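/- Work over $\mathbb{C}$. Let $G=G(2,4)$ be the Grassmannian of two-dimensional subspaces $\ell\subseteq\mathbb{C}^4$ (lines in $\mathbb{P}^3$), let $X=G\times\mathbb{P}^3$ with projection $\pi:X\to G$, and let $Z=\{(\ell,p): p\in\ell\}\subseteq X$ be the incidence variety with ideal sheaf $I_Z$. For $d\in\mathbb{Z}$ let $\mathcal{O}_X(d)$ be the pull-back of $\mathcal{O}_{\mathbb{P}^3}(d)$ and $I_Z^k(d)=I_Z^k\otimes\mathcal{O}_X(d)$. Let $\nu$ be the dual of the quotient bundle $\mathcal{O}_G^4/\tau$, where $\tau$ is the tautological subbundle, so that the fibre of $\nu$ at $\ell$ is the space of linear functionals on $\mathbb{C}^4$ vanishing on $\ell$. Let $P(m)$ be the space of homogeneous polynomials of degree $m$ in four variables ($P(m)=0$ for $m<0$), and let $V_{k,d}\subseteq\mathcal{O}_G\otimes P(d)$ be the vector bundle whose fibre at $\ell$ is the space of $f\in P(d)$ vanishing to order $k$ along $\ell$, i.e. lying in the $k$-th power of the homogeneous ideal of $\ell$. Let $k\ge 1$ and $d$ be integers. 1. If $d\ge k-2$, then $R\pi_*\,I_Z^k(d)$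 has no higher cohomology: $R^i\pi_*\,I_Z^k(d)=0$ for all $i\ge 1$. 2. If $d\ge k-3$, then there is a short exact sequence of vector bundles on $G$ $$0\to \wedge^2\nu\otimes \mathrm{Sym}^{k-1}\nu\otimes_{\mathbb{C}} P(d-k-1)\xrightarrow{\ \alpha\ } \mathrm{Sym}^k\nu\otimes_{\mathbb{C}} P(d-k)\xrightarrow{\ \beta\ } V_{k,d}\to 0,$$ where, on fibres, $\alpha\big((a\wedge b)\otimes s\otimes p\big)=(as)\otimes(bp)-(bs)\otimes(ap)$, and $\beta$ is the multiplication of polynomials, $\beta(a_1\cdots a_k\otimes p)=a_1\cdots a_k\,p$ (linear functionals on $\mathbb{C}^4$ being regarded as linear forms). -/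

import Mathlib

open CategoryTheory TopologicalSpace Opposite
open scoped TensorProduct

noncomputable section

namespace LineSing

/-! ### Classical complex varieties presented by coordinates

The spaces below are sets of closed points `Pt`, presented as the image of a subset `Rep` of an
affine space `ℂ ^ Idx` (think of homogeneous coordinates, or of Stiefel coordinates on a
Grassmannian).  The topology is the quotient of the Zariski topology, and a regular function is a
function whose pull-back to `Rep` is locally a quotient of polynomials. -/

structure CoordSpace where
  Pt : Type
  Idx : Type
  Rep : Set (Idx → ℂ)
  pr : Rep → Pt
  pr_surjective : Function.Surjective pr

namespace CoordSpace

variable (X : CoordSpace)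

/-- The quotient of the Zariski topology on `Rep`: the sets `{a | g a ≠ 0}`, for polynomials `g`,
are a basis of the Zariski topology on `Rep`. -/
instance zariski : TopologicalSpace X.Pt where
  IsOpen U := ∀ a : X.Rep, X.pr a ∈ U → ∃ g : MvPolynomial X.Idx ℂ,
    MvPolynomial.eval a.1 g ≠ 0 ∧ ∀ b : X.Rep, MvPolynomial.eval b.1 g ≠ 0 → X.pr b ∈ U
  isOpen_univ := fun _ _ => ⟨1, by simp, fun _ _ => Set.mem_univ _⟩
  isOpen_inter := by
    intro U W hU hW a ha
    obtain ⟨g, hg, hgU⟩ := hU a ha.1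
    obtain ⟨h, hh, hhW⟩ := hW a ha.2
    refine ⟨g * h, by simpa using ⟨hg, hh⟩, fun b hb => ?_⟩
    rw [map_mul] at hb
    exact ⟨hgU b (left_ne_zero_of_mul hb), hhW b (right_ne_zero_of_mul hb)⟩
  isOpen_sUnion := by
    rintro S hS a ⟨U, hU, ha⟩
    obtain ⟨g, hg, hgU⟩ := hS U hU a ha
    exact ⟨g, hg, fun b hb => ⟨U, hU, hgU b hb⟩⟩

/-- The underlying topological space (Zariski topology). -/
abbrev top : TopCat.{0} := TopCat.of X.Pt

variable {X}

/-- A function on the part of `Rep` lying over `U` is regular if it is locally a quotient of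
polynomials. -/
def RegularOn (U : Opens X.Pt) (h : ∀ a : X.Rep, X.pr a ∈ U → ℂ) : Prop :=
  ∀ (a : X.Rep), X.pr a ∈ U → ∃ F G : MvPolynomial X.Idx ℂ,
    MvPolynomial.eval a.1 G ≠ 0 ∧
    ∀ (b : X.Rep) (hb : X.pr b ∈ U), MvPolynomial.eval b.1 G ≠ 0 →
      h b hb = MvPolynomial.eval b.1 F / MvPolynomial.eval b.1 G

theorem RegularOn.add {U : Opens X.Pt} {h₁ h₂ : ∀ a : X.Rep, X.pr a ∈ U → ℂ}
    (H₁ : RegularOn U h₁) (H₂ : RegularOn U h₂) :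
    RegularOn U (fun a ha => h₁ a ha + h₂ a ha) := by
  intro a ha
  obtain ⟨F₁, G₁, hG₁, e₁⟩ := H₁ a ha
  obtain ⟨F₂, G₂, hG₂, e₂⟩ := H₂ a ha
  refine ⟨F₁ * G₂ + G₁ * F₂, G₁ * G₂, by simpa using ⟨hG₁, hG₂⟩, fun b hb hG => ?_⟩
  rw [map_mul] at hG
  have n₁ := left_ne_zero_of_mul hG
  have n₂ := right_ne_zero_of_mul hG
  change h₁ b hb + h₂ b hb = _
  rw [e₁ b hb n₁, e₂ b hb n₂, div_add_div _ _ n₁ n₂]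
  simp

theorem RegularOn.mul {U : Opens X.Pt} {h₁ h₂ : ∀ a : X.Rep, X.pr a ∈ U → ℂ}
    (H₁ : RegularOn U h₁) (H₂ : RegularOn U h₂) :
    RegularOn U (fun a ha => h₁ a ha * h₂ a ha) := by
  intro a ha
  obtain ⟨F₁, G₁, hG₁, e₁⟩ := H₁ a ha
  obtain ⟨F₂, G₂, hG₂, e₂⟩ := H₂ a ha
  refine ⟨F₁ * F₂, G₁ * G₂, by simpa using ⟨hG₁, hG₂⟩, fun b hb hG => ?_⟩
  rw [map_mul] at hG
  change h₁ b hb * h₂ b hb = _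
  rw [e₁ b hb (left_ne_zero_of_mul hG), e₂ b hb (right_ne_zero_of_mul hG), div_mul_div_comm]
  simp

theorem RegularOn.const {U : Opens X.Pt} (c : ℂ) :
    RegularOn U (fun _ _ => c) := fun _ _ =>
  ⟨MvPolynomial.C c, 1, by simp, fun b hb _ => by simp⟩

theorem RegularOn.res {U W : Opens X.Pt} (i : W ≤ U)
    {h : ∀ a : X.Rep, X.pr a ∈ U → ℂ} (H : RegularOn U h) :
    RegularOn W (fun a ha => h a (i ha)) := by
  intro a ha
  obtain ⟨F, G, hG, e⟩ := H a (i ha)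
  exact ⟨F, G, hG, fun b hb => e b (i hb)⟩

theorem RegularOn.glue {U : Opens X.Pt} {h : ∀ a : X.Rep, X.pr a ∈ U → ℂ}
    (H : ∀ x ∈ U, ∃ (W : Opens X.Pt) (i : W ≤ U), x ∈ W ∧
      RegularOn W (fun a ha => h a (i ha))) : RegularOn U h := by
  intro a ha
  obtain ⟨W, i, hW, HW⟩ := H _ ha
  obtain ⟨F, G, hG, e⟩ := HW a hW
  obtain ⟨g, hg, hgW⟩ := W.2 a hW
  refine ⟨F * g, G * g, by simpa using ⟨hG, hg⟩, fun b hb hGb => ?_⟩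
  rw [map_mul] at hGb
  have n₁ := left_ne_zero_of_mul hGb
  have n₂ := right_ne_zero_of_mul hGb
  rw [map_mul, map_mul, mul_div_mul_right _ _ n₂]
  exact e b (hgW b n₂) n₁

variable (X)

/-- The ring `𝒪_X(U)` of regular functions on `U`. -/
def O (U : Opens X.Pt) : Subalgebra ℂ (U → ℂ) where
  carrier := {f | RegularOn U (fun a ha => f ⟨X.pr a, ha⟩)}
  mul_mem' := fun hf hg => RegularOn.mul hf hg
  add_mem' := fun hf hg => RegularOn.add hf hg
  algebraMap_mem' := fun c => RegularOn.const c

variable {X}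

/-- Restriction of a family of vectors over `U` to `W ⊆ U`. -/
def res {fiber : X.Pt → Type} {U W : Opens X.Pt} (i : W ≤ U) (s : ∀ x : U, fiber x.1) :
    ∀ x : W, fiber x.1 := fun x => s ⟨x.1, i x.2⟩

theorem O.res_mem {U W : Opens X.Pt} (i : W ≤ U) {f : U → ℂ} (hf : f ∈ X.O U) :
    (fun x : W => f ⟨x.1, i x.2⟩) ∈ X.O W := RegularOn.res i hf

theorem O.glue {U : Opens X.Pt} {f : U → ℂ}
    (H : ∀ x ∈ U, ∃ (W : Opens X.Pt) (i : W ≤ U), x ∈ W ∧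
      (fun x : W => f ⟨x.1, i x.2⟩) ∈ X.O W) : f ∈ X.O U := RegularOn.glue H

end CoordSpace

open CoordSpace

/-! ### Sheaves of modules whose sections are families of vectors -/

/-- A sheaf of `𝒪_X`-modules whose sections over `U` are some of the families
`(s x ∈ fiber x)_{x ∈ U}`. -/
structure FamSheaf (X : CoordSpace) where
  fiber : X.Pt → Type
  [grp : ∀ x, AddCommGroup (fiber x)]
  [mod : ∀ x, Module ℂ (fiber x)]
  sec : ∀ U : Opens X.Pt, Submodule (X.O U) (∀ x : U, fiber x.1)
  res_mem : ∀ {U W : Opens X.Pt} (i : W ≤ U) (s : ∀ x : U, fiber x.1),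
    s ∈ sec U → res i s ∈ sec W
  glue : ∀ {U : Opens X.Pt} (s : ∀ x : U, fiber x.1),
    (∀ x ∈ U, ∃ (W : Opens X.Pt) (i : W ≤ U), x ∈ W ∧ res i s ∈ sec W) → s ∈ sec U

attribute [instance] FamSheaf.grp FamSheaf.mod

namespace FamSheaf

variable {X : CoordSpace}

/-- The sections that, locally, are `𝒪_X`-linear combinations of members of `gen`. -/
def locallySpanned (fiber : X.Pt → Type) [∀ x, AddCommGroup (fiber x)]
    [∀ x, Module ℂ (fiber x)] (gen : ∀ U : Opens X.Pt, Set (∀ x : U, fiber x.1))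
    (gen_res : ∀ {U W : Opens X.Pt} (i : W ≤ U) (s : ∀ x : U, fiber x.1),
      s ∈ gen U → res i s ∈ gen W) : FamSheaf X :=
  have span_res : ∀ {U W : Opens X.Pt} (i : W ≤ U) (s : ∀ x : U, fiber x.1),
      s ∈ Submodule.span (X.O U) (gen U) → res i s ∈ Submodule.span (X.O W) (gen W) := by
    intro U W i s hs
    induction hs using Submodule.span_induction with
    | mem s hs => exact Submodule.subset_span (gen_res i s hs)
    | zero => exact Submodule.zero_mem _
    | add s t _ _ hs ht => exact Submodule.add_mem _ hs ht
    | smul f s _ hs =>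
      exact Submodule.smul_mem _ (⟨_, O.res_mem i f.2⟩ : X.O W) hs
  { fiber := fiber
    sec := fun U =>
      { carrier := {s | ∀ x ∈ U, ∃ (W : Opens X.Pt) (i : W ≤ U), x ∈ W ∧
          res i s ∈ Submodule.span (X.O W) (gen W)}
        zero_mem' := fun x hx => ⟨U, le_rfl, hx, Submodule.zero_mem _⟩
        add_mem' := by
          intro s t hs ht x hx
          obtain ⟨W₁, i₁, h₁, m₁⟩ := hs x hx
          obtain ⟨W₂, i₂, h₂, m₂⟩ := ht x hx
          exact ⟨W₁ ⊓ W₂, inf_le_left.trans i₁, ⟨h₁, h₂⟩,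
            Submodule.add_mem _ (span_res inf_le_left _ m₁) (span_res inf_le_right _ m₂)⟩
        smul_mem' := by
          intro f s hs x hx
          obtain ⟨W, i, h, m⟩ := hs x hx
          exact ⟨W, i, h, Submodule.smul_mem _ (⟨_, O.res_mem i f.2⟩ : X.O W) m⟩ }
    res_mem := by
      intro U W i s hs x hx
      obtain ⟨W', i', h, m⟩ := hs x (i hx)
      exact ⟨W' ⊓ W, inf_le_right, ⟨h, hx⟩, span_res inf_le_left _ m⟩
    glue := by
      intro U s H x hx
      obtain ⟨W, i, h, m⟩ := H x hx
      obtain ⟨W', i', h', m'⟩ := m x h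
      exact ⟨W', i'.trans i, h', m'⟩ }

/-- The sheaf of regular maps `s` to the vector space `M` with `s x ∈ E x` for all `x`; here `s`
is regular if all its coordinates `φ ∘ s`, for linear functionals `φ`, are regular functions. -/
def sub (M : Type) [AddCommGroup M] [Module ℂ M] (E : X.Pt → Submodule ℂ M) : FamSheaf X where
  fiber x := E x
  sec U :=
    { carrier := {s | ∀ φ : M →ₗ[ℂ] ℂ, (fun x : U => φ (s x)) ∈ X.O U}
      zero_mem' := fun φ => by
        have : (fun x : U => φ ((0 : ∀ x : U, E x.1) x)) = 0 := by
          ext x; simp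
        rw [this]; exact zero_mem _
      add_mem' := by
        intro s t hs ht φ
        have : (fun x : U => φ ((s + t) x)) = (fun x : U => φ (s x)) + fun x : U => φ (t x) := by
          ext x; simp
        rw [this]; exact add_mem (hs φ) (ht φ)
      smul_mem' := by
        intro f s hs φ
        have : (fun x : U => φ ((f • s) x)) = f.1 * fun x : U => φ (s x) := by
          ext x; exact φ.map_smul (f.1 x) _
        rw [this]; exact mul_mem f.2 (hs φ) }
  res_mem := fun i s hs φ => O.res_mem i (hs φ)
  glue := by
    intro U s H φ
    refine O.glue fun x hx => ?_
    obtain ⟨W, i, h, m⟩ := H x hx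
    exact ⟨W, i, h, m φ⟩

/-- The tensor product of `E` and `F`: locally generated by the sections `s ⊗ t`. -/
def tensor (E F : FamSheaf X) : FamSheaf X :=
  locallySpanned (fun x => E.fiber x ⊗[ℂ] F.fiber x)
    (fun U => {u | ∃ s ∈ E.sec U, ∃ t ∈ F.sec U, u = fun x => s x ⊗ₜ[ℂ] t x})
    (by
      rintro U W i _ ⟨s, hs, t, ht, rfl⟩
      exact ⟨_, E.res_mem i s hs, _, F.res_mem i t ht, rfl⟩)

/-- The second exterior power of `E`: locally generated by the sections `s ∧ t`. -/
def wedge2 (E : FamSheaf X) : FamSheaf X :=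
  locallySpanned (fun x => ⋀[ℂ]^2 (E.fiber x))
    (fun U => {u | ∃ s ∈ E.sec U, ∃ t ∈ E.sec U,
      u = fun x => exteriorPower.ιMulti ℂ 2 ![s x, t x]})
    (by
      rintro U W i _ ⟨s, hs, t, ht, rfl⟩
      exact ⟨_, E.res_mem i s hs, _, E.res_mem i t ht, rfl⟩)

/-- The `n`-th symmetric power of a vector space: the degree `n` part of the symmetric algebra. -/
abbrev SymPow (n : ℕ) (M : Type) [AddCommGroup M] [Module ℂ M] :
    Submodule ℂ (SymmetricAlgebra ℂ M) :=
  LinearMap.range (SymmetricAlgebra.ι ℂ M) ^ n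

/-- The `n`-th symmetric power of `E`: locally generated by the products `s₁ ⋯ sₙ` of sections. -/
def sym (n : ℕ) (E : FamSheaf X) : FamSheaf X :=
  locallySpanned (fun x => SymPow n (E.fiber x))
    (fun U => {u | ∃ s : Fin n → ∀ x : U, E.fiber x.1, (∀ j, s j ∈ E.sec U) ∧
      ∀ x : U, (u x : SymmetricAlgebra ℂ (E.fiber x.1)) =
        ∏ j, SymmetricAlgebra.ι ℂ (E.fiber x.1) (s j x)})
    (by
      rintro U W i u ⟨s, hs, hu⟩
      exact ⟨fun j => res i (s j), fun j => E.res_mem i _ (hs j), fun x => hu ⟨x.1, i x.2⟩⟩)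

/-- `E` is an algebraic vector bundle with the given fibres: every point has a neighbourhood with
a frame of sections, such that a family is a section exactly when its coordinates are regular. -/
def IsVectorBundle (E : FamSheaf X) : Prop :=
  ∀ x : X.Pt, ∃ U : Opens X.Pt, x ∈ U ∧ ∃ (n : ℕ) (e : ∀ y : U, Module.Basis (Fin n) ℂ (E.fiber y.1)),
    ∀ (W : Opens X.Pt) (i : W ≤ U) (s : ∀ y : W, E.fiber y.1),
      s ∈ E.sec W ↔ ∀ j, (fun y : W => (e ⟨y.1, i y.2⟩).repr (s y) j) ∈ X.O W

/-- A family of linear maps between the fibres is a morphism if it maps sections to sections. -/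
def IsMorphism {E F : FamSheaf X} (α : ∀ x, E.fiber x →ₗ[ℂ] F.fiber x) : Prop :=
  ∀ (U : Opens X.Pt) (s : ∀ x : U, E.fiber x.1), s ∈ E.sec U → (fun x : U => α x.1 (s x)) ∈ F.sec U

/-- `0 → E → F → G → 0` is a short exact sequence of vector bundles: it is a sequence of morphisms
of vector bundles that is exact on every fibre, and exact on sheaves of sections. -/
structure IsShortExact {E F G : FamSheaf X} (α : ∀ x, E.fiber x →ₗ[ℂ] F.fiber x)
    (β : ∀ x, F.fiber x →ₗ[ℂ] G.fiber x) : Prop where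
  bundle_left : E.IsVectorBundle
  bundle_mid : F.IsVectorBundle
  bundle_right : G.IsVectorBundle
  morphism_left : IsMorphism α
  morphism_right : IsMorphism β
  fiber_injective : ∀ x, Function.Injective (α x)
  fiber_exact : ∀ x, Function.Exact (α x) (β x)
  fiber_surjective : ∀ x, Function.Surjective (β x)
  sheaf_injective : ∀ (U : Opens X.Pt), ∀ s ∈ E.sec U, (∀ x : U, α x.1 (s x) = 0) → s = 0
  sheaf_exact : ∀ (U : Opens X.Pt), ∀ t ∈ F.sec U, (∀ x : U, β x.1 (t x) = 0) →
    ∃ s ∈ E.sec U, ∀ x : U, α x.1 (s x) = t x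
  sheaf_surjective : ∀ (U : Opens X.Pt), ∀ u ∈ G.sec U, ∀ x ∈ U,
    ∃ (W : Opens X.Pt) (i : W ≤ U), x ∈ W ∧
      ∃ t ∈ F.sec W, ∀ y : W, β y.1 (t y) = u ⟨y.1, i y.2⟩

/-- The underlying presheaf of abelian groups. -/
def toPresheaf (E : FamSheaf X) : TopCat.Presheaf AddCommGrpCat.{0} X.top where
  obj U := AddCommGrpCat.of (E.sec U.unop)
  map {U W} i := AddCommGrpCat.ofHom
    { toFun := fun s => ⟨res i.unop.le s.1, E.res_mem i.unop.le s.1 s.2⟩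
      map_zero' := rfl
      map_add' := fun _ _ => rfl }

/-- Being a section is a local condition. -/
def localPredicate (E : FamSheaf X) : TopCat.LocalPredicate (X := X.top) E.fiber where
  pred {U} s := s ∈ E.sec U
  res i s hs := E.res_mem i.le s hs
  locality {U} s H := E.glue s fun x hx => by
    obtain ⟨W, hW, i, h⟩ := H ⟨x, hx⟩
    exact ⟨W, i.le, hW, h⟩

theorem toPresheaf_isSheaf (E : FamSheaf X) : E.toPresheaf.IsSheaf :=
  (TopCat.Presheaf.isSheaf_iff_isSheaf_comp (forget AddCommGrpCat.{0}) E.toPresheaf).mpr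
    (TopCat.Presheaf.isSheaf_of_iso
      (NatIso.ofComponents (fun _ => Iso.refl _) :
        TopCat.subpresheafToTypes E.localPredicate.toPrelocalPredicate ≅
          E.toPresheaf ⋙ forget AddCommGrpCat.{0})
      (TopCat.subpresheafToTypes.isSheaf E.localPredicate))

/-- The underlying sheaf of abelian groups. -/
def toSheaf (E : FamSheaf X) : TopCat.Sheaf AddCommGrpCat.{0} X.top :=
  ⟨E.toPresheaf, E.toPresheaf_isSheaf⟩

end FamSheaf

/-! ### The Grassmannian of lines in projective space -/

/-- The points of `G(2,4)`: the two-dimensional subspaces of `ℂ⁴`, i.e. the lines in `ℙ³`. -/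
abbrev Line : Type := {ℓ : Submodule ℂ (Fin 4 → ℂ) // Module.finrank ℂ ℓ = 2}

/-- The rows of a `2 × 4` matrix. -/
abbrev rows (A : Fin 2 × Fin 4 → ℂ) : Fin 2 → Fin 4 → ℂ := fun i j => A (i, j)

/-- The row span of a `2 × 4` matrix of rank two. -/
def spanLine (A : Fin 2 × Fin 4 → ℂ) (hA : LinearIndependent ℂ (rows A)) : Line :=
  ⟨Submodule.span ℂ (Set.range (rows A)), by
    rw [finrank_span_eq_card hA, Fintype.card_fin]⟩

theorem spanLine_surjective (ℓ : Line) : ∃ A, ∃ hA : LinearIndependent ℂ (rows A),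
    spanLine A hA = ℓ := by
  let b := Module.finBasisOfFinrankEq ℂ ℓ.1 ℓ.2
  have hb : LinearIndependent ℂ (fun i => (b i : Fin 4 → ℂ)) :=
    b.linearIndependent.map' ℓ.1.subtype (Submodule.ker_subtype _)
  refine ⟨fun p => (b p.1 : Fin 4 → ℂ) p.2, hb, Subtype.ext ?_⟩
  change Submodule.span ℂ (Set.range (fun i => ℓ.1.subtype (b i))) = ℓ.1
  rw [show (fun i => ℓ.1.subtype (b i)) = ℓ.1.subtype ∘ b from rfl, Set.range_comp,
    ← Submodule.map_span, b.span_eq, Submodule.map_top, Submodule.range_subtype]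

/-- `G(2,4)`, as the quotient of the space of `2 × 4` matrices of rank two by `GL₂`. -/
def Gr : CoordSpace where
  Pt := Line
  Idx := Fin 2 × Fin 4
  Rep := {A | LinearIndependent ℂ (rows A)}
  pr A := spanLine A.1 A.2
  pr_surjective ℓ := by
    obtain ⟨A, hA, h⟩ := spanLine_surjective ℓ
    exact ⟨⟨A, hA⟩, h⟩

/-- The line corresponding to a point of `G(2,4)`. -/
def Gr.line (ℓ : Gr.Pt) : Submodule ℂ (Fin 4 → ℂ) := (show Line from ℓ).1

/-- `ν`, the dual of the quotient bundle `𝒪⁴/τ`: its fibre at `ℓ` is the space of linear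
functionals on `ℂ⁴` vanishing on `ℓ`. -/
def nu : FamSheaf Gr :=
  FamSheaf.sub (Module.Dual ℂ (Fin 4 → ℂ)) fun ℓ => (Gr.line ℓ).dualAnnihilator

/-- `P(m)`: homogeneous polynomials of degree `m` in four variables; zero if `m < 0`. -/
def P (m : ℤ) : Submodule ℂ (MvPolynomial (Fin 4) ℂ) :=
  if 0 ≤ m then MvPolynomial.homogeneousSubmodule (Fin 4) ℂ m.toNat else ⊥

/-- The trivial bundle `𝒪 ⊗ P(m)` on `G(2,4)`. -/
def trivP (m : ℤ) : FamSheaf Gr := FamSheaf.sub (MvPolynomial (Fin 4) ℂ) fun _ => P m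

/-- The ideal of polynomials vanishing on `ℓ`. -/
def lineIdeal (ℓ : Gr.Pt) : Ideal (MvPolynomial (Fin 4) ℂ) :=
  MvPolynomial.vanishingIdeal ℂ (Gr.line ℓ : Set (Fin 4 → ℂ))

/-- `V_{k,d}`: its fibre at `ℓ` is the space of homogeneous polynomials of degree `d` that vanish
to order `k` along `ℓ`, i.e. that lie in the `k`-th power of the ideal of `ℓ`. -/
def V (k : ℕ) (d : ℤ) : FamSheaf Gr :=
  FamSheaf.sub (MvPolynomial (Fin 4) ℂ) fun ℓ =>
    P d ⊓ (lineIdeal ℓ ^ k).restrictScalars ℂ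

/-- A linear functional on `ℂ⁴`, as a linear form in four variables. -/
def linForm : Module.Dual ℂ (Fin 4 → ℂ) →ₗ[ℂ] MvPolynomial (Fin 4) ℂ :=
  ∑ j : Fin 4, (LinearMap.toSpanSingleton ℂ _ (MvPolynomial.X j)).comp
    (LinearMap.applyₗ (Pi.single j 1 : Fin 4 → ℂ))

/-- The linear form given by an element of a fibre of `ν`. -/
def nuForm (ℓ : Gr.Pt) : nu.fiber ℓ →ₗ[ℂ] MvPolynomial (Fin 4) ℂ :=
  linForm.comp (Gr.line ℓ).dualAnnihilator.subtype

/-! ### The product `X = G(2,4) × ℙ³` and the incidence variety -/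

/-- The vector part of a coordinate vector on `G(2,4) × ℙ³`. -/
abbrev vec (a : (Fin 2 × Fin 4) ⊕ Fin 4 → ℂ) : Fin 4 → ℂ := fun j => a (Sum.inr j)

/-- The matrix part of a coordinate vector on `G(2,4) × ℙ³`. -/
abbrev mat (a : (Fin 2 × Fin 4) ⊕ Fin 4 → ℂ) : Fin 2 × Fin 4 → ℂ := fun p => a (Sum.inl p)

/-- `X = G(2,4) × ℙ³`, as the quotient of the space of pairs of a `2 × 4` matrix of rank two and a
nonzero vector by `GL₂ × ℂˣ`. -/
def GrP : CoordSpace where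
  Pt := Line × Projectivization ℂ (Fin 4 → ℂ)
  Idx := (Fin 2 × Fin 4) ⊕ Fin 4
  Rep := {a | LinearIndependent ℂ (rows (mat a)) ∧ vec a ≠ 0}
  pr a := (spanLine (mat a.1) a.2.1, Projectivization.mk ℂ (vec a.1) a.2.2)
  pr_surjective := by
    rintro ⟨ℓ, p⟩
    obtain ⟨A, hA, h⟩ := spanLine_surjective ℓ
    exact ⟨⟨Sum.elim A p.rep, hA, p.rep_nonzero⟩, Prod.ext h p.mk_rep⟩

/-- The line component of a point of `X`. -/
def GrP.line (x : GrP.Pt) : Submodule ℂ (Fin 4 → ℂ) :=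
  (show Line × Projectivization ℂ (Fin 4 → ℂ) from x).1.1

/-- The point component of a point of `X`. -/
def GrP.point (x : GrP.Pt) : Projectivization ℂ (Fin 4 → ℂ) :=
  (show Line × Projectivization ℂ (Fin 4 → ℂ) from x).2

/-- The projection `π : G(2,4) × ℙ³ → G(2,4)`. -/
def proj : GrP.top ⟶ Gr.top :=
  TopCat.ofHom
    { toFun := fun x : GrP.Pt => (Prod.fst x : Line)
      continuous_toFun := by
        refine ⟨fun U hU => ?_⟩
        intro a ha
        obtain ⟨g, hg, hgU⟩ := hU ⟨mat a.1, a.2.1⟩ ha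
        have key : ∀ b : GrP.Rep, MvPolynomial.eval b.1 (MvPolynomial.rename
            (Sum.inl : Fin 2 × Fin 4 → (Fin 2 × Fin 4) ⊕ Fin 4) g) =
            MvPolynomial.eval (mat b.1) g := fun b => MvPolynomial.eval_rename _ _ _
        exact ⟨MvPolynomial.rename Sum.inl g, fun h => hg ((key a).symm.trans h),
          fun b hb => hgU ⟨mat b.1, b.2.1⟩ fun h => hb ((key b).trans h)⟩ }

/-- The incidence variety `Z ⊆ X` of pairs of a line and a point on this line. -/
def Z : Set GrP.Pt := {x | (GrP.point x).submodule ≤ GrP.line x}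

/-- The ideal `I_Z(U) ⊆ 𝒪_X(U)` of the regular functions vanishing on `Z`. -/
def idealZ (U : Opens GrP.Pt) : Ideal (GrP.O U) where
  carrier := {f | ∀ x : U, x.1 ∈ Z → f.1 x = 0}
  zero_mem' := fun _ _ => rfl
  add_mem' := fun {f g} hf hg x hx => by
    change f.1 x + g.1 x = 0
    rw [hf x hx, hg x hx, add_zero]
  smul_mem' := fun f g hg x hx => by
    change f.1 x * g.1 x = 0
    rw [hg x hx, mul_zero]

/-- The nonzero vectors spanning a point of `ℙ³`. -/
abbrev Cone (p : Projectivization ℂ (Fin 4 → ℂ)) : Type :=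
  {v : Fin 4 → ℂ // ∃ hv : v ≠ 0, Projectivization.mk ℂ v hv = p}

/-- The fibre of `𝒪(d)` at a point `p` of `ℙ³`: functions on the nonzero vectors spanning `p` that
are homogeneous of degree `d`. -/
def twistFiber (d : ℤ) (p : Projectivization ℂ (Fin 4 → ℂ)) : Submodule ℂ (Cone p → ℂ) where
  carrier := {f | ∀ (v w : Cone p) (t : ℂ), w.1 = t • v.1 → f w = t ^ d * f v}
  zero_mem' := fun _ _ _ _ => by simp
  add_mem' := fun hf hg v w t h => by
    simp only [Pi.add_apply]; rw [hf v w t h, hg v w t h, mul_add]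
  smul_mem' := fun c f hf v w t h => by
    simp only [Pi.smul_apply, smul_eq_mul]; rw [hf v w t h]; ring

/-- The value of a family `s` of elements of the fibres of `𝒪_X(d)` in coordinates. -/
def twistEval {d : ℤ} {U : Opens GrP.Pt} (s : ∀ x : U, twistFiber d (GrP.point x.1))
    (a : GrP.Rep) (ha : GrP.pr a ∈ U) : ℂ :=
  (s ⟨GrP.pr a, ha⟩).1 ⟨vec a.1, a.2.2, rfl⟩

/-- The line bundle `𝒪_X(d)`, the pull-back of `𝒪(d)` from `ℙ³`. -/
def twist (d : ℤ) : FamSheaf GrP where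
  fiber x := twistFiber d (GrP.point x)
  sec U :=
    { carrier := {s | RegularOn U (twistEval s)}
      zero_mem' := RegularOn.const 0
      add_mem' := fun hs ht => RegularOn.add hs ht
      smul_mem' := fun f _ hs => RegularOn.mul f.2 hs }
  res_mem := fun i _ hs => RegularOn.res i hs
  glue := fun _ H => RegularOn.glue H

/-- `I_Z^k(d) = I_Z^k ⊗ 𝒪_X(d)`, as the subsheaf `I_Z^k · 𝒪_X(d)` of `𝒪_X(d)`: it is locally
generated by the products `f • s` with `f` in the `k`-th power of the ideal `I_Z(U)` and `s` a
section of `𝒪_X(d)`. -/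
def idealPow (k : ℕ) (d : ℤ) : FamSheaf GrP :=
  FamSheaf.locallySpanned (fun x => (twist d).fiber x)
    (fun U => {u | ∃ f ∈ idealZ U ^ k, ∃ s ∈ (twist d).sec U, u = f • s})
    (by
      rintro U W i _ ⟨f, hf, s, hs, rfl⟩
      let r : GrP.O U →+* GrP.O W :=
        { toFun := fun g => ⟨_, O.res_mem i g.2⟩
          map_one' := rfl
          map_mul' := fun _ _ => rfl
          map_zero' := rfl
          map_add' := fun _ _ => rfl }
      have hr : Ideal.map r (idealZ U) ≤ idealZ W :=
        Ideal.map_le_iff_le_comap.mpr fun g hg x hx => hg ⟨x.1, i x.2⟩ hx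
      refine ⟨r f, ?_, res i s, (twist d).res_mem i s hs, rfl⟩
      have := Ideal.mem_map_of_mem r hf
      rw [Ideal.map_pow] at this
      exact Ideal.pow_right_mono hr k this)

/-- Direct image of sheaves of abelian groups is an additive functor. -/
instance pushforward_additive {X Y : TopCat.{0}} (f : X ⟶ Y) :
    (TopCat.Sheaf.pushforward AddCommGrpCat.{0} f).Additive where
  map_add := rfl

/-- The higher direct images `R^i f_*` of sheaves of abelian groups. -/
def higherDirectImage {X Y : TopCat.{0}} (f : X ⟶ Y) (i : ℕ) :
    TopCat.Sheaf AddCommGrpCat.{0} X ⥤ TopCat.Sheaf AddCommGrpCat.{0} Y :=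
  (TopCat.Sheaf.pushforward AddCommGrpCat.{0} f).rightDerived i

end LineSing

end

/-!
The two assertions are local on the Grassmannian, which is covered by charts isomorphic to `ℂ⁴`:
`chartLine σ t` is the line `x_{σ i} = t_{i0} x_{σ 2} + t_{i1} x_{σ 3}`, `i = 0, 1`. Over a chart,
`ℙ³` has homogeneous coordinates `y₀, …, y₃` in which `Z` is given by `y₀ = y₁ = 0`.

**Direct images.** In these coordinates the sections of `I_Z^k(d)` are the functions, homogeneous of
degree `d`, that are locally quotients of polynomials with numerator in `(y₀, y₁)^k`
(`mem_sec_iff`). Where a homogeneous `G` of positive degree does not vanish, the Nullstellensatz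
provides a common denominator `G ^ N` (`exists_numerator`) and partitions of unity, so that these
open sets behave like affine ones (`isAffineBasis_basics`, `affineAcyclic_basics`). Hence it
suffices that the Čech complexes of the covers `g y_i ≠ 0`, where `g` is a function on the chart,
are exact in positive degrees (`isZero_rightDerived_pushforward`): along an injective resolution,
both kinds of acyclicity pass from the kernel of one differential to the kernel of the next. The
Čech complex decomposes into pieces indexed by monomials. A monomial `y^m / (y₀ y₁ y₂ y₃)^N` occurs
over the intersection of the sets with indices in `I` if and only if its exponents outside `I` are
nonnegative and, in case `0, 1 ∉ I`, the exponents of `y₀` and `y₁` add up to at least `k`. If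
`d ≥ k - 2`, then there is an index whose removal from `I` never matters (`exists_pivot`): either
the exponents of `y₀` and `y₁` add up to at least `k`, and one of them is nonnegative, or those of `y₂`
and `y₃` add up to at least `d - k + 1 ≥ -1`, and one of these is nonnegative. Such an index
contracts the piece (`cechAcyclic_yCover`).

**The exact sequence.** A linear change of variables, regular in `t`, takes the line with
coordinates `t` to the line `X₀ = X₁ = 0` (`down`, `up`). It trivializes all the bundles over the
chart (`trivNu`, `trivTrivP`, `trivV`) and turns `α` and `β` into the maps of the standard line, so
that it suffices to prove exactness for the latter (`isShortExact_of_triv`). There, elements of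
`Symᵏ ⊗ P(d - k)` are families of coefficients of the monomials `X₀ⁱ X₁ᵏ⁻ⁱ`; if they are written as
polynomials in a further variable `T`, then `α` is the multiplication by `X₁ T - X₀`, which is
injective (`genFun_alpha_wedgeSum`). The kernel of `β` consists of the syzygies of the monomials,
and these are generated by the syzygies between neighbours, which make up the image of `α`
(`exists_syzygy`). The map `β` is surjective because the coefficients in a representation of an
element of `(X₀, X₁)^k` may be taken homogeneous (`exists_eq_sum_homogeneous`).
-/

noncomputable section

namespace LineSing

/-! ### Sheaves of abelian groups through their sections -/

namespace AbSheaf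

variable {X : TopCat.{0}}

/-- Restriction of sections. -/
def rs (F : TopCat.Sheaf AddCommGrpCat.{0} X) {U V : Opens X} (h : V ≤ U) :
    F.obj.obj (op U) →+ F.obj.obj (op V) := (F.obj.map (homOfLE h).op).hom

/-- The map induced on sections by a morphism of sheaves. -/
def ap {F G : TopCat.Sheaf AddCommGrpCat.{0} X} (φ : F ⟶ G) (U : Opens X) :
    F.obj.obj (op U) →+ G.obj.obj (op U) := (φ.hom.app (op U)).hom

variable {F G H : TopCat.Sheaf AddCommGrpCat.{0} X} {U V W : Opens X}

theorem rs_rs (h : V ≤ U) (h' : W ≤ V) (s : F.obj.obj (op U)) :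
    rs F h' (rs F h s) = rs F (h'.trans h) s := by
  change (F.obj.map (homOfLE h).op ≫ F.obj.map (homOfLE h').op).hom s = _
  rw [← F.obj.map_comp]
  rfl

theorem rs_self (h : U ≤ U) (s : F.obj.obj (op U)) : rs F h s = s := by
  change (F.obj.map (𝟙 (op U))).hom s = s
  rw [F.obj.map_id]
  rfl

theorem ap_rs (φ : F ⟶ G) (h : V ≤ U) (s : F.obj.obj (op U)) :
    ap φ V (rs F h s) = rs G h (ap φ U s) := by
  change (F.obj.map (homOfLE h).op ≫ φ.hom.app (op V)).hom s = _
  rw [φ.hom.naturality]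
  rfl

theorem ap_comp (φ : F ⟶ G) (ψ : G ⟶ H) (s : F.obj.obj (op U)) :
    ap (φ ≫ ψ) U s = ap ψ U (ap φ U s) := rfl

theorem ap_id (s : F.obj.obj (op U)) : ap (𝟙 F) U s = s := rfl

theorem ap_zero (s : F.obj.obj (op U)) : ap (0 : F ⟶ G) U s = 0 := rfl

theorem eq_of_locally_eq (s t : F.obj.obj (op U))
    (h : ∀ x ∈ U, ∃ (V : Opens X) (i : V ≤ U), x ∈ V ∧ rs F i s = rs F i t) : s = t := by
  choose V i hx e using h
  refine F.eq_of_locally_eq' (fun x : U => V x.1 x.2) U (fun x => homOfLE (i x.1 x.2)) ?_ s t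
    (fun x => e x.1 x.2)
  intro x hxU
  exact Opens.mem_iSup.mpr ⟨⟨x, hxU⟩, hx x hxU⟩

theorem exists_glue {ι : Type} (V : ι → Opens X) (i : ∀ a, V a ≤ U) (hU : U ≤ iSup V)
    (s : ∀ a, F.obj.obj (op (V a)))
    (h : ∀ a b, rs F (inf_le_left : V a ⊓ V b ≤ V a) (s a) =
      rs F (inf_le_right : V a ⊓ V b ≤ V b) (s b)) :
    ∃ t : F.obj.obj (op U), ∀ a, rs F (i a) t = s a := by
  obtain ⟨t, ht, -⟩ := F.existsUnique_gluing' V U (fun a => homOfLE (i a)) hU s h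
  exact ⟨t, ht⟩

theorem exists_glue₂ {U₁ U₂ : Opens X} (i₁ : U₁ ≤ U) (i₂ : U₂ ≤ U) (hU : U ≤ U₁ ⊔ U₂)
    (s₁ : F.obj.obj (op U₁)) (s₂ : F.obj.obj (op U₂))
    (h : rs F (inf_le_left : U₁ ⊓ U₂ ≤ U₁) s₁ = rs F (inf_le_right : U₁ ⊓ U₂ ≤ U₂) s₂) :
    ∃ t : F.obj.obj (op U), rs F i₁ t = s₁ ∧ rs F i₂ t = s₂ := by
  obtain ⟨t, ht⟩ := exists_glue (F := F) (fun b : Bool => if b then U₁ else U₂) (U := U)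
    (fun b => by cases b <;> simpa) (hU.trans
      (sup_le (le_iSup (fun b : Bool => if b then U₁ else U₂) true)
      (le_iSup (fun b : Bool => if b then U₁ else U₂) false)))
    (fun b => match b with | true => s₁ | false => s₂)
    (fun a b => by
      match a, b with
      | true, true => rfl
      | false, false => rfl
      | true, false => exact h
      | false, true =>
        have := congrArg (rs F (le_inf inf_le_right inf_le_left : U₂ ⊓ U₁ ≤ U₁ ⊓ U₂)) h
        rw [rs_rs, rs_rs] at this
        exact this.symm)
  exact ⟨t, ht true, ht false⟩

/-- A complex of sheaves is exact if and only if sections in the kernel are locally in the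
image. -/
theorem exact_iff_locally (S : ShortComplex (TopCat.Sheaf AddCommGrpCat.{0} X)) :
    S.Exact ↔ ∀ (U : Opens X) (s : S.X₂.obj.obj (op U)), ap S.g U s = 0 → ∀ x ∈ U,
      ∃ (V : Opens X) (i : V ≤ U), x ∈ V ∧ ∃ t : S.X₁.obj.obj (op V), ap S.f V t = rs S.X₂ i s := by
  rw [TopCat.Sheaf.exact_iff_stalkFunctor_map_exact]
  constructor
  · intro h U s hs x hx
    have hx' := (ShortComplex.ab_exact_iff _).mp (h x) (S.X₂.presheaf.germ U x hx s) (by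
      refine (TopCat.Presheaf.stalkFunctor_map_germ_apply U x hx S.g.hom s).trans ?_
      have : S.g.hom.app (op U) s = 0 := hs
      rw [this]
      exact map_zero _)
    obtain ⟨t, ht⟩ := hx'
    obtain ⟨V, hV, t, rfl⟩ := S.X₁.presheaf.exists_germ_eq t
    have ht' : S.X₂.presheaf.germ V x hV (S.f.hom.app (op V) t) = S.X₂.presheaf.germ U x hx s :=
      (TopCat.Presheaf.stalkFunctor_map_germ_apply V x hV S.f.hom t).symm.trans ht
    obtain ⟨W, hW, i, j, e⟩ := S.X₂.presheaf.germ_eq x hV hx _ _ ht'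
    exact ⟨W, j.le, hW, rs S.X₁ i.le t, (ap_rs S.f i.le t).trans e⟩
  · intro h x
    refine (ShortComplex.ab_exact_iff _).mpr fun s hs => ?_
    obtain ⟨U, hU, s, rfl⟩ := S.X₂.presheaf.exists_germ_eq (x := x) s
    have hs' : S.X₃.presheaf.germ U x hU (S.g.hom.app (op U) s) = S.X₃.presheaf.germ U x hU 0 :=
      (TopCat.Presheaf.stalkFunctor_map_germ_apply U x hU S.g.hom s).symm.trans
        (hs.trans (map_zero _).symm)
    obtain ⟨W, hW, i, j, e⟩ := S.X₃.presheaf.germ_eq x hU hU _ _ hs'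
    obtain ⟨V, k, hV, t, ht⟩ := h W (rs S.X₂ i.le s) (by
      rw [ap_rs]; exact e.trans (map_zero _)) x hW
    refine ⟨S.X₁.presheaf.germ V x hV t, ?_⟩
    refine (TopCat.Presheaf.stalkFunctor_map_germ_apply V x hV S.f.hom t).trans ?_
    have ht' : S.f.hom.app (op V) t = rs S.X₂ (k.trans i.le) s := by
      rw [← rs_rs]; exact ht
    rw [ht']
    exact S.X₂.presheaf.germ_res_apply (homOfLE (k.trans i.le)) x hV s

end AbSheaf
end LineSing

namespace LineSing
namespace AbSheaf

variable {X : TopCat.{0}}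

/-! ### Injective sheaves and Čech cochains -/

/-- The Godement sheaf of `F`, whose sections over `U` are all families of germs of `F` at the
points of `U`. -/
def godement (F : TopCat.Sheaf AddCommGrpCat.{0} X) : TopCat.Sheaf AddCommGrpCat.{0} X where
  obj :=
    { obj := fun U => AddCommGrpCat.of (∀ x : U.unop, F.presheaf.stalk x.1)
      map := fun {U V} i => AddCommGrpCat.ofHom
        { toFun := fun s x => s ⟨x.1, i.unop.le x.2⟩
          map_zero' := rfl
          map_add' := fun _ _ => rfl } }
  property :=
    (TopCat.Presheaf.isSheaf_iff_isSheaf_comp (forget AddCommGrpCat.{0}) _).mpr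
      (TopCat.Presheaf.isSheaf_of_iso
        (NatIso.ofComponents (fun _ => Iso.refl _) :
          TopCat.presheafToTypes X (fun x => (F.presheaf.stalk x : Type)) ≅ _)
        (TopCat.Presheaf.toTypes_isSheaf X _))

/-- The canonical morphism from a sheaf to its Godement sheaf. -/
def toGodement (F : TopCat.Sheaf AddCommGrpCat.{0} X) : F ⟶ godement F :=
  ⟨{ app := fun U => AddCommGrpCat.ofHom
      { toFun := fun s x => F.presheaf.germ U.unop x.1 x.2 s
        map_zero' := funext fun x => map_zero (F.presheaf.germ U.unop x.1 x.2).hom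
        map_add' := fun s t => funext fun x => map_add (F.presheaf.germ U.unop x.1 x.2).hom s t }
     naturality := by
      intro U V i
      ext s
      funext x
      exact F.presheaf.germ_res_apply i.unop x.1 x.2 s }⟩

instance (F : TopCat.Sheaf AddCommGrpCat.{0} X) : Mono (toGodement F) := by
  refine ⟨fun {G} φ ψ h => ?_⟩
  apply CategoryTheory.Sheaf.hom_ext
  ext U s
  refine TopCat.Presheaf.section_ext F U.unop _ _ fun x hx => ?_
  have h1 : ap (toGodement F) U.unop (ap φ U.unop s) =
      ap (toGodement F) U.unop (ap ψ U.unop s) := by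
    rw [← ap_comp, ← ap_comp, h]
  exact congrFun h1 ⟨x, hx⟩

theorem exists_godement_retraction (I : TopCat.Sheaf AddCommGrpCat.{0} X) [Injective I] :
    ∃ r : godement I ⟶ I, toGodement I ≫ r = 𝟙 I :=
  ⟨Injective.factorThru (𝟙 I) (toGodement I), Injective.comp_factorThru _ _⟩

/-- An injective sheaf is flasque: it is a retract of its Godement sheaf, whose sections extend
by zero. -/
theorem rs_surjective_of_injective (I : TopCat.Sheaf AddCommGrpCat.{0} X) [Injective I]
    {U V : Opens X} (h : V ≤ U) : Function.Surjective (rs I h) := by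
  classical
  obtain ⟨r, hr⟩ := exists_godement_retraction I
  intro s
  let t : (godement I).obj.obj (op U) := fun x =>
    if hx : x.1 ∈ V then I.presheaf.germ V x.1 hx s else 0
  refine ⟨ap r U t, ?_⟩
  have ht : rs (godement I) h t = ap (toGodement I) V s := by
    funext x
    exact dif_pos x.2
  rw [← ap_rs, ht, ← ap_comp, hr, ap_id]

variable {κ : Type}

/-- The intersection of the members `𝒰 (i 0), …, 𝒰 (i (n - 1))` of a cover. -/
def inter (𝒰 : κ → Opens X) {n : ℕ} (i : Fin n → κ) : Opens X :=
  ⟨{x | ∀ j, x ∈ 𝒰 (i j)}, by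
    rw [Set.ofPred_forall]
    exact isOpen_iInter_of_finite fun j => (𝒰 (i j)).isOpen⟩

variable {𝒰 : κ → Opens X}

theorem inter_le_comp {n m : ℕ} (i : Fin n → κ) (f : Fin m → Fin n) :
    inter 𝒰 i ≤ inter 𝒰 (i ∘ f) := fun _ hx j => hx (f j)

/-- Unordered Čech cochains on `n`-fold intersections, i.e. of degree `n - 1`. -/
abbrev Cochain (F : TopCat.Sheaf AddCommGrpCat.{0} X) (𝒰 : κ → Opens X) (n : ℕ) : Type :=
  ∀ i : Fin n → κ, F.obj.obj (op (inter 𝒰 i))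

/-- The Čech differential. -/
def cechD {F : TopCat.Sheaf AddCommGrpCat.{0} X} {n : ℕ} (c : Cochain F 𝒰 n) :
    Cochain F 𝒰 (n + 1) := fun i =>
  ∑ j : Fin (n + 1), (-1 : ℤ) ^ (j : ℕ) • rs F (inter_le_comp i j.succAbove) (c (i ∘ j.succAbove))

variable {F G : TopCat.Sheaf AddCommGrpCat.{0} X}

/-- A cochain takes equal values, after restriction, on equal index tuples. -/
theorem rs_cochain_congr {n : ℕ} (c : Cochain F 𝒰 n) {i i' : Fin n → κ} (h : i = i')
    {W : Opens X} (hW : W ≤ inter 𝒰 i) (hW' : W ≤ inter 𝒰 i') :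
    rs F hW (c i) = rs F hW' (c i') := by
  subst h; rfl

theorem cechD_cechD {n : ℕ} (c : Cochain F 𝒰 n) : cechD (cechD c) = 0 := by
  funext i
  have hle : ∀ j : Fin (n + 2), ∀ l : Fin (n + 1),
      inter 𝒰 i ≤ inter 𝒰 ((i ∘ j.succAbove) ∘ l.succAbove) := fun j l =>
    (inter_le_comp i _).trans (inter_le_comp _ _)
  have h1 : cechD (cechD c) i = ∑ p : Fin (n + 2) × Fin (n + 1),
      (-1 : ℤ) ^ (p.1 + p.2 : ℕ) •
        rs F (hle p.1 p.2) (c ((i ∘ p.1.succAbove) ∘ p.2.succAbove)) := by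
    rw [Fintype.sum_prod_type]
    refine Finset.sum_congr rfl fun j _ => ?_
    change _ • rs F _ (∑ l, _) = _
    rw [map_sum, Finset.smul_sum]
    refine Finset.sum_congr rfl fun l _ => ?_
    rw [map_zsmul, smul_smul, rs_rs, pow_add]
  rw [h1]
  change _ = (0 : F.obj.obj (op (inter 𝒰 i)))
  -- the terms for `(j, l)` with `l < j` cancel against those for `(l, j - 1)`
  let S : Finset (Fin (n + 2) × Fin (n + 1)) := Finset.univ.filter fun p => (p.2 : ℕ) < p.1
  rw [← Finset.sum_add_sum_compl S, ← eq_neg_iff_add_eq_zero, ← Finset.sum_neg_distrib]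
  refine Finset.sum_bij (fun p hp => (p.2.castSucc, p.1.pred fun h0 => by
      simp [S, h0] at hp)) ?_ ?_ ?_ ?_
  · rintro ⟨j, l⟩ hp
    simp only [S, Finset.mem_filter, Finset.mem_univ, true_and] at hp
    simp only [S, Finset.mem_compl, Finset.mem_filter, Finset.mem_univ, true_and, Fin.val_pred,
      Fin.val_castSucc]
    omega
  · rintro ⟨j, l⟩ hp ⟨j', l'⟩ hp' h
    simp only [Prod.mk.injEq, Fin.ext_iff, Fin.val_castSucc, Fin.val_pred, S, Finset.mem_filter,
      Finset.mem_univ, true_and] at h hp hp' ⊢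
    omega
  · rintro ⟨j, l⟩ hp
    simp only [S, Finset.mem_compl, Finset.mem_filter, Finset.mem_univ, true_and, not_lt] at hp
    refine ⟨(l.succ, ⟨j, by omega⟩), ?_, ?_⟩
    · simp only [S, Finset.mem_filter, Finset.mem_univ, true_and, Fin.val_succ]
      omega
    · simp
  · rintro ⟨j, l⟩ hp
    simp only [S, Finset.mem_filter, Finset.mem_univ, true_and] at hp
    have hj : j ≠ 0 := by rintro rfl; simp at hp
    have key : (i ∘ j.succAbove) ∘ l.succAbove =
        (i ∘ (l.castSucc).succAbove) ∘ (j.pred hj).succAbove := by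
      funext m
      simp only [Function.comp_apply]
      congr 1
      have := hp
      ext
      simp only [Fin.succAbove, Fin.lt_def]
      split_ifs <;> simp_all <;> omega
    rw [← neg_smul]
    refine congrArg₂ _ ?_ (rs_cochain_congr c key _ _)
    simp only [Fin.val_castSucc, Fin.val_pred]
    obtain ⟨m, hm⟩ : ∃ m, (j : ℕ) = m + 1 := ⟨j - 1, by omega⟩
    rw [hm, Nat.add_sub_cancel]
    ring

theorem ap_cechD (φ : F ⟶ G) {n : ℕ} (c : Cochain F 𝒰 n) (i : Fin (n + 1) → κ) :
    ap φ _ (cechD c i) = cechD (fun i => ap φ _ (c i)) i := by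
  unfold cechD
  rw [map_sum]
  refine Finset.sum_congr rfl fun j _ => ?_
  rw [map_zsmul, ap_rs]

theorem cechD_sub {n : ℕ} (c c' : Cochain F 𝒰 n) : cechD (c - c') = cechD c - cechD c' := by
  funext i
  simp only [cechD, Pi.sub_apply, map_sub, smul_sub, Finset.sum_sub_distrib]

theorem inter_cons_le {n : ℕ} (i : Fin n → κ) (j : κ) :
    inter 𝒰 (Fin.cons j i : Fin (n + 1) → κ) ≤ inter 𝒰 i := fun _ hx l => by
  simpa using hx l.succ

theorem cechD_eq_zero_cons {n : ℕ} (c : Cochain F 𝒰 n) (j : κ) (i : Fin n → κ) :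
    cechD c (Fin.cons j i) = rs F (inter_cons_le i j) (c i) -
      ∑ l : Fin n, (-1 : ℤ) ^ (l : ℕ) •
        rs F (inter_le_comp (Fin.cons j i) l.succ.succAbove)
          (c (Fin.cons j i ∘ l.succ.succAbove)) := by
  unfold cechD
  rw [Fin.sum_univ_succ, sub_eq_add_neg, ← Finset.sum_neg_distrib]
  congr 1
  · rw [Fin.val_zero, pow_zero, one_smul]
    exact rs_cochain_congr c (by funext l; simp) _ _
  · refine Finset.sum_congr rfl fun l _ => ?_
    rw [Fin.val_succ, pow_succ, mul_neg_one, neg_smul]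

theorem cons_comp_succ_succAbove {n : ℕ} (j : κ) (i : Fin (n + 1) → κ) (l : Fin (n + 1)) :
    (Fin.cons j i : Fin (n + 2) → κ) ∘ l.succ.succAbove = Fin.cons j (i ∘ l.succAbove) := by
  funext m
  refine Fin.cases ?_ (fun m => ?_) m
  · simp
  · simp [Fin.succ_succAbove_succ]

/-- An injective sheaf has no higher Čech cohomology: for the Godement sheaf, choosing a member
of the cover around each point yields a contracting homotopy. -/
theorem exists_cechD_eq_of_injective [Nonempty κ] (I : TopCat.Sheaf AddCommGrpCat.{0} X)
    [Injective I] {n : ℕ} (c : Cochain I 𝒰 (n + 2)) (hc : cechD c = 0) :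
    ∃ b : Cochain I 𝒰 (n + 1), cechD b = c := by
  classical
  obtain ⟨r, hr⟩ := exists_godement_retraction I
  let g : Cochain (godement I) 𝒰 (n + 2) := fun i => ap (toGodement I) _ (c i)
  have hg : cechD g = 0 := by
    funext i
    rw [← ap_cechD, hc]
    exact map_zero _
  let J : X → κ := fun x => if h : ∃ j, x ∈ 𝒰 j then h.choose else Classical.arbitrary κ
  have hJ : ∀ x (j : κ), x ∈ 𝒰 j → x ∈ 𝒰 (J x) := fun x j h => by
    have h' : ∃ j, x ∈ 𝒰 j := ⟨j, h⟩
    simp only [J, dif_pos h']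
    exact h'.choose_spec
  have hmem : ∀ {m : ℕ} (i : Fin (m + 1) → κ) (x : inter 𝒰 i),
      x.1 ∈ inter 𝒰 (Fin.cons (J x.1) i : Fin (m + 2) → κ) := fun i x => by
    refine Fin.cases ?_ (fun l => ?_)
    · simpa using hJ _ _ (x.2 0)
    · simpa using x.2 l
  let b : Cochain (godement I) 𝒰 (n + 1) := fun i x => g (Fin.cons (J x.1) i) ⟨x.1, hmem i x⟩
  have hb : cechD b = g := by
    funext i
    funext x
    have h1 := congrFun (congrFun hg (Fin.cons (J x.1) i)) ⟨x.1, hmem i x⟩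
    rw [cechD_eq_zero_cons] at h1
    have ev_sum : ∀ {W : Opens X} {m : ℕ} (f : Fin m → (godement I).obj.obj (op W)) (y : W),
        (∑ l, f l : (godement I).obj.obj (op W)) y = ∑ l, f l y := fun f y =>
      Finset.sum_apply y Finset.univ f
    have h2 := sub_eq_zero.mp h1
    refine Eq.trans ?_ h2.symm
    refine (ev_sum _ _).trans
      (Eq.trans ?_ (ev_sum (W := inter 𝒰 (Fin.cons (J x.1) i)) _ ⟨x.1, hmem i x⟩).symm)
    refine Finset.sum_congr rfl fun l _ => ?_
    have e := rs_cochain_congr g (cons_comp_succ_succAbove (J x.1) i l)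
      (inter_le_comp _ _) ((inter_le_comp (Fin.cons (J x.1) i) l.succ.succAbove).trans
        (by rw [cons_comp_succ_succAbove]))
    exact congrArg (fun z => (-1 : ℤ) ^ (l : ℕ) • z) (congrFun e ⟨x.1, hmem i x⟩).symm
  refine ⟨fun i => ap r _ (b i), ?_⟩
  funext i
  rw [← ap_cechD, hb]
  change ap r _ (ap (toGodement I) _ (c i)) = _
  rw [← ap_comp, hr, ap_id]

end AbSheaf
end LineSing

namespace LineSing
namespace AbSheaf

variable {X : TopCat.{0}}

/-! ### A criterion for the vanishing of higher direct images -/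

/-- A collection of open sets that behaves like the principal open subsets of an affine variety:
a local assertion about its members that can be glued along unions `W₁ ⊔ W₂` of two members holds
for all members.  (A finite cover by principal open sets is refined to iterated covers by two
principal open sets by means of a partition of unity.) -/
structure IsAffineBasis (B : Set (Opens X)) : Prop where
  /-- Below a member of `B`, the members of `B` form a basis of the topology. -/
  exists_le : ∀ W ∈ B, ∀ U ≤ W, ∀ x ∈ U, ∃ W' ∈ B, x ∈ W' ∧ W' ≤ U
  /-- The induction principle: `T` holds for `W` if it holds locally, passes to smaller members and
  is preserved by unions of two members. -/
  induct : ∀ W ∈ B, ∀ T : Opens X → Prop, T ⊥ →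
    (∀ W₁ ∈ B, ∀ W₂ ∈ B, W₂ ≤ W₁ → W₁ ≤ W → T W₁ → T W₂) →
    (∀ W₁ ∈ B, ∀ W₂ ∈ B, W₁ ⊔ W₂ ∈ B → W₁ ⊓ W₂ ∈ B → T W₁ → T W₂ → T (W₁ ⊔ W₂)) →
    (∀ x ∈ W, ∃ W' ∈ B, x ∈ W' ∧ W' ≤ W ∧ T W') → T W

variable {F I J K : TopCat.Sheaf AddCommGrpCat.{0} X} {κ : Type}

/-- The kernel of `φ` has no first Čech cohomology for the covers of a member of `B` by two
members of `B`. -/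
def AffineAcyclic (B : Set (Opens X)) (φ : I ⟶ J) : Prop :=
  ∀ W₁ ∈ B, ∀ W₂ ∈ B, W₁ ⊔ W₂ ∈ B → W₁ ⊓ W₂ ∈ B →
    ∀ s : I.obj.obj (op (W₁ ⊓ W₂)), ap φ _ s = 0 →
      ∃ (s₁ : I.obj.obj (op W₁)) (s₂ : I.obj.obj (op W₂)), ap φ _ s₁ = 0 ∧ ap φ _ s₂ = 0 ∧
        s = rs I inf_le_left s₁ - rs I inf_le_right s₂

/-- The kernel of `φ` has no Čech cohomology of positive degree for the cover `𝒰`. -/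
def CechAcyclic (𝒰 : κ → Opens X) (φ : I ⟶ J) : Prop :=
  ∀ (n : ℕ) (c : Cochain I 𝒰 (n + 2)), (∀ i, ap φ _ (c i) = 0) → cechD c = 0 →
    ∃ b : Cochain I 𝒰 (n + 1), (∀ i, ap φ _ (b i) = 0) ∧ cechD b = c

/-- Local exactness of `I ⟶ J ⟶ K` at `J`, in terms of sections. -/
def LocallyExact (d : I ⟶ J) (d' : J ⟶ K) : Prop :=
  ∀ (U : Opens X) (s : J.obj.obj (op U)), ap d' U s = 0 → ∀ x ∈ U,
    ∃ (V : Opens X) (i : V ≤ U), x ∈ V ∧ ∃ t : I.obj.obj (op V), ap d V t = rs J i s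

variable {B : Set (Opens X)} {d : I ⟶ J} {d' : J ⟶ K} {𝒰 : κ → Opens X}

/-- Over a member of an affine basis, the sections of the kernel of `d'` lift along `d`: local lifts
exist by exactness, and two of them glue after a correction by sections of the kernel of `d`. -/
theorem AffineAcyclic.exists_lift (hB : IsAffineBasis B) (hex : LocallyExact d d')
    (hd : AffineAcyclic B d) {W : Opens X} (hW : W ∈ B) (s : J.obj.obj (op W))
    (hs : ap d' W s = 0) : ∃ t : I.obj.obj (op W), ap d W t = s := by
  let T : Opens X → Prop := fun W' => ∀ h : W' ≤ W, ∃ t : I.obj.obj (op W'), ap d W' t = rs J h s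
  have key : T W := by
    refine hB.induct W hW T ?_ ?_ ?_ ?_
    · intro h
      exact ⟨0, eq_of_locally_eq _ _ fun x hx => absurd hx (by simp)⟩
    · intro W₁ _ W₂ _ h h₁ T₁ h₂
      obtain ⟨t, ht⟩ := T₁ h₁
      exact ⟨rs I h t, by rw [ap_rs, ht, rs_rs]⟩
    · intro W₁ hW₁ W₂ hW₂ hsup hinf T₁ T₂ h
      obtain ⟨t₁, ht₁⟩ := T₁ (le_sup_left.trans h)
      obtain ⟨t₂, ht₂⟩ := T₂ (le_sup_right.trans h)
      obtain ⟨s₁, s₂, hs₁, hs₂, e⟩ := hd W₁ hW₁ W₂ hW₂ hsup hinf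
        (rs I inf_le_left t₁ - rs I inf_le_right t₂) (by
          rw [map_sub, ap_rs, ap_rs, ht₁, ht₂, rs_rs, rs_rs, sub_self])
      obtain ⟨t, h₁, h₂⟩ := exists_glue₂ (F := I) (le_sup_left : W₁ ≤ W₁ ⊔ W₂) le_sup_right le_rfl
        (t₁ - s₁) (t₂ - s₂) (by
          rw [map_sub, map_sub, sub_eq_sub_iff_sub_eq_sub]; exact e)
      refine ⟨t, eq_of_locally_eq _ _ fun x hx => ?_⟩
      rcases hx with hx | hx
      · exact ⟨W₁, le_sup_left, hx, by rw [← ap_rs, h₁, map_sub, hs₁, ht₁, rs_rs, sub_zero]⟩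
      · exact ⟨W₂, le_sup_right, hx, by rw [← ap_rs, h₂, map_sub, hs₂, ht₂, rs_rs, sub_zero]⟩
    · intro x hx
      obtain ⟨V, i, hV, t, ht⟩ := hex W s hs x hx
      obtain ⟨W', hW', hx', h⟩ := hB.exists_le W hW V i x hV
      exact ⟨W', hW', hx', h.trans i, fun _ => ⟨rs I h t, by rw [ap_rs, ht, rs_rs]⟩⟩
  obtain ⟨t, ht⟩ := key le_rfl
  exact ⟨t, ht.trans (rs_self _ _)⟩

/-- Affine acyclicity passes from the kernel of `d` to the kernel of `d'`: lift the section along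
`d` and extend the lift to one of the two open sets. -/
theorem AffineAcyclic.next [Injective I] (hB : IsAffineBasis B) (hex : LocallyExact d d')
    (hd : AffineAcyclic B d) (hdd : d ≫ d' = 0) : AffineAcyclic B d' := by
  intro W₁ hW₁ W₂ hW₂ _ hinf s hs
  obtain ⟨t, ht⟩ := hd.exists_lift hB hex hinf s hs
  obtain ⟨t', ht'⟩ := rs_surjective_of_injective I (inf_le_left : W₁ ⊓ W₂ ≤ W₁) t
  refine ⟨ap d _ t', 0, ?_, map_zero _, ?_⟩
  · rw [← ap_comp, hdd, ap_zero]
  · rw [map_zero, sub_zero, ← ap_rs, ht', ht]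

/-- Čech acyclicity passes from the kernel of `d` to the kernel of `d'`: lift a cocycle along `d`
and correct the lift to a cocycle, which is a coboundary because the source of `d` is injective. -/
theorem CechAcyclic.next [Injective I] [Nonempty κ] (hB : IsAffineBasis B)
    (hex : LocallyExact d d') (hd : AffineAcyclic B d) (hdd : d ≫ d' = 0)
    (h𝒰 : ∀ (n : ℕ) (i : Fin (n + 1) → κ), inter 𝒰 i ∈ B) (hc : CechAcyclic 𝒰 d) :
    CechAcyclic 𝒰 d' := by
  intro n c hc₀ hc₁
  choose a ha using fun i => hd.exists_lift hB hex (h𝒰 _ i) (c i) (hc₀ i)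
  have hda : ∀ i, ap d _ (cechD a i) = 0 := fun i => by
    rw [ap_cechD]
    simp only [ha]
    exact congrFun hc₁ i
  obtain ⟨b, hb, hba⟩ := hc _ (cechD a) hda (cechD_cechD a)
  obtain ⟨e, he⟩ := exists_cechD_eq_of_injective I (a - b) (by rw [cechD_sub, hba, sub_self])
  refine ⟨fun i => ap d _ (e i), fun i => by rw [← ap_comp, hdd, ap_zero], ?_⟩
  funext i
  rw [← ap_cechD, he, Pi.sub_apply, map_sub, hb, sub_zero, ha]

/-- Over an open set with an acyclic cover, the sections of the kernel of `d'` lift along `d`: the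
lifts over the members of the cover differ by a 1-cocycle of the kernel of `d`, hence by a
coboundary. -/
theorem CechAcyclic.exists_lift [Injective I] [Nonempty κ] (hB : IsAffineBasis B)
    (hex : LocallyExact d d') (hd : AffineAcyclic B d)
    (h𝒰 : ∀ (n : ℕ) (i : Fin (n + 1) → κ), inter 𝒰 i ∈ B) (hc : CechAcyclic 𝒰 d)
    {U : Opens X} (hU : U = iSup 𝒰) (s : J.obj.obj (op U)) (hs : ap d' U s = 0) :
    ∃ t : I.obj.obj (op U), ap d U t = s := by
  have hle : ∀ j, 𝒰 j ≤ U := fun j => hU ▸ le_iSup 𝒰 j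
  have hle' : ∀ i : Fin 1 → κ, inter 𝒰 i ≤ U := fun i x hx => hle _ (hx 0)
  have hs' : ∀ i : Fin 1 → κ, ap d' _ (rs J (hle' i) s) = 0 := fun i => by
    rw [ap_rs, hs, map_zero]
  choose a ha using fun i : Fin 1 → κ => hd.exists_lift hB hex (h𝒰 _ i) _ (hs' i)
  have hda : ∀ i, ap d _ (cechD a i) = 0 := fun i => by
    rw [ap_cechD]
    simp only [ha, cechD, rs_rs]
    simp [Fin.sum_univ_succ]
  obtain ⟨b, hb, hba⟩ := hc _ (cechD a) hda (cechD_cechD a)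
  have hab : cechD (a - b) = 0 := by rw [cechD_sub, hba, sub_self]
  have hj : ∀ j, 𝒰 j ≤ inter 𝒰 (fun _ : Fin 1 => j) := fun j x hx _ => hx
  obtain ⟨t, ht⟩ := exists_glue (F := I) 𝒰 hle hU.le
    (fun j => rs I (hj j) ((a - b) fun _ => j)) (fun j l => by
      have h1 := congrFun hab ![j, l]
      unfold cechD at h1
      have hjl : 𝒰 j ⊓ 𝒰 l ≤ inter 𝒰 ![j, l] := fun x hx m => by
        fin_cases m
        · exact hx.1
        · exact hx.2
      have h2 := congrArg (rs I hjl) h1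
      rw [map_sum, Fin.sum_univ_two] at h2
      simp only [Fin.val_zero, Fin.val_one, pow_zero, pow_one, one_smul, neg_smul, map_neg,
        rs_rs] at h2
      have h3 : _ + -_ = (0 : I.obj.obj (op (𝒰 j ⊓ 𝒰 l))) := h2.trans (map_zero _)
      rw [← sub_eq_add_neg, sub_eq_zero] at h3
      rw [rs_rs, rs_rs]
      refine (rs_cochain_congr (a - b) ?_ _ _).trans
        (h3.symm.trans (rs_cochain_congr (a - b) ?_ _ _))
      · funext m; fin_cases m; rfl
      · funext m; fin_cases m; rfl)
  refine ⟨t, eq_of_locally_eq _ _ fun x hx => ?_⟩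
  rw [hU] at hx
  obtain ⟨j, hj'⟩ := Opens.mem_iSup.mp hx
  refine ⟨𝒰 j, hle j, hj', ?_⟩
  rw [← ap_rs, ht, ap_rs, Pi.sub_apply, map_sub, ha, hb, sub_zero, rs_rs]

theorem ap_rs_eq_zero (φ : I ⟶ J) {U V : Opens X} (h : V ≤ U) {s : I.obj.obj (op U)}
    (hs : ap φ U s = 0) : ap φ V (rs I h s) = 0 := by
  rw [ap_rs, hs, map_zero]

theorem exists_of_exact {ι : F ⟶ I} {d : I ⟶ J} {w : ι ≫ d = 0} [Mono ι]
    (h : (ShortComplex.mk ι d w).Exact) {U : Opens X} (s : I.obj.obj (op U)) (hs : ap d U s = 0) :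
    ∃ t : F.obj.obj (op U), ap ι U t = s :=
  TopCat.Sheaf.sections_exact_of_left_exact h (inferInstanceAs (Mono ι)) s hs

theorem ap_injective (φ : F ⟶ I) [Mono φ] (U : Opens X) : Function.Injective (ap φ U) := by
  refine (injective_iff_map_eq_zero _).mpr fun s hs => eq_of_locally_eq _ _ fun x hx => ?_
  have h : (ShortComplex.mk (0 : F ⟶ F) φ Limits.zero_comp).Exact :=
    (ShortComplex.exact_iff_mono _ rfl).mpr inferInstance
  obtain ⟨V, i, hV, t, ht⟩ := (exact_iff_locally _).mp h U s hs x hx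
  exact ⟨V, i, hV, by rw [map_zero]; exact ht.symm⟩

theorem AffineAcyclic.of_exact {ι : F ⟶ I} {d : I ⟶ J} {w : ι ≫ d = 0} [Mono ι]
    (h : (ShortComplex.mk ι d w).Exact) (hF : AffineAcyclic B (0 : F ⟶ F)) :
    AffineAcyclic B d := by
  have hι : ∀ (W : Opens X) (t : F.obj.obj (op W)), ap d W (ap ι W t) = 0 := fun W t => by
    rw [← ap_comp, w, ap_zero]
  intro W₁ hW₁ W₂ hW₂ hsup hinf s hs
  obtain ⟨t, rfl⟩ := exists_of_exact h s hs
  obtain ⟨t₁, t₂, -, -, rfl⟩ := hF W₁ hW₁ W₂ hW₂ hsup hinf t rfl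
  exact ⟨ap ι _ t₁, ap ι _ t₂, hι _ _, hι _ _, by rw [map_sub, ap_rs, ap_rs]⟩

theorem CechAcyclic.of_exact {ι : F ⟶ I} {d : I ⟶ J} {w : ι ≫ d = 0} [Mono ι]
    (h : (ShortComplex.mk ι d w).Exact) (hF : CechAcyclic 𝒰 (0 : F ⟶ F)) :
    CechAcyclic 𝒰 d := by
  have hι : ∀ (W : Opens X) (t : F.obj.obj (op W)), ap d W (ap ι W t) = 0 := fun W t => by
    rw [← ap_comp, w, ap_zero]
  intro n c hc₀ hc₁
  choose a ha using fun i => exists_of_exact h (c i) (hc₀ i)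
  obtain ⟨b, -, hb⟩ := hF n a (fun _ => rfl) (by
    funext i
    apply ap_injective ι
    rw [ap_cechD]
    simp only [ha]
    exact (congrFun hc₁ i).trans (map_zero _).symm)
  refine ⟨fun i => ap ι _ (b i), fun i => hι _ _, ?_⟩
  funext i
  rw [← ap_cechD, hb, ha]

/-- If every point of `Y` has arbitrarily small neighbourhoods whose preimage has a cover by
affine-like open sets for which `F` has no Čech cohomology of positive degree, then the higher
direct images of `F` vanish.  Both acyclicity conditions pass from the kernel of one differential
of an injective resolution to the kernel of the next. -/
theorem isZero_rightDerived_pushforward {Y : TopCat.{0}} (f : X ⟶ Y) [Nonempty κ]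
    (H : ∀ (y : Y) (U : Opens Y), y ∈ U → ∃ V ≤ U, y ∈ V ∧ ∃ (B : Set (Opens X))
      (𝒰 : κ → Opens X), IsAffineBasis B ∧ (Opens.map f).obj V = iSup 𝒰 ∧
        (∀ (n : ℕ) (i : Fin (n + 1) → κ), inter 𝒰 i ∈ B) ∧
        AffineAcyclic B (0 : F ⟶ F) ∧ CechAcyclic 𝒰 (0 : F ⟶ F)) (i : ℕ) (hi : 1 ≤ i) :
    Limits.IsZero ((higherDirectImage f i).obj F) := by
  obtain ⟨n, rfl⟩ : ∃ n, i = n + 1 := ⟨i - 1, by omega⟩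
  let R := injectiveResolution F
  refine Limits.IsZero.of_iso ?_
    (R.isoRightDerivedObj (TopCat.Sheaf.pushforward AddCommGrpCat.{0} f) (n + 1))
  refine (HomologicalComplex.exactAt_iff_isZero_homology _ _).mp ?_
  refine (HomologicalComplex.exactAt_iff' _ n (n + 1) (n + 2) (by simp)
    (by simp only [CochainComplex.next]; rfl)).mpr ?_
  refine (exact_iff_locally _).mpr ?_
  intro U s hs y hy
  obtain ⟨V, hVU, hyV, B, 𝒰, hB, h𝒰, h𝒰B, hA, hC⟩ := H y U hy
  have hex : ∀ m, LocallyExact (R.cocomplex.d m (m + 1)) (R.cocomplex.d (m + 1) (m + 2)) :=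
    fun m => (exact_iff_locally _).mp (R.exact_succ m)
  have hdd : ∀ m, R.cocomplex.d m (m + 1) ≫ R.cocomplex.d (m + 1) (m + 2) = 0 :=
    R.complex_d_comp
  -- the kernel of the first differential is `F`
  have acyc : ∀ m, AffineAcyclic B (R.cocomplex.d m (m + 1)) ∧
      CechAcyclic 𝒰 (R.cocomplex.d m (m + 1)) := by
    intro m
    induction m with
    | zero => exact ⟨hA.of_exact R.exact₀, hC.of_exact R.exact₀⟩
    | succ m ih =>
      exact ⟨ih.1.next hB (hex m) (hdd m), ih.2.next hB (hex m) ih.1 (hdd m) h𝒰B⟩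
  obtain ⟨t, ht⟩ := (acyc n).2.exists_lift hB (hex n) (acyc n).1 h𝒰B h𝒰
    (rs (R.cocomplex.X (n + 1)) ((Opens.map f).map (homOfLE hVU)).le s)
      (ap_rs_eq_zero _ _ hs)
  exact ⟨V, hVU, hyV, t, ht⟩

end AbSheaf
end LineSing

namespace LineSing

/-! ### Polynomials vanishing along a coordinate subspace of codimension two -/

namespace ConePoly

open MvPolynomial

variable {σ : Type}

theorem eval_aeval {τ : Type} (c : τ → ℂ) (f : σ → MvPolynomial τ ℂ) (F : MvPolynomial σ ℂ) :
    eval c (aeval f F) = eval (fun i => eval c (f i)) F := by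
  induction F using MvPolynomial.induction_on with
  | C r => simp
  | add p q hp hq => rw [map_add, map_add, map_add, hp, hq]
  | mul_X p i hp => rw [map_mul, map_mul, map_mul, hp, aeval_X, eval_X]

/-- The `k`-th power of the ideal generated by two variables. -/
abbrev pairIdeal (a b : σ) (k : ℕ) : Ideal (MvPolynomial σ ℂ) :=
  Ideal.span {X a, X b} ^ k

theorem pairIdeal_mul {a b : σ} {k l : ℕ} {F G : MvPolynomial σ ℂ} (hF : F ∈ pairIdeal a b k)
    (hG : G ∈ pairIdeal a b l) : F * G ∈ pairIdeal a b (k + l) := by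
  rw [pairIdeal, pow_add]
  exact Ideal.mul_mem_mul hF hG

theorem monomial_mem_pairIdeal {a b : σ} (hab : a ≠ b) {k : ℕ} {m : σ →₀ ℕ} (h : k ≤ m a + m b)
    (r : ℂ) : monomial m r ∈ pairIdeal a b k := by
  classical
  have h1 : (X a : MvPolynomial σ ℂ) ^ m a * X b ^ m b ∈ pairIdeal a b (m a + m b) :=
    pairIdeal_mul (Ideal.pow_mem_pow (Ideal.subset_span (by simp)) _)
      (Ideal.pow_mem_pow (Ideal.subset_span (by simp)) _)
  have h2 : monomial m r = monomial (m - (Finsupp.single a (m a) + Finsupp.single b (m b))) r *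
      ((X a : MvPolynomial σ ℂ) ^ m a * X b ^ m b) := by
    rw [X_pow_eq_monomial, X_pow_eq_monomial, monomial_mul, monomial_mul, mul_one, mul_one,
      tsub_add_cancel_of_le]
    intro i
    simp only [Finsupp.coe_add, Pi.add_apply, Finsupp.single_apply]
    split_ifs with h1 h2 <;> simp_all
  rw [h2]
  exact Ideal.mul_mem_left _ _ (Ideal.pow_le_pow_right h h1)

theorem mem_pairIdeal_iff {a b : σ} (hab : a ≠ b) {k : ℕ} {F : MvPolynomial σ ℂ} :
    F ∈ pairIdeal a b k ↔ ∀ m ∈ F.support, k ≤ m a + m b := by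
  classical
  constructor
  · let D : ℕ → Ideal (MvPolynomial σ ℂ) := fun k =>
      restrictSupportIdeal (R := ℂ) {m : σ →₀ ℕ | k ≤ m a + m b}
        (fun m m' hle hm => le_trans hm (add_le_add (hle a) (hle b)))
    have hD : ∀ k F, F ∈ D k ↔ ∀ m ∈ F.support, k ≤ m a + m b := fun k F => Iff.rfl
    have key : ∀ k, pairIdeal a b k ≤ D k := by
      intro k
      induction k with
      | zero => intro F _; exact (hD 0 F).mpr fun _ _ => Nat.zero_le _
      | succ k ih =>
        rw [pairIdeal, pow_succ]
        refine Ideal.mul_le.mpr fun F hF G hG => (hD _ _).mpr fun m hm => ?_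
        have hG' : G ∈ D 1 := by
          refine (Ideal.span_le.mpr ?_ : Ideal.span {X a, X b} ≤ D 1) hG
          rintro _ (rfl | rfl)
          · refine (hD _ _).mpr fun m hm => ?_
            rw [mem_support_iff, coeff_X] at hm
            obtain rfl : Finsupp.single a 1 = m := by by_contra h; simp [h] at hm
            simp
          · refine (hD _ _).mpr fun m hm => ?_
            rw [mem_support_iff, coeff_X] at hm
            obtain rfl : Finsupp.single b 1 = m := by by_contra h; simp [h] at hm
            simp
        obtain ⟨m₁, h₁, m₂, h₂, rfl⟩ := Finset.mem_add.mp (support_mul _ _ hm)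
        have e₁ := (hD _ _).mp (ih hF) m₁ h₁
        have e₂ := (hD _ _).mp hG' m₂ h₂
        simp only [Finsupp.coe_add, Pi.add_apply]
        omega
    exact fun h => (hD k F).mp (key k h)
  · intro h
    rw [F.as_sum]
    exact Ideal.sum_mem _ fun m hm => monomial_mem_pairIdeal hab (h m hm) _

theorem exists_eq_sum_of_mem_pairIdeal {a b : σ} {k : ℕ} {F : MvPolynomial σ ℂ}
    (hF : F ∈ pairIdeal a b k) :
    ∃ C : ℕ → MvPolynomial σ ℂ,
      F = ∑ i ∈ Finset.range (k + 1), C i * (X a ^ i * X b ^ (k - i)) := by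
  induction k generalizing F with
  | zero => exact ⟨fun _ => F, by simp⟩
  | succ k ih =>
    rw [pairIdeal, pow_succ] at hF
    refine Submodule.mul_induction_on (C := fun F => ∃ C : ℕ → MvPolynomial σ ℂ,
      F = ∑ i ∈ Finset.range (k + 1 + 1), C i * (X a ^ i * X b ^ (k + 1 - i))) hF ?_ ?_
    · intro F hF G hG
      obtain ⟨C, rfl⟩ := ih hF
      obtain ⟨p, q, rfl⟩ := Ideal.mem_span_pair.mp hG
      refine ⟨fun i => (if i = 0 then 0 else C (i - 1) * p) + (if i = k + 1 then 0 else C i * q),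
        ?_⟩
      simp only [add_mul, Finset.sum_add_distrib]
      rw [mul_add, Finset.sum_range_succ' (n := k + 1), Finset.sum_range_succ (n := k + 1)]
      simp only [if_true, zero_mul, add_zero, Finset.sum_mul]
      refine congrArg₂ (· + ·) ?_ ?_
      · refine Finset.sum_congr rfl fun i hi => ?_
        rw [if_neg (Nat.succ_ne_zero i), Nat.add_sub_cancel, Nat.add_sub_add_right]
        ring
      · refine Finset.sum_congr rfl fun i hi => ?_
        have hi' := Finset.mem_range.mp hi
        rw [if_neg (by omega), show k + 1 - i = k - i + 1 by omega]
        ring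
    · rintro F G ⟨C, rfl⟩ ⟨D, rfl⟩
      refine ⟨fun i => C i + D i, ?_⟩
      rw [← Finset.sum_add_distrib]
      exact Finset.sum_congr rfl fun i _ => by ring

/-- A polynomial that vanishes where `X a` and `X b` do lies in the ideal they generate: modulo this
ideal it is congruent to the result of setting both variables to zero. -/
theorem mem_span_pair_of_eval_eq_zero {a b : σ} {F : MvPolynomial σ ℂ}
    (hF : ∀ c : σ → ℂ, c a = 0 → c b = 0 → eval c F = 0) :
    F ∈ Ideal.span {(X a : MvPolynomial σ ℂ), X b} := by
  classical
  let I : Ideal (MvPolynomial σ ℂ) := Ideal.span {X a, X b}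
  let φ : MvPolynomial σ ℂ →ₐ[ℂ] MvPolynomial σ ℂ := aeval fun i => if i = a ∨ i = b then 0 else X i
  have h1 : (Ideal.Quotient.mkₐ ℂ I).comp φ = Ideal.Quotient.mkₐ ℂ I := by
    refine algHom_ext fun i => ?_
    simp only [AlgHom.comp_apply, φ, aeval_X]
    split_ifs with h
    · rw [map_zero]
      refine (Ideal.Quotient.eq_zero_iff_mem.mpr (Ideal.subset_span ?_)).symm
      rcases h with rfl | rfl <;> simp
    · rfl
  have h2 : φ F = 0 := by
    refine MvPolynomial.funext fun c => ?_
    rw [map_zero, eval_aeval]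
    exact hF _ (by simp) (by simp)
  refine Ideal.Quotient.eq_zero_iff_mem.mp ?_
  have := DFunLike.congr_fun h1 F
  rw [AlgHom.comp_apply, h2, map_zero] at this
  exact this.symm

/-- A form of the Nullstellensatz: if `G` vanishes at the common zeros of an ideal, then a power
of `G` lies in the ideal. -/
theorem exists_pow_mem_of_eval [Finite σ] (I : Ideal (MvPolynomial σ ℂ)) (G : MvPolynomial σ ℂ)
    (h : ∀ c : σ → ℂ, eval c G ≠ 0 → ∃ H ∈ I, eval c H ≠ 0) : ∃ N : ℕ, G ^ N ∈ I := by
  have : G ∈ vanishingIdeal ℂ (zeroLocus ℂ I) := by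
    intro c hc
    by_contra hG
    obtain ⟨H, hH, hne⟩ := h c hG
    exact hne (hc H hH)
  rw [vanishingIdeal_zeroLocus_eq_radical] at this
  exact this

end ConePoly
end LineSing

namespace LineSing
namespace ConePoly

open MvPolynomial

/-! ### Polynomials homogeneous in the second group of variables -/

/-- The index set of the affine coordinates `(t, y)` used on `G(2,4) × ℙ³`: four coordinates `t` on
an affine chart of the Grassmannian and four homogeneous coordinates `y`. -/
abbrev J : Type := (Fin 2 × Fin 2) ⊕ Fin 4

/-- The weight for which the variables `t` have degree `0` and the variables `y` degree `1`. -/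
def yWeight : J → ℕ := Sum.elim (fun _ => 0) (fun _ => 1)

/-- Homogeneity of degree `n` in the variables `y`. -/
abbrev IsYHom (F : MvPolynomial J ℂ) (n : ℕ) : Prop := IsWeightedHomogeneous yWeight F n

/-- The component of degree `n` in the variables `y`. -/
abbrev yComp (n : ℕ) (F : MvPolynomial J ℂ) : MvPolynomial J ℂ :=
  weightedHomogeneousComponent yWeight n F

/-- The action of scalars on the `y` coordinates. -/
def scale (a : ℂ) (c : J → ℂ) : J → ℂ :=
  Sum.elim (fun p => c (Sum.inl p)) fun j => a * c (Sum.inr j)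

theorem weight_yWeight (m : J →₀ ℕ) : Finsupp.weight yWeight m = ∑ j : Fin 4, m (Sum.inr j) := by
  rw [Finsupp.weight_apply, Finsupp.sum_fintype _ _ (by simp), Fintype.sum_sum_type]
  simp [yWeight]

theorem IsYHom.eval_scale {F : MvPolynomial J ℂ} {n : ℕ} (hF : IsYHom F n) (a : ℂ) (c : J → ℂ) :
    eval (scale a c) F = a ^ n * eval c F := by
  rw [eval_eq', eval_eq', Finset.mul_sum]
  refine Finset.sum_congr rfl fun m hm => ?_
  have h := hF (mem_support_iff.mp hm)
  rw [weight_yWeight] at h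
  rw [Fintype.prod_sum_type, Fintype.prod_sum_type]
  simp only [scale, Sum.elim_inl, Sum.elim_inr, mul_pow, Finset.prod_mul_distrib,
    Finset.prod_pow_eq_pow_sum, h]
  ring

/-- The restriction of `F` to the curve `a ↦ scale a c` is a polynomial in `a`, whose coefficients
are the values at `c` of the components of `F`. -/
theorem exists_eval_scale_eq (F : MvPolynomial J ℂ) (c : J → ℂ) :
    ∃ p : Polynomial ℂ, (∀ n, p.coeff n = eval c (yComp n F)) ∧
      ∀ a, p.eval a = eval (scale a c) F := by
  refine ⟨∑ n ∈ (weightedHomogeneousComponent_finsupp (w := yWeight) F).toFinset,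
    Polynomial.monomial n (eval c (yComp n F)), fun n => ?_, fun a => ?_⟩
  · rw [Polynomial.finsetSum_coeff]
    simp only [Polynomial.coeff_monomial, Finset.sum_ite_eq']
    split_ifs with h
    · rfl
    · have h' : yComp n F = 0 := by
        by_contra hne
        exact h ((Set.Finite.mem_toFinset _).mpr hne)
      rw [h', map_zero]
  · conv_rhs => rw [← sum_weightedHomogeneousComponent yWeight F,
      finsum_eq_sum _ (weightedHomogeneousComponent_finsupp F), map_sum]
    rw [Polynomial.eval_finsetSum]
    refine Finset.sum_congr rfl fun n _ => ?_
    rw [Polynomial.eval_monomial, IsYHom.eval_scale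
      (weightedHomogeneousComponent_isWeightedHomogeneous n F),
      mul_comm]

theorem exists_eval_scale_ne_zero {F : MvPolynomial J ℂ} {n : ℕ} {c : J → ℂ}
    (h : eval c (yComp n F) ≠ 0) : ∃ a : ℂ, a ≠ 0 ∧ eval (scale a c) F ≠ 0 := by
  obtain ⟨p, hp, hpe⟩ := exists_eval_scale_eq F c
  -- The factor `Polynomial.X` takes care of the excluded value `a = 0`.
  have hp0 : Polynomial.X * p ≠ 0 := by
    refine mul_ne_zero Polynomial.X_ne_zero fun h0 => h ?_
    rw [← hp, h0, Polynomial.coeff_zero]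
  by_contra! H
  refine hp0 (Polynomial.funext fun a => ?_)
  rw [Polynomial.eval_mul, Polynomial.eval_X, Polynomial.eval_zero, hpe]
  by_cases ha : a = 0
  · rw [ha, zero_mul]
  · rw [H a ha, mul_zero]

theorem eval_yComp_of_scale {F : MvPolynomial J ℂ} {n : ℕ} {c : J → ℂ} {v : ℂ}
    (h : ∀ a : ℂ, a ≠ 0 → eval (scale a c) F = a ^ n * v) : eval c (yComp n F) = v := by
  obtain ⟨p, hp, hpe⟩ := exists_eval_scale_eq F c
  have : p = Polynomial.monomial n v := by
    have h0 : Polynomial.X * p = Polynomial.X * Polynomial.monomial n v := by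
      refine Polynomial.funext fun a => ?_
      rw [Polynomial.eval_mul, Polynomial.eval_mul, Polynomial.eval_X, hpe,
        Polynomial.eval_monomial]
      by_cases ha : a = 0
      · rw [ha, zero_mul, zero_mul]
      · rw [h a ha, mul_comm v]
    exact mul_left_cancel₀ Polynomial.X_ne_zero h0
  rw [← hp, this, Polynomial.coeff_monomial, if_pos rfl]

theorem exists_yComp_ne_zero {F : MvPolynomial J ℂ} {c : J → ℂ} (h : eval c F ≠ 0) :
    ∃ n, eval c (yComp n F) ≠ 0 := by
  by_contra! H
  refine h ?_
  rw [← sum_weightedHomogeneousComponent yWeight F,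
      finsum_eq_sum _ (weightedHomogeneousComponent_finsupp F), map_sum]
  exact Finset.sum_eq_zero fun n _ => H n

theorem isYHom_yComp (n : ℕ) (F : MvPolynomial J ℂ) : IsYHom (yComp n F) n :=
  weightedHomogeneousComponent_isWeightedHomogeneous n F

theorem isYHom_X_inr (j : Fin 4) : IsYHom (X (Sum.inr j)) 1 :=
  isWeightedHomogeneous_X ℂ yWeight (Sum.inr j)

theorem isYHom_rename (g : MvPolynomial (Fin 2 × Fin 2) ℂ) : IsYHom (rename Sum.inl g) 0 := by
  intro m hm
  obtain ⟨u, rfl, -⟩ := coeff_rename_ne_zero _ _ _ hm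
  rw [weight_yWeight]
  refine Finset.sum_eq_zero fun j _ => ?_
  rw [Finsupp.mapDomain_of_notMem_range]
  simp

theorem yComp_mul_of_isYHom {H : MvPolynomial J ℂ} {e : ℕ} (hH : IsYHom H e)
    (A : MvPolynomial J ℂ) {n : ℕ} (hn : e ≤ n) : yComp n (A * H) = yComp (n - e) A * H := by
  classical
  refine MvPolynomial.funext fun c => ?_
  obtain ⟨p, hp, hpe⟩ := exists_eval_scale_eq A c
  obtain ⟨q, hq, hqe⟩ := exists_eval_scale_eq (A * H) c
  have : q = p * Polynomial.monomial e (eval c H) := by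
    refine Polynomial.funext fun a => ?_
    rw [hqe, map_mul, Polynomial.eval_mul, hpe, Polynomial.eval_monomial, hH.eval_scale,
      mul_comm (a ^ e)]
  rw [← hq, this, map_mul, ← hp, ← Polynomial.C_mul_X_pow_eq_monomial, mul_left_comm,
    ← mul_assoc, Polynomial.coeff_mul_X_pow', if_pos hn, Polynomial.coeff_C_mul, mul_comm]

theorem yComp_mem_pairIdeal {F : MvPolynomial J ℂ} {k : ℕ} {a b : J} (hab : a ≠ b)
    (hF : F ∈ pairIdeal a b k) (n : ℕ) : yComp n F ∈ pairIdeal a b k := by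
  classical
  rw [mem_pairIdeal_iff hab] at hF ⊢
  intro m hm
  rw [mem_support_iff, coeff_weightedHomogeneousComponent] at hm
  exact hF m (mem_support_iff.mpr fun h => hm (by rw [h, ite_self]))

end ConePoly
end LineSing

namespace LineSing

open CoordSpace MvPolynomial

/-! ### Regular functions -/

namespace CoordSpace

variable {X : CoordSpace} {U : Opens X.Pt} {h : ∀ a : X.Rep, X.pr a ∈ U → ℂ}

theorem RegularOn.inv (H : RegularOn U h) (h0 : ∀ a ha, h a ha ≠ 0) :
    RegularOn U (fun a ha => (h a ha)⁻¹) := by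
  intro a ha
  obtain ⟨F, G, hG, e⟩ := H a ha
  have hF : ∀ b (hb : X.pr b ∈ U), eval b.1 G ≠ 0 → eval b.1 F ≠ 0 := fun b hb hGb hF =>
    h0 b hb (by rw [e b hb hGb, hF, zero_div])
  refine ⟨G * G, F * G, by rw [map_mul]; exact mul_ne_zero (hF a ha hG) hG, fun b hb hne => ?_⟩
  rw [map_mul] at hne
  have hGb := right_ne_zero_of_mul hne
  change (h b hb)⁻¹ = _
  rw [e b hb hGb, map_mul, map_mul, mul_div_mul_right _ _ hGb, inv_div]

theorem RegularOn.pow (H : RegularOn U h) (n : ℕ) : RegularOn U (fun a ha => h a ha ^ n) := by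
  induction n with
  | zero => simpa using RegularOn.const 1
  | succ n ih => simpa [pow_succ] using ih.mul H

theorem RegularOn.eval {σ : Type} {r : σ → ∀ a : X.Rep, X.pr a ∈ U → ℂ}
    (H : ∀ i, RegularOn U (r i)) (F : MvPolynomial σ ℂ) :
    RegularOn U (fun a ha => MvPolynomial.eval (fun i => r i a ha) F) := by
  induction F using MvPolynomial.induction_on with
  | C c => simpa using RegularOn.const c
  | add p q hp hq => simpa using hp.add hq
  | mul_X p i hp => simpa using hp.mul (H i)

/-- The set where a regular function does not vanish is open. -/
theorem RegularOn.isOpen_ne_zero (H : RegularOn U h) {S : Set X.Pt}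
    (hS : ∀ a, X.pr a ∈ S ↔ ∃ ha, h a ha ≠ 0) : IsOpen S := by
  intro a ha
  obtain ⟨haU, hne⟩ := (hS a).mp ha
  obtain ⟨F, G, hG, e⟩ := H a haU
  obtain ⟨g, hg, hgU⟩ := U.isOpen a haU
  refine ⟨F * G * g, ?_, fun b hb => ?_⟩
  · rw [map_mul, map_mul]
    rw [e a haU hG] at hne
    exact mul_ne_zero (mul_ne_zero (div_ne_zero_iff.mp hne).1 hG) hg
  · rw [map_mul, map_mul] at hb
    have h1 := hgU b (right_ne_zero_of_mul hb)
    have h2 := right_ne_zero_of_mul (left_ne_zero_of_mul hb)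
    refine (hS b).mpr ⟨h1, ?_⟩
    rw [e b h1 h2]
    exact div_ne_zero (left_ne_zero_of_mul (left_ne_zero_of_mul hb)) h2

end CoordSpace

/-! ### The affine charts of the Grassmannian -/

/-- The `2 × 4` matrix in normal form with coordinates `t`: the columns `σ 2` and `σ 3` form the
identity matrix, and the columns `σ 0` and `σ 1` are given by `t`. -/
def normalForm {R : Type} [CommRing R] (σ : Equiv.Perm (Fin 4)) (t : Fin 2 × Fin 2 → R) :
    Fin 2 × Fin 4 → R := fun p =>
  ![t (0, p.1), t (1, p.1), if p.1 = 0 then 1 else 0, if p.1 = 1 then 1 else 0] (σ.symm p.2)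

section

theorem linearIndependent_rows_iff {A : Fin 2 × Fin 4 → ℂ} : LinearIndependent ℂ (rows A) ↔
    ∀ a b : ℂ, (∀ j, a * A (0, j) + b * A (1, j) = 0) → a = 0 ∧ b = 0 := by
  rw [Fintype.linearIndependent_iff]
  simp only [Fin.sum_univ_two, Fin.forall_fin_two]
  constructor
  · intro h a b hab
    exact h ![a, b] (funext hab)
  · intro h g hg
    exact h _ _ fun j => congrFun hg j

variable (σ : Equiv.Perm (Fin 4)) (t : Fin 2 × Fin 2 → ℂ)

theorem linearIndependent_normalForm : LinearIndependent ℂ (rows (normalForm σ t)) := by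
  rw [linearIndependent_rows_iff]
  intro a b h
  have h2 := h (σ 2)
  have h3 := h (σ 3)
  simp [normalForm] at h2 h3
  exact ⟨h2, h3⟩

/-- The line with coordinates `t` in the chart `σ`. -/
def chartLine : Line := spanLine (normalForm σ t) (linearIndependent_normalForm σ t)

theorem mem_spanLine {A : Fin 2 × Fin 4 → ℂ} {hA : LinearIndependent ℂ (rows A)}
    {v : Fin 4 → ℂ} :
    v ∈ (spanLine A hA).1 ↔ ∃ a b : ℂ, ∀ j, v j = a * A (0, j) + b * A (1, j) := by
  change v ∈ Submodule.span ℂ (Set.range (rows A)) ↔ _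
  rw [Submodule.mem_span_range_iff_exists_fun]
  simp only [Fin.sum_univ_two]
  constructor
  · rintro ⟨c, rfl⟩
    exact ⟨c 0, c 1, fun j => rfl⟩
  · rintro ⟨a, b, h⟩
    exact ⟨![a, b], funext fun j => (h j).symm⟩

theorem forall_perm {p : Fin 4 → Prop} : (∀ j, p j) ↔ p (σ 0) ∧ p (σ 1) ∧ p (σ 2) ∧ p (σ 3) := by
  rw [← σ.forall_congr_right, Fin.forall_fin_succ, Fin.forall_fin_succ, Fin.forall_fin_two]
  rfl

theorem mem_chartLine {v : Fin 4 → ℂ} : v ∈ (chartLine σ t).1 ↔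
    v (σ 0) = t (0, 0) * v (σ 2) + t (0, 1) * v (σ 3) ∧
      v (σ 1) = t (1, 0) * v (σ 2) + t (1, 1) * v (σ 3) := by
  rw [chartLine, mem_spanLine]
  simp only [forall_perm σ, normalForm, Equiv.symm_apply_apply, Matrix.cons_val_zero,
    Matrix.cons_val_one, Matrix.cons_val]
  constructor
  · rintro ⟨a, b, h0, h1, h2, h3⟩
    simp at h2 h3
    rw [h0, h1, h2, h3]
    constructor <;> ring
  · rintro ⟨h0, h1⟩
    refine ⟨v (σ 2), v (σ 3), ?_, ?_, by simp, by simp⟩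
    · rw [h0]; ring
    · rw [h1]; ring

/-- The rows of the normal form lie on the line. -/
theorem normalForm_mem_chartLine (i : Fin 2) : rows (normalForm σ t) i ∈ (chartLine σ t).1 :=
  Submodule.subset_span ⟨i, rfl⟩

theorem chartLine_injective : Function.Injective (chartLine σ) := by
  intro t t' h
  have h0 := normalForm_mem_chartLine σ t 0
  have h1 := normalForm_mem_chartLine σ t 1
  rw [h, mem_chartLine] at h0 h1
  simp [normalForm] at h0 h1
  ext ⟨i, j⟩
  fin_cases i <;> fin_cases j <;> simp [h0, h1]

variable {R : Type} [CommRing R]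

/-- The minor of a `2 × 4` matrix given by the columns `σ 2` and `σ 3`. -/
def minor (A : Fin 2 × Fin 4 → R) : R := A (0, σ 2) * A (1, σ 3) - A (0, σ 3) * A (1, σ 2)

/-- The minor of a `2 × 4` matrix that is the numerator of a chart coordinate, by Cramer's rule. -/
def numer (A : Fin 2 × Fin 4 → R) (p : Fin 2 × Fin 2) : R :=
  ![A (1, σ 3) * A (0, σ (p.1.castLE (by omega))) - A (0, σ 3) * A (1, σ (p.1.castLE (by omega))),
    A (0, σ 2) * A (1, σ (p.1.castLE (by omega))) -
      A (1, σ 2) * A (0, σ (p.1.castLE (by omega)))] p.2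

theorem eval_minor_X {I : Type} (ι : Fin 2 × Fin 4 → I) (c : I → ℂ) :
    eval c (minor σ fun q => (X (ι q) : MvPolynomial I ℂ)) = minor σ fun q => c (ι q) := by
  simp [minor]

theorem eval_numer_X {I : Type} (ι : Fin 2 × Fin 4 → I) (c : I → ℂ) (p : Fin 2 × Fin 2) :
    eval c (numer σ (fun q => (X (ι q) : MvPolynomial I ℂ)) p) = numer σ (fun q => c (ι q)) p := by
  obtain ⟨i, j⟩ := p
  fin_cases j <;> simp [numer]

theorem eval_normalForm {I : Type} (t : Fin 2 × Fin 2 → MvPolynomial I ℂ) (c : I → ℂ)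
    (p : Fin 2 × Fin 4) : eval c (normalForm σ t p) = normalForm σ (fun q => eval c (t q)) p := by
  obtain ⟨i, j⟩ := p
  obtain ⟨j, rfl⟩ := σ.surjective j
  fin_cases j <;> fin_cases i <;> simp [normalForm]

variable {σ t}

theorem spanLine_eq_chartLine {A : Fin 2 × Fin 4 → ℂ} (hA : LinearIndependent ℂ (rows A))
    (h : minor σ A ≠ 0) : spanLine A hA = chartLine σ fun p => numer σ A p / minor σ A := by
  refine Subtype.ext (Submodule.eq_of_le_of_finrank_eq ?_
    ((spanLine A hA).2.trans (chartLine σ _).2.symm))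
  refine Submodule.span_le.mpr ?_
  rintro _ ⟨i, rfl⟩
  refine (mem_chartLine σ _).mpr ?_
  fin_cases i <;> simp [numer] <;> constructor <;> field_simp <;> simp [minor] <;> ring

theorem minor_ne_zero {A : Fin 2 × Fin 4 → ℂ} {hA : LinearIndependent ℂ (rows A)}
    (h : spanLine A hA = chartLine σ t) : minor σ A ≠ 0 := by
  intro h0
  have key : ∀ a b : ℂ, a * A (0, σ 2) + b * A (1, σ 2) = 0 → a * A (0, σ 3) + b * A (1, σ 3) = 0 →
      a = 0 ∧ b = 0 := by
    intro a b h2 h3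
    have hv : (fun j => a * A (0, j) + b * A (1, j)) ∈ (chartLine σ t).1 := by
      rw [← h, mem_spanLine]
      exact ⟨a, b, fun _ => rfl⟩
    rw [mem_chartLine, h2, h3] at hv
    refine linearIndependent_rows_iff.mp hA a b ?_
    refine (forall_perm σ).mpr ⟨?_, ?_, h2, h3⟩
    · simpa using hv.1
    · simpa using hv.2
  unfold minor at h0
  have h1 := key (A (1, σ 3)) (-A (0, σ 3)) (by linear_combination h0) (by ring)
  have h2 := key (A (1, σ 2)) (-A (0, σ 2)) (by ring) (by linear_combination -h0)
  have h3 := key 1 0 (by simpa using h2.2) (by simpa using h1.2)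
  exact one_ne_zero h3.1

theorem numer_div_minor {A : Fin 2 × Fin 4 → ℂ} {hA : LinearIndependent ℂ (rows A)}
    (h : spanLine A hA = chartLine σ t) (p : Fin 2 × Fin 2) : t p = numer σ A p / minor σ A := by
  have := h.symm.trans (spanLine_eq_chartLine hA (minor_ne_zero h))
  exact congrFun (chartLine_injective σ this) p

/-- The charts cover the Grassmannian. -/
theorem exists_chartLine (ℓ : Line) : ∃ σ t, ℓ = chartLine σ t := by
  obtain ⟨A, hA, rfl⟩ := spanLine_surjective ℓ
  by_contra! H
  have hperm : ∀ i j : Fin 4, i ≠ j → ∃ σ : Equiv.Perm (Fin 4), σ 2 = i ∧ σ 3 = j := by decide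
  have hminor : ∀ i j, A (0, i) * A (1, j) - A (0, j) * A (1, i) = 0 := by
    intro i j
    by_cases hij : i = j
    · subst hij; ring
    · obtain ⟨σ, rfl, rfl⟩ := hperm i j hij
      by_contra h
      exact H σ _ (spanLine_eq_chartLine hA h)
  have h1 : ∀ j, A (1, j) = 0 := fun j =>
    (linearIndependent_rows_iff.mp hA (A (1, j)) (-A (0, j)) fun i => by
      linear_combination hminor i j).1
  exact one_ne_zero (linearIndependent_rows_iff.mp hA 0 1 fun j => by simp [h1]).2

variable (σ)

/-- The coordinates of a line in the chart `σ`; zero outside the domain of the chart. -/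
def chartCoord (ℓ : Line) : Fin 2 × Fin 2 → ℂ :=
  open Classical in if h : ∃ t, ℓ = chartLine σ t then h.choose else 0

theorem chartCoord_chartLine (t : Fin 2 × Fin 2 → ℂ) : chartCoord σ (chartLine σ t) = t := by
  have h : ∃ t', chartLine σ t = chartLine σ t' := ⟨t, rfl⟩
  rw [chartCoord, dif_pos h]
  exact (chartLine_injective σ h.choose_spec).symm

/-- The domain of the chart `σ`. -/
def chartDomain : Opens Gr.Pt where
  carrier := {ℓ | ∃ t, ℓ = chartLine σ t}
  is_open' := by
    rintro a ⟨t, ht⟩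
    exact ⟨(minor σ fun q => X q : MvPolynomial (Fin 2 × Fin 4) ℂ),
      fun h => minor_ne_zero (hA := a.2) ht ((eval_minor_X σ id a.1).symm.trans h),
      fun b hb => ⟨_, spanLine_eq_chartLine b.2 fun h => hb ((eval_minor_X σ id b.1).trans h)⟩⟩

theorem chartLine_mem (t : Fin 2 × Fin 2 → ℂ) : (chartLine σ t : Line) ∈ chartDomain σ := ⟨t, rfl⟩

variable {σ}

theorem chartLine_chartCoord {ℓ : Line} (h : ℓ ∈ chartDomain σ) :
    chartLine σ (chartCoord σ ℓ) = ℓ := by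
  obtain ⟨t, rfl⟩ := h
  rw [chartCoord_chartLine]

end

end LineSing

namespace LineSing

open CoordSpace MvPolynomial ConePoly

/-! ### Coordinates on `G(2,4) × ℙ³` adapted to a chart -/

/-- The vector with adapted coordinates `y`: its coordinates `σ 2` and `σ 3` are `y 2` and `y 3`,
and `y 0 = y 1 = 0` if and only if it lies on the line with coordinates `t`. -/
def toVec {R : Type} [CommRing R] (σ : Equiv.Perm (Fin 4)) (c : J → R) : Fin 4 → R := fun j =>
  ![c (.inr 0) + (c (.inl (0, 0)) * c (.inr 2) + c (.inl (0, 1)) * c (.inr 3)),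
    c (.inr 1) + (c (.inl (1, 0)) * c (.inr 2) + c (.inl (1, 1)) * c (.inr 3)),
    c (.inr 2), c (.inr 3)] (σ.symm j)

/-- The coordinates `(t, y)` of a pair of a line and a vector in the chart `σ`. -/
def coord (σ : Equiv.Perm (Fin 4)) (ℓ : Line) (v : Fin 4 → ℂ) : J → ℂ :=
  Sum.elim (chartCoord σ ℓ)
    ![v (σ 0) - (chartCoord σ ℓ (0, 0) * v (σ 2) + chartCoord σ ℓ (0, 1) * v (σ 3)),
      v (σ 1) - (chartCoord σ ℓ (1, 0) * v (σ 2) + chartCoord σ ℓ (1, 1) * v (σ 3)),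
      v (σ 2), v (σ 3)]

variable {σ : Equiv.Perm (Fin 4)}

theorem toVec_coord (ℓ : Line) (v : Fin 4 → ℂ) : toVec σ (coord σ ℓ v) = v := by
  refine funext ((forall_perm σ).mpr ⟨?_, ?_, ?_, ?_⟩) <;> simp [toVec, coord]

theorem coord_toVec (c : J → ℂ) : coord σ (chartLine σ fun p => c (.inl p)) (toVec σ c) = c := by
  funext j
  rcases j with p | j
  · simp [coord, chartCoord_chartLine]
  · fin_cases j <;> simp [coord, toVec, chartCoord_chartLine]

theorem coord_smul (ℓ : Line) (a : ℂ) (v : Fin 4 → ℂ) :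
    coord σ ℓ (a • v) = scale a (coord σ ℓ v) := by
  funext j
  rcases j with p | j
  · rfl
  · fin_cases j <;> simp [coord, scale] <;> ring

theorem toVec_scale (a : ℂ) (c : J → ℂ) : toVec σ (scale a c) = a • toVec σ c := by
  refine funext ((forall_perm σ).mpr ⟨?_, ?_, ?_, ?_⟩) <;> simp [toVec, scale] <;> ring

theorem toVec_ne_zero {c : J → ℂ} (h : ∃ j, c (.inr j) ≠ 0) : toVec σ c ≠ 0 := by
  intro h0
  obtain ⟨j, hj⟩ := h
  have h1 := coord_toVec (σ := σ) c
  rw [h0] at h1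
  refine hj ?_
  rw [← h1]
  fin_cases j <;> simp [coord]

theorem exists_coord_ne_zero (ℓ : Line) {v : Fin 4 → ℂ} (hv : v ≠ 0) :
    ∃ j, coord σ ℓ v (.inr j) ≠ 0 := by
  by_contra! h
  refine hv ?_
  rw [← toVec_coord (σ := σ) ℓ v]
  refine funext ((forall_perm σ).mpr ⟨?_, ?_, ?_, ?_⟩) <;> simp [toVec, h]

theorem coord_eq_zero_of_mem {ℓ : Line} (hℓ : ℓ ∈ chartDomain σ) {v : Fin 4 → ℂ} (hv : v ∈ ℓ.1) :
    coord σ ℓ v (.inr 0) = 0 ∧ coord σ ℓ v (.inr 1) = 0 := by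
  rw [← chartLine_chartCoord hℓ, mem_chartLine] at hv
  simp [coord, hv.1, hv.2]

theorem toVec_mem {c : J → ℂ} (h0 : c (.inr 0) = 0) (h1 : c (.inr 1) = 0) :
    toVec σ c ∈ (chartLine σ fun p => c (.inl p)).1 := by
  rw [mem_chartLine]
  simp [toVec, h0, h1]

/-- The line of a point of `X`. -/
abbrev lineOf (x : GrP.Pt) : Line := (show Line × Projectivization ℂ (Fin 4 → ℂ) from x).1

variable (σ)

/-- The part of `X` lying over the domain of a chart. -/
def chartDomainX : Opens GrP.Pt := (Opens.map proj).obj (chartDomain σ)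

/-- The homogeneous coordinates in the chart `σ` of a coordinate vector of `X`. -/
def repCoord (a : GrP.Rep) : J → ℂ := coord σ (lineOf (GrP.pr a)) (vec a.1)

/-- The coordinate vector on `X` with homogeneous coordinates `c` in the chart `σ`. -/
def repOf (c : J → ℂ) (hc : ∃ j, c (.inr j) ≠ 0) : GrP.Rep :=
  ⟨Sum.elim (normalForm σ fun p => c (.inl p)) (toVec σ c),
    linearIndependent_normalForm σ fun p => c (.inl p), toVec_ne_zero hc⟩

variable {σ}

theorem repCoord_repOf (c : J → ℂ) (hc : ∃ j, c (.inr j) ≠ 0) : repCoord σ (repOf σ c hc) = c :=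
  coord_toVec c

theorem repOf_mem (c : J → ℂ) (hc : ∃ j, c (.inr j) ≠ 0) :
    GrP.pr (repOf σ c hc) ∈ chartDomainX σ := chartLine_mem σ fun p => c (.inl p)

theorem exists_repCoord_ne_zero (a : GrP.Rep) : ∃ j, repCoord σ a (.inr j) ≠ 0 :=
  exists_coord_ne_zero _ a.2.2

theorem pr_repOf_repCoord (a : GrP.Rep) (ha : GrP.pr a ∈ chartDomainX σ) :
    GrP.pr (repOf σ (repCoord σ a) (exists_repCoord_ne_zero a)) = GrP.pr a := by
  refine Prod.ext ?_ ?_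
  · change chartLine σ (chartCoord σ (lineOf (GrP.pr a))) = lineOf (GrP.pr a)
    exact chartLine_chartCoord ha
  · refine (Projectivization.mk_eq_mk_iff' ℂ _ _ _ _).mpr ⟨1, ?_⟩
    exact (one_smul ℂ _).trans (toVec_coord _ _).symm

theorem pr_repOf_scale (c : J → ℂ) (hc : ∃ j, c (.inr j) ≠ 0) {a : ℂ}
    (hc' : ∃ j, scale a c (.inr j) ≠ 0) :
    GrP.pr (repOf σ (scale a c) hc') = GrP.pr (repOf σ c hc) := by
  refine Prod.ext rfl ?_
  exact (Projectivization.mk_eq_mk_iff' ℂ _ _ _ _).mpr ⟨a, (toVec_scale a c).symm⟩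

theorem scale_ne_zero {c : J → ℂ} (hc : ∃ j, c (.inr j) ≠ 0) {a : ℂ} (ha : a ≠ 0) :
    ∃ j, scale a c (.inr j) ≠ 0 := by
  obtain ⟨j, hj⟩ := hc
  exact ⟨j, mul_ne_zero ha hj⟩

variable (σ)

/-- The set of homogeneous coordinates of the points of `W` in the chart `σ`. -/
def cone (W : Opens GrP.Pt) : Set (J → ℂ) :=
  {c | ∃ hc : ∃ j, c (.inr j) ≠ 0, GrP.pr (repOf σ c hc) ∈ W}

variable {σ}

theorem cone_mono {W W' : Opens GrP.Pt} (h : W' ≤ W) : cone σ W' ⊆ cone σ W :=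
  fun _ hc => ⟨hc.1, h hc.2⟩

theorem scale_mem_cone {W : Opens GrP.Pt} {c : J → ℂ} (hc : c ∈ cone σ W) {a : ℂ} (ha : a ≠ 0) :
    scale a c ∈ cone σ W :=
  ⟨scale_ne_zero hc.1 ha, by rw [pr_repOf_scale c hc.1]; exact hc.2⟩

theorem repCoord_mem_cone {W : Opens GrP.Pt} {a : GrP.Rep} (ha : GrP.pr a ∈ W)
    (hW : GrP.pr a ∈ chartDomainX σ) : repCoord σ a ∈ cone σ W :=
  ⟨exists_repCoord_ne_zero a, by rw [pr_repOf_repCoord a hW]; exact ha⟩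

theorem eval_toVec {I : Type} (f : J → MvPolynomial I ℂ) (c : I → ℂ) (j : Fin 4) :
    eval c (toVec σ f j) = toVec σ (fun i => eval c (f i)) j := by
  obtain ⟨j, rfl⟩ := σ.surjective j
  fin_cases j <;> simp [toVec]

/-- A polynomial in the coordinates on `X`, in terms of the coordinates of the chart `σ`. -/
def pullPoly (σ : Equiv.Perm (Fin 4)) (F : MvPolynomial GrP.Idx ℂ) : MvPolynomial J ℂ :=
  aeval (Sum.elim (normalForm σ fun p => X (Sum.inl p)) (toVec σ X)) F

theorem eval_pullPoly (F : MvPolynomial GrP.Idx ℂ) (c : J → ℂ) (hc : ∃ j, c (.inr j) ≠ 0) :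
    eval c (pullPoly σ F) = eval (repOf σ c hc).1 F := by
  refine (eval_aeval c _ F).trans ?_
  refine congrArg (fun f => eval f F) (funext fun i => ?_)
  rcases i with p | j
  · refine (eval_normalForm σ (fun p => (X (Sum.inl p) : MvPolynomial J ℂ)) c p).trans ?_
    exact congrArg (fun t => normalForm σ t p) (funext fun q => eval_X _)
  · refine (eval_toVec (fun i => (X i : MvPolynomial J ℂ)) c j).trans ?_
    exact congrArg (fun t => toVec σ t j) (funext fun q => eval_X _)

/-- The cone over an open set is open in the Zariski topology. -/
theorem exists_polynomial_of_mem_cone {W : Opens GrP.Pt} {c : J → ℂ} (hc : c ∈ cone σ W) :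
    ∃ g : MvPolynomial J ℂ, eval c g ≠ 0 ∧ ∀ b, eval b g ≠ 0 → b ∈ cone σ W := by
  obtain ⟨⟨j, hj⟩, hW⟩ := hc
  obtain ⟨g, hg, hgW⟩ := W.isOpen _ hW
  refine ⟨pullPoly σ g * X (.inr j), ?_, fun b hb => ?_⟩
  · rw [map_mul, eval_pullPoly g c ⟨j, hj⟩, eval_X]
    exact mul_ne_zero hg hj
  · rw [map_mul, eval_X] at hb
    have hbj : ∃ j, b (.inr j) ≠ 0 := ⟨j, right_ne_zero_of_mul hb⟩
    rw [eval_pullPoly g b hbj] at hb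
    exact ⟨hbj, hgW _ (left_ne_zero_of_mul hb)⟩

/-- The coordinates in a chart are regular functions. -/
theorem regularOn_repCoord {W : Opens GrP.Pt} (hW : W ≤ chartDomainX σ) (j : J) :
    RegularOn W (fun a _ => repCoord σ a j) := by
  have hvec : ∀ i : Fin 4, RegularOn W (fun a _ => vec a.1 i) := fun i a _ =>
    ⟨X (Sum.inr i : (Fin 2 × Fin 4) ⊕ Fin 4), 1, by rw [map_one]; exact one_ne_zero, fun b _ _ => by
      rw [map_one, div_one]
      exact (eval_X (f := b.1) (Sum.inr i : (Fin 2 × Fin 4) ⊕ Fin 4)).symm⟩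
  have ht : ∀ p, RegularOn W (fun a _ => chartCoord σ (lineOf (GrP.pr a)) p) := fun p a ha => by
    refine ⟨numer σ (fun q => (X (.inl q) : MvPolynomial ((Fin 2 × Fin 4) ⊕ Fin 4) ℂ)) p,
      minor σ (fun q => (X (.inl q) : MvPolynomial ((Fin 2 × Fin 4) ⊕ Fin 4) ℂ)),
      fun h => ?_, fun b hb _ => ?_⟩
    · obtain ⟨t, ht⟩ := hW ha
      exact minor_ne_zero (hA := a.2.1) ht ((eval_minor_X σ Sum.inl a.1).symm.trans h)
    · refine Eq.trans ?_ (congrArg₂ (· / ·) (eval_numer_X σ Sum.inl b.1 p)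
        (eval_minor_X σ Sum.inl b.1)).symm
      exact numer_div_minor (hA := b.2.1) (chartLine_chartCoord (hW hb)).symm p
  rcases j with p | j
  · exact ht p
  · have key : ∀ i : Fin 2, RegularOn W (fun a _ =>
        (-1) * (chartCoord σ (lineOf (GrP.pr a)) (i, 0) *
        vec a.1 (σ 2) + chartCoord σ (lineOf (GrP.pr a)) (i, 1) * vec a.1 (σ 3))) := fun i =>
      (RegularOn.const (-1)).mul (((ht _).mul (hvec _)).add ((ht _).mul (hvec _)))
    fin_cases j
    · simpa [repCoord, coord, sub_eq_add_neg] using (hvec (σ 0)).add (key 0)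
    · simpa [repCoord, coord, sub_eq_add_neg] using (hvec (σ 1)).add (key 1)
    · exact hvec (σ 2)
    · exact hvec (σ 3)

end LineSing

namespace LineSing

open CoordSpace MvPolynomial ConePoly

/-! ### Sections of `I_Z^k(d)` in homogeneous coordinates -/

theorem twistEval_smul {d : ℤ} {W : Opens GrP.Pt} (s : ∀ x : W, twistFiber d (GrP.point x.1))
    {a b : GrP.Rep} (ha : GrP.pr a ∈ W) (hb : GrP.pr b ∈ W) (h : GrP.pr b = GrP.pr a) {t : ℂ}
    (hv : vec b.1 = t • vec a.1) : twistEval s b hb = t ^ d * twistEval s a ha := by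
  have key : ∀ (x y : W) (hx : x = y) (v : Cone (GrP.point x.1)) (w : Cone (GrP.point y.1)),
      w.1 = t • v.1 → (s y).1 w = t ^ d * (s x).1 v := by
    rintro x _ rfl v w hvw
    exact (s x).2 v w t hvw
  exact key ⟨GrP.pr a, ha⟩ ⟨GrP.pr b, hb⟩ (Subtype.ext h.symm) _ _ hv

theorem twistEval_congr {d : ℤ} {W : Opens GrP.Pt} (s : ∀ x : W, twistFiber d (GrP.point x.1))
    {a b : GrP.Rep} (ha : GrP.pr a ∈ W) (hb : GrP.pr b ∈ W) (h : GrP.pr b = GrP.pr a)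
    (hv : vec b.1 = vec a.1) : twistEval s b hb = twistEval s a ha := by
  rw [twistEval_smul s ha hb h (t := 1) (by rw [one_smul, hv]), one_zpow, one_mul]

/-- A function on the coordinate vectors over `W`, in terms of the coordinates of the chart `σ`;
zero outside the cone over `W`. -/
def pull (σ : Equiv.Perm (Fin 4)) {W : Opens GrP.Pt} (h : ∀ a : GrP.Rep, GrP.pr a ∈ W → ℂ)
    (c : J → ℂ) : ℂ :=
  open Classical in if hc : c ∈ cone σ W then h (repOf σ c hc.1) hc.2 else 0

/-- The expression of a section of `𝒪(d)` in the homogeneous coordinates of the chart `σ`. -/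
abbrev hat (σ : Equiv.Perm (Fin 4)) {d : ℤ} {W : Opens GrP.Pt}
    (s : ∀ x : W, twistFiber d (GrP.point x.1)) : (J → ℂ) → ℂ := pull σ (twistEval s)

variable {σ : Equiv.Perm (Fin 4)} {d : ℤ} {W : Opens GrP.Pt} {k : ℕ}

theorem pull_apply (h : ∀ a : GrP.Rep, GrP.pr a ∈ W → ℂ) {c : J → ℂ} (hc : c ∈ cone σ W) :
    pull σ h c = h (repOf σ c hc.1) hc.2 := dif_pos hc

theorem hat_res {W' : Opens GrP.Pt} (i : W' ≤ W) (s : ∀ x : W, twistFiber d (GrP.point x.1))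
    {c : J → ℂ} (hc : c ∈ cone σ W') :
    hat σ (res (fiber := fun x => twistFiber d (GrP.point x)) i s) c = hat σ s c := by
  rw [hat, hat, pull_apply _ hc, pull_apply _ (cone_mono i hc)]
  rfl

theorem hat_zero (c : J → ℂ) : hat σ (0 : ∀ x : W, twistFiber d (GrP.point x.1)) c = 0 := by
  by_cases hc : c ∈ cone σ W
  · rw [hat, pull_apply _ hc]
    rfl
  · exact dif_neg hc

theorem hat_add (s t : ∀ x : W, twistFiber d (GrP.point x.1)) (c : J → ℂ) :
    hat σ (s + t) c = hat σ s c + hat σ t c := by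
  by_cases hc : c ∈ cone σ W
  · rw [hat, hat, hat, pull_apply _ hc, pull_apply _ hc, pull_apply _ hc]
    rfl
  · simp only [hat, pull, dif_neg hc, add_zero]

theorem hat_neg (s : ∀ x : W, twistFiber d (GrP.point x.1)) (c : J → ℂ) :
    hat σ (-s) c = -hat σ s c := by
  by_cases hc : c ∈ cone σ W
  · rw [hat, hat, pull_apply _ hc, pull_apply _ hc]
    rfl
  · simp only [hat, pull, dif_neg hc, neg_zero]

theorem hat_scale (s : ∀ x : W, twistFiber d (GrP.point x.1)) {c : J → ℂ} (hc : c ∈ cone σ W)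
    {a : ℂ} (ha : a ≠ 0) : hat σ s (scale a c) = a ^ d * hat σ s c := by
  rw [hat, pull_apply _ hc, pull_apply _ (scale_mem_cone hc ha)]
  exact twistEval_smul s _ _ (pr_repOf_scale c hc.1 _) (toVec_scale a c)

theorem twistEval_eq_hat (hW : W ≤ chartDomainX σ) (s : ∀ x : W, twistFiber d (GrP.point x.1))
    (a : GrP.Rep) (ha : GrP.pr a ∈ W) : twistEval s a ha = hat σ s (repCoord σ a) := by
  rw [hat, pull_apply _ (repCoord_mem_cone ha (hW ha))]
  exact twistEval_congr s _ _ (pr_repOf_repCoord a (hW ha)).symm (toVec_coord _ _).symm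

theorem eq_of_hat_eq (hW : W ≤ chartDomainX σ) {s t : ∀ x : W, twistFiber d (GrP.point x.1)}
    (h : ∀ c ∈ cone σ W, hat σ s c = hat σ t c) : s = t := by
  funext ⟨x, hx⟩
  obtain ⟨a, rfl⟩ := GrP.pr_surjective x
  have key : twistEval s a hx = twistEval t a hx := by
    rw [twistEval_eq_hat hW, twistEval_eq_hat hW, h _ (repCoord_mem_cone hx (hW hx))]
  refine Subtype.ext (funext fun v => ?_)
  obtain ⟨hv, e⟩ := v.2
  obtain ⟨r, hr⟩ := (Projectivization.mk_eq_mk_iff' ℂ _ _ hv a.2.2).mp e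
  rw [(s ⟨GrP.pr a, hx⟩).2 ⟨vec a.1, a.2.2, rfl⟩ v r hr.symm,
    (t ⟨GrP.pr a, hx⟩).2 ⟨vec a.1, a.2.2, rfl⟩ v r hr.symm]
  exact congrArg (r ^ d * ·) key

theorem coord_mem_cone (hW : W ≤ chartDomainX σ) (x : W) (v : Cone (GrP.point x.1)) :
    coord σ (lineOf x.1) v.1 ∈ cone σ W := by
  obtain ⟨hv, e⟩ := v.2
  refine ⟨exists_coord_ne_zero _ hv, ?_⟩
  have : GrP.pr (repOf σ (coord σ (lineOf x.1) v.1) (exists_coord_ne_zero _ hv)) = x.1 := by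
    refine Prod.ext (chartLine_chartCoord (hW x.2)) (Eq.trans ?_ e)
    refine (Projectivization.mk_eq_mk_iff' ℂ _ _ _ _).mpr ⟨1, ?_⟩
    exact (one_smul ℂ _).trans (toVec_coord _ _).symm
  rw [this]
  exact x.2

/-- The family of vectors of `𝒪(d)` given by a function of the homogeneous coordinates that is
homogeneous of degree `d`. -/
def ofHat (hW : W ≤ chartDomainX σ) (H : (J → ℂ) → ℂ)
    (hH : ∀ c ∈ cone σ W, ∀ a : ℂ, a ≠ 0 → H (scale a c) = a ^ d * H c) :
    ∀ x : W, twistFiber d (GrP.point x.1) := fun x =>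
  ⟨fun v => H (coord σ (lineOf x.1) v.1), fun v w t hvw => by
    have ht : t ≠ 0 := by
      rintro rfl
      obtain ⟨hw, -⟩ := w.2
      exact hw (hvw.trans (zero_smul ℂ _))
    change H (coord σ (lineOf x.1) w.1) = t ^ d * H (coord σ (lineOf x.1) v.1)
    rw [hvw, coord_smul, hH _ (coord_mem_cone hW x v) t ht]⟩

theorem twistEval_ofHat (hW : W ≤ chartDomainX σ) (H : (J → ℂ) → ℂ)
    (hH : ∀ c ∈ cone σ W, ∀ a : ℂ, a ≠ 0 → H (scale a c) = a ^ d * H c) (a : GrP.Rep)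
    (ha : GrP.pr a ∈ W) : twistEval (ofHat hW H hH) a ha = H (repCoord σ a) := rfl

theorem hat_ofHat (hW : W ≤ chartDomainX σ) (H : (J → ℂ) → ℂ)
    (hH : ∀ c ∈ cone σ W, ∀ a : ℂ, a ≠ 0 → H (scale a c) = a ^ d * H c) {c : J → ℂ}
    (hc : c ∈ cone σ W) : hat σ (ofHat hW H hH) c = H c := by
  rw [hat, pull_apply _ hc, twistEval_ofHat, repCoord_repOf]

/-- `h` is, locally on `S`, a quotient of polynomials with numerator in the `k`-th power of the
ideal `(y₀, y₁)` of the incidence variety. -/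
def LocalQuot (k : ℕ) (S : Set (J → ℂ)) (h : (J → ℂ) → ℂ) : Prop :=
  ∀ a ∈ S, ∃ F ∈ pairIdeal (Sum.inr 0 : J) (Sum.inr 1) k, ∃ G : MvPolynomial J ℂ, eval a G ≠ 0 ∧
    ∀ b ∈ S, h b * eval b G = eval b F

theorem LocalQuot.congr {S : Set (J → ℂ)} {h h' : (J → ℂ) → ℂ} (H : LocalQuot k S h)
    (e : ∀ c ∈ S, h' c = h c) : LocalQuot k S h' := fun a ha => by
  obtain ⟨F, hF, G, hG, hE⟩ := H a ha
  exact ⟨F, hF, G, hG, fun b hb => by rw [e b hb, hE b hb]⟩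

theorem LocalQuot.zero (S : Set (J → ℂ)) : LocalQuot k S 0 := fun a _ =>
  ⟨0, Ideal.zero_mem _, 1, by simp, fun b _ => by simp⟩

theorem LocalQuot.add {S : Set (J → ℂ)} {h h' : (J → ℂ) → ℂ} (H : LocalQuot k S h)
    (H' : LocalQuot k S h') : LocalQuot k S (h + h') := fun a ha => by
  obtain ⟨F, hF, G, hG, hE⟩ := H a ha
  obtain ⟨F', hF', G', hG', hE'⟩ := H' a ha
  refine ⟨G' * F + G * F', Ideal.add_mem _ (Ideal.mul_mem_left _ _ hF) (Ideal.mul_mem_left _ _ hF'),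
    G * G', by rw [map_mul]; exact mul_ne_zero hG hG', fun b hb => ?_⟩
  rw [map_add, map_mul, map_mul, map_mul, ← hE b hb, ← hE' b hb, Pi.add_apply]
  ring

theorem LocalQuot.mul {k k' : ℕ} {S : Set (J → ℂ)} {h h' : (J → ℂ) → ℂ} (H : LocalQuot k S h)
    (H' : LocalQuot k' S h') : LocalQuot (k + k') S (h * h') := fun a ha => by
  obtain ⟨F, hF, G, hG, hE⟩ := H a ha
  obtain ⟨F', hF', G', hG', hE'⟩ := H' a ha
  refine ⟨F * F', pairIdeal_mul hF hF', G * G', by rw [map_mul]; exact mul_ne_zero hG hG',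
    fun b hb => ?_⟩
  rw [map_mul, map_mul, ← hE b hb, ← hE' b hb, Pi.mul_apply]
  ring

theorem LocalQuot.of_regularOn {h : ∀ a : GrP.Rep, GrP.pr a ∈ W → ℂ} (H : RegularOn W h) :
    LocalQuot 0 (cone σ W) (pull σ h) := fun c hc => by
  obtain ⟨F, G, hG, e⟩ := H (repOf σ c hc.1) hc.2
  refine ⟨pullPoly σ F * pullPoly σ G, ?_, pullPoly σ G * pullPoly σ G, ?_, fun b hb => ?_⟩
  · rw [pairIdeal, pow_zero, Ideal.one_eq_top]
    trivial
  · rw [map_mul, eval_pullPoly G c hc.1]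
    exact mul_ne_zero hG hG
  · rw [map_mul, map_mul, eval_pullPoly F b hb.1, eval_pullPoly G b hb.1, pull_apply _ hb]
    by_cases h0 : eval (repOf σ b hb.1).1 G = 0
    · rw [h0, mul_zero, mul_zero, mul_zero]
    · rw [e _ hb.2 h0]
      field_simp

/-- A function of `O W` in terms of the coordinates of the chart. -/
abbrev pullO (σ : Equiv.Perm (Fin 4)) (f : GrP.O W) : (J → ℂ) → ℂ :=
  pull σ fun a ha => f.1 ⟨GrP.pr a, ha⟩

theorem pr_repOf_mem_Z {c : J → ℂ} (hc : ∃ j, c (.inr j) ≠ 0) (h0 : c (.inr 0) = 0)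
    (h1 : c (.inr 1) = 0) : GrP.pr (repOf σ c hc) ∈ Z := by
  change (Projectivization.mk ℂ (toVec σ c) (toVec_ne_zero hc)).submodule ≤
    (chartLine σ fun p => c (.inl p)).1
  rw [Projectivization.submodule_mk, Submodule.span_singleton_le_iff_mem]
  exact toVec_mem h0 h1

theorem repCoord_eq_zero_of_mem_Z {a : GrP.Rep} (ha : GrP.pr a ∈ chartDomainX σ)
    (hZ : GrP.pr a ∈ Z) : repCoord σ a (.inr 0) = 0 ∧ repCoord σ a (.inr 1) = 0 := by
  change (Projectivization.mk ℂ (vec a.1) a.2.2).submodule ≤ (lineOf (GrP.pr a)).1 at hZ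
  rw [Projectivization.submodule_mk, Submodule.span_singleton_le_iff_mem] at hZ
  exact coord_eq_zero_of_mem ha hZ

theorem LocalQuot.of_mem_idealZ {f : GrP.O W} (hf : f ∈ idealZ W) :
    LocalQuot 1 (cone σ W) (pullO σ f) := fun a ha => by
  obtain ⟨F, -, G, hG, e⟩ := LocalQuot.of_regularOn (σ := σ) f.2 a ha
  obtain ⟨g, hg, hgW⟩ := exists_polynomial_of_mem_cone ha
  refine ⟨F * g, ?_, G * g, by rw [map_mul]; exact mul_ne_zero hG hg, fun b hb => ?_⟩
  · rw [pairIdeal, pow_one]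
    refine mem_span_pair_of_eval_eq_zero fun c h0 h1 => ?_
    rw [map_mul]
    by_cases hgc : eval c g = 0
    · rw [hgc, mul_zero]
    · have hc := hgW c hgc
      rw [← e c hc, pull_apply _ hc, hf ⟨_, hc.2⟩ (pr_repOf_mem_Z hc.1 h0 h1), zero_mul, zero_mul]
  · rw [map_mul, map_mul, ← e b hb, mul_assoc]

theorem LocalQuot.of_mem_idealZ_pow {f : GrP.O W} (hf : f ∈ idealZ W ^ k) :
    LocalQuot k (cone σ W) (pullO σ f) := by
  induction k generalizing f with
  | zero => exact LocalQuot.of_regularOn f.2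
  | succ k ih =>
    rw [pow_succ] at hf
    refine Submodule.mul_induction_on hf (fun g hg g' hg' => ?_) (fun g g' hg hg' => ?_)
    · refine ((ih hg).mul (LocalQuot.of_mem_idealZ hg')).congr fun c hc => ?_
      rw [Pi.mul_apply, pullO, pullO, pullO, pull_apply _ hc, pull_apply _ hc, pull_apply _ hc]
      rfl
    · refine (hg.add hg').congr fun c hc => ?_
      rw [Pi.add_apply, pullO, pullO, pullO, pull_apply _ hc, pull_apply _ hc, pull_apply _ hc]
      rfl

theorem hat_smul (f : GrP.O W) (s : ∀ x : W, twistFiber d (GrP.point x.1)) {c : J → ℂ}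
    (hc : c ∈ cone σ W) :
    hat σ (d := d) (f • (show ∀ x : W, (twist d).fiber x.1 from s)) c =
      pullO σ f c * hat σ s c := by
  refine (pull_apply _ hc).trans ?_
  rw [pullO, hat, pull_apply _ hc, pull_apply _ hc]
  rfl

/-- The sections of `I_Z^k(d)` are local quotients. The polynomial `g` supported in the cone over a
smaller open set turns an identity on that open set into one on all of `W`. -/
theorem LocalQuot.of_sec {s : ∀ x : W, twistFiber d (GrP.point x.1)}
    (hs : s ∈ (idealPow k d).sec W) : LocalQuot k (cone σ W) (hat σ s) := fun a ha => by
  obtain ⟨W', i, hx, hspan⟩ := hs _ ha.2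
  have key : ∀ u : ∀ x : W', (twist d).fiber x.1, u ∈ Submodule.span (GrP.O W')
      {u : ∀ x : W', (twist d).fiber x.1 |
        ∃ f ∈ idealZ W' ^ k, ∃ s ∈ (twist d).sec W', u = f • s} →
      LocalQuot k (cone σ W') (hat σ (d := d) u) := by
    intro u hu
    induction hu using Submodule.span_induction with
    | mem u hu =>
      obtain ⟨f, hf, t, ht, rfl⟩ := hu
      exact ((LocalQuot.of_mem_idealZ_pow hf).mul (LocalQuot.of_regularOn ht)).congr
        fun c hc => hat_smul f t hc
    | zero => exact (LocalQuot.zero _).congr fun c _ => hat_zero c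
    | add u v _ _ hu hv => exact (hu.add hv).congr fun c _ => hat_add _ _ c
    | smul f u _ hu =>
      have := (LocalQuot.of_regularOn (σ := σ) f.2).mul hu
      rw [zero_add] at this
      exact this.congr fun c hc => hat_smul f u hc
  have ha' : a ∈ cone σ W' := ⟨ha.1, hx⟩
  obtain ⟨F, hF, G, hG, e⟩ := key _ hspan a ha'
  obtain ⟨g, hg, hgW⟩ := exists_polynomial_of_mem_cone ha'
  refine ⟨F * g, Ideal.mul_mem_right _ _ hF, G * g, by rw [map_mul]; exact mul_ne_zero hG hg,
    fun b hb => ?_⟩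
  rw [map_mul, map_mul]
  by_cases hgb : eval b g = 0
  · rw [hgb, mul_zero, mul_zero, mul_zero]
  · have hb' := hgW b hgb
    rw [← e b hb', ← mul_assoc]
    exact congrArg (fun z => z * eval b G * eval b g) (hat_res i s hb').symm

theorem isYHom_mul {F G : MvPolynomial J ℂ} {m n : ℕ} (hF : IsYHom F m) (hG : IsYHom G n) :
    IsYHom (F * G) (m + n) := IsWeightedHomogeneous.mul hF hG

theorem isYHom_pow {F : MvPolynomial J ℂ} {m : ℕ} (hF : IsYHom F m) (n : ℕ) :
    IsYHom (F ^ n) (n * m) := IsWeightedHomogeneous.pow hF n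

/-- A local quotient that is homogeneous of degree `d` is a local quotient of homogeneous
polynomials. One passes to components of numerator and denominator after multiplication by a power
of a coordinate `y_l`, which makes the degrees as large as needed. -/
theorem LocalQuot.exists_homogeneous {h : (J → ℂ) → ℂ} (H : LocalQuot k (cone σ W) h)
    (hh : ∀ c ∈ cone σ W, ∀ a : ℂ, a ≠ 0 → h (scale a c) = a ^ d * h c) {c : J → ℂ}
    (hc : c ∈ cone σ W) : ∃ n e : ℕ, (e : ℤ) = n + d ∧ 1 ≤ n ∧ k ≤ e ∧
      ∃ F ∈ pairIdeal (Sum.inr 0 : J) (Sum.inr 1) k, IsYHom F e ∧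
      ∃ G : MvPolynomial J ℂ, IsYHom G n ∧ eval c G ≠ 0 ∧
        (∃ l, ∀ b, eval b G ≠ 0 → b (.inr l) ≠ 0) ∧
        ∀ b ∈ cone σ W, h b * eval b G = eval b F := by
  obtain ⟨F, hF, G, hG, e⟩ := H c hc
  obtain ⟨n, hn⟩ := exists_yComp_ne_zero hG
  obtain ⟨l, hl⟩ := hc.1
  obtain ⟨M, hM⟩ : ∃ M : ℕ, M = d.natAbs + k + 1 := ⟨_, rfl⟩
  obtain ⟨D, hD⟩ : ∃ D : ℕ, (D : ℤ) = d + M := ⟨(d + M).toNat, by omega⟩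
  have hX : IsYHom (X (Sum.inr l) ^ M) M := by
    simpa using isYHom_pow (isYHom_X_inr l) M
  have hGX : IsYHom (yComp n G * X (.inr l) ^ M) (n + M) := isYHom_mul (isYHom_yComp n G) hX
  have hFX : yComp (n + D) (F * X (.inr l) ^ M) ∈ pairIdeal (Sum.inr 0 : J) (Sum.inr 1) k :=
    yComp_mem_pairIdeal (by simp) (Ideal.mul_mem_right _ _ hF) _
  refine ⟨n + M, n + D, ?_, ?_, ?_, _, hFX, isYHom_yComp _ _, _, hGX, ?_, ⟨l, fun b hb => ?_⟩,
    fun b hb => ?_⟩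
  · push_cast
    omega
  · omega
  · omega
  · rw [map_mul, map_pow, eval_X]
    exact mul_ne_zero hn (pow_ne_zero _ hl)
  · rw [map_mul, map_pow, eval_X] at hb
    intro h0
    exact right_ne_zero_of_mul hb (by rw [h0, zero_pow (by omega)])
  -- Compare the coefficients of the restrictions of both sides to the curve `a ↦ scale a b`.
  · obtain ⟨p, hp, hpe⟩ := exists_eval_scale_eq G b
    obtain ⟨q, hq, hqe⟩ := exists_eval_scale_eq (F * X (.inr l) ^ M) b
    have key : q = p * Polynomial.monomial D (h b * b (.inr l) ^ M) := by
      have h0 : Polynomial.X * q =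
          Polynomial.X * (p * Polynomial.monomial D (h b * b (.inr l) ^ M)) := by
        refine Polynomial.funext fun a => ?_
        simp only [Polynomial.eval_mul, Polynomial.eval_X, hpe, hqe, Polynomial.eval_monomial]
        by_cases ha : a = 0
        · rw [ha, zero_mul, zero_mul]
        · have h1 := e _ (scale_mem_cone hb ha)
          have h2 : a ^ D = a ^ d * a ^ M := by
            rw [← zpow_natCast, hD, zpow_add₀ ha, zpow_natCast]
          rw [map_mul, ← h1, hh b hb a ha, map_pow, eval_X, h2]
          simp only [scale, Sum.elim_inr, mul_pow]
          ring
      exact mul_left_cancel₀ Polynomial.X_ne_zero h0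
    rw [← hq, key, map_mul, ← hp, map_pow, eval_X, ← Polynomial.C_mul_X_pow_eq_monomial,
      ← mul_assoc p, Polynomial.coeff_mul_X_pow, Polynomial.coeff_mul_C]
    ring

end LineSing

namespace LineSing

open CoordSpace MvPolynomial ConePoly

/-! ### Basic open sets over a chart -/

section

variable {σ : Equiv.Perm (Fin 4)} {d : ℤ} {W : Opens GrP.Pt} {k : ℕ}

theorem regularOn_scale_repCoord (hW : W ≤ chartDomainX σ) (r : ℂ) (j : J) :
    RegularOn W (fun a _ => scale r (repCoord σ a) j) := by
  rcases j with p | j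
  · exact regularOn_repCoord hW (.inl p)
  · exact (RegularOn.const r).mul (regularOn_repCoord hW (.inr j))

theorem pr_repOf_scale_repCoord {a : GrP.Rep} (ha : GrP.pr a ∈ chartDomainX σ) {r : ℂ}
    (hr : ∃ j, scale r (repCoord σ a) (.inr j) ≠ 0) :
    GrP.pr (repOf σ (scale r (repCoord σ a)) hr) = GrP.pr a :=
  (pr_repOf_scale _ (exists_repCoord_ne_zero a) hr).trans (pr_repOf_repCoord a ha)

theorem exists_eq_scale {c : J → ℂ} {hc : ∃ j, c (.inr j) ≠ 0} {a : GrP.Rep}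
    (hx : GrP.pr (repOf σ c hc) = GrP.pr a) : ∃ r : ℂ, r ≠ 0 ∧ c = scale r (repCoord σ a) := by
  obtain ⟨r, h⟩ := (Projectivization.mk_eq_mk_iff ℂ _ _ (repOf σ c hc).2.2 a.2.2).mp
    (congrArg GrP.point hx)
  refine ⟨r, r.ne_zero, ?_⟩
  rw [repCoord, ← coord_smul, ← coord_toVec (σ := σ) c]
  exact congrArg₂ (coord σ) (congrArg lineOf hx) h.symm

variable (σ) in
/-- The set of points over the domain of a chart that have homogeneous coordinates at which `G`
does not vanish. -/
def basicOpen (G : MvPolynomial J ℂ) : Opens GrP.Pt where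
  carrier := {x | ∃ c, ∃ hc : ∃ j, c (.inr j) ≠ 0, GrP.pr (repOf σ c hc) = x ∧ eval c G ≠ 0}
  is_open' := by
    rintro a ⟨c, hc, hx, hG⟩
    have ha : GrP.pr a ∈ chartDomainX σ := by rw [← hx]; exact repOf_mem c hc
    obtain ⟨r, hr, rfl⟩ := exists_eq_scale hx
    obtain ⟨F', G', hG', e⟩ := RegularOn.eval (fun j => regularOn_scale_repCoord le_rfl r j) G a ha
    obtain ⟨g, hg, hgW⟩ := (chartDomainX σ).isOpen a ha
    refine ⟨F' * G' * g, ?_, fun b hb => ?_⟩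
    · rw [map_mul, map_mul]
      have h1 := e a ha hG'
      refine mul_ne_zero (mul_ne_zero (fun h0 => hG ?_) hG') hg
      rw [h0, zero_div] at h1
      exact h1
    · rw [map_mul, map_mul] at hb
      have hbU := hgW b (right_ne_zero_of_mul hb)
      have hb1 := right_ne_zero_of_mul (left_ne_zero_of_mul hb)
      have hb2 := left_ne_zero_of_mul (left_ne_zero_of_mul hb)
      have h1 := e b hbU hb1
      refine ⟨_, scale_ne_zero (exists_repCoord_ne_zero b) hr, pr_repOf_scale_repCoord hbU _, ?_⟩
      exact fun h0 => div_ne_zero hb2 hb1 (h1.symm.trans h0)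

theorem basicOpen_le (G : MvPolynomial J ℂ) : basicOpen σ G ≤ chartDomainX σ := by
  rintro x ⟨c, hc, rfl, -⟩
  exact repOf_mem c hc

theorem mem_cone_basicOpen {G : MvPolynomial J ℂ} {n : ℕ} (hG : IsYHom G n) {c : J → ℂ} :
    c ∈ cone σ (basicOpen σ G) ↔ (∃ j, c (.inr j) ≠ 0) ∧ eval c G ≠ 0 := by
  constructor
  · rintro ⟨hc, c', hc', hx, h⟩
    obtain ⟨r, hr, rfl⟩ := exists_eq_scale hx
    rw [repCoord_repOf, hG.eval_scale] at h
    exact ⟨hc, right_ne_zero_of_mul h⟩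
  · rintro ⟨hc, h⟩
    exact ⟨hc, c, hc, rfl, h⟩

theorem exists_ne_zero_of_eval {G : MvPolynomial J ℂ} {n : ℕ} (hG : IsYHom G n) (hn : 1 ≤ n)
    {c : J → ℂ} (h : eval c G ≠ 0) : ∃ j, c (.inr j) ≠ 0 := by
  by_contra! h0
  refine h ?_
  have : c = scale 0 c := by
    funext j
    rcases j with p | j
    · rfl
    · simp [scale, h0]
  rw [this, hG.eval_scale, zero_pow (by omega), zero_mul]

/-- The cone over a basic open set given by a polynomial of positive degree. -/
theorem mem_cone_basicOpen_of_pos {G : MvPolynomial J ℂ} {n : ℕ} (hG : IsYHom G n) (hn : 1 ≤ n)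
    {c : J → ℂ} : c ∈ cone σ (basicOpen σ G) ↔ eval c G ≠ 0 :=
  (mem_cone_basicOpen hG).trans ⟨fun h => h.2, fun h => ⟨exists_ne_zero_of_eval hG hn h, h⟩⟩

theorem le_of_cone_subset {W W' : Opens GrP.Pt} (hW : W ≤ chartDomainX σ)
    (h : cone σ W ⊆ cone σ W') : W ≤ W' := by
  intro x hx
  obtain ⟨a, rfl⟩ := GrP.pr_surjective x
  have := (h (repCoord_mem_cone hx (hW hx))).2
  rwa [pr_repOf_repCoord a (hW hx)] at this

theorem cone_inf (W W' : Opens GrP.Pt) : cone σ (W ⊓ W') = cone σ W ∩ cone σ W' := by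
  ext c
  exact ⟨fun h => ⟨⟨h.1, h.2.1⟩, h.1, h.2.2⟩, fun h => ⟨h.1.1, h.1.2, h.2.2⟩⟩

/-! ### The criterion for sections of `I_Z^k(d)` -/

variable (σ) in
/-- The function on `W` given by a function of degree `0` of the homogeneous coordinates. -/
def funOf (W : Opens GrP.Pt) (H : (J → ℂ) → ℂ) : W → ℂ := fun x =>
  H (coord σ (lineOf x.1) (GrP.point x.1).rep)

theorem funOf_pr (hW : W ≤ chartDomainX σ) {H : (J → ℂ) → ℂ}
    (hH : ∀ c ∈ cone σ W, ∀ a : ℂ, a ≠ 0 → H (scale a c) = H c) (a : GrP.Rep)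
    (ha : GrP.pr a ∈ W) : funOf σ W H ⟨GrP.pr a, ha⟩ = H (repCoord σ a) := by
  obtain ⟨r, hr⟩ := Projectivization.exists_smul_eq_mk_rep ℂ (vec a.1) a.2.2
  have h1 : (GrP.point (GrP.pr a)).rep = (r : ℂ) • vec a.1 := hr.symm
  rw [funOf, h1, coord_smul]
  exact hH _ (repCoord_mem_cone ha (hW ha)) r r.ne_zero

theorem funOf_mem (hW : W ≤ chartDomainX σ) {H : (J → ℂ) → ℂ}
    (hH : ∀ c ∈ cone σ W, ∀ a : ℂ, a ≠ 0 → H (scale a c) = H c)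
    (hr : RegularOn W fun a _ => H (repCoord σ a)) : funOf σ W H ∈ GrP.O W := by
  have : (fun (a : GrP.Rep) (ha : GrP.pr a ∈ W) => funOf σ W H ⟨GrP.pr a, ha⟩) =
      fun a _ => H (repCoord σ a) := by
    funext a ha
    exact funOf_pr hW hH a ha
  change RegularOn W fun (a : GrP.Rep) (ha : GrP.pr a ∈ W) => funOf σ W H ⟨GrP.pr a, ha⟩
  rwa [this]

theorem pullO_funOf (hW : W ≤ chartDomainX σ) {H : (J → ℂ) → ℂ}
    (hH : ∀ c ∈ cone σ W, ∀ a : ℂ, a ≠ 0 → H (scale a c) = H c)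
    (hr : RegularOn W fun a _ => H (repCoord σ a)) {c : J → ℂ} (hc : c ∈ cone σ W) :
    pullO σ ⟨funOf σ W H, funOf_mem hW hH hr⟩ c = H c := by
  refine (pull_apply _ hc).trans ((funOf_pr hW hH _ _).trans ?_)
  rw [repCoord_repOf]

theorem hat_sum {ι : Type} (t : Finset ι) (s : ι → ∀ x : W, twistFiber d (GrP.point x.1))
    (c : J → ℂ) : hat σ (∑ i ∈ t, s i) c = ∑ i ∈ t, hat σ (s i) c :=
  map_sum (AddMonoidHom.mk' (fun s : ∀ x : W, twistFiber d (GrP.point x.1) => hat σ s c)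
    fun s t => hat_add s t c) s t

/-- The local quotients of degree `d` are sections of `I_Z^k(d)`. With homogeneous numerator
`∑ i, D i * y₀ ^ i * y₁ ^ (k - i)` and denominator `G`, the section is the combination of the
sections `y_l ^ k * D i / G` of `𝒪(d)` with coefficients `(y₀ / y_l) ^ i * (y₁ / y_l) ^ (k - i)`. -/
theorem sec_of_localQuot (hW : W ≤ chartDomainX σ) (s : ∀ x : W, twistFiber d (GrP.point x.1))
    (H : LocalQuot k (cone σ W) (hat σ s)) : s ∈ (idealPow k d).sec W := by
  intro x hx
  obtain ⟨a, rfl⟩ := GrP.pr_surjective x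
  have ha := repCoord_mem_cone hx (hW hx)
  obtain ⟨n, e, hne, hn, hke, F, hF, hFe, G, hGn, hG, ⟨l, hl⟩, E⟩ :=
    H.exists_homogeneous (fun c hc a ha => hat_scale s hc ha) ha
  obtain ⟨C, hC⟩ := exists_eq_sum_of_mem_pairIdeal hF
  let W' := W ⊓ basicOpen σ G
  have hW' : W' ≤ chartDomainX σ := inf_le_left.trans hW
  have hcone : ∀ c ∈ cone σ W', eval c G ≠ 0 := fun c hc =>
    ((mem_cone_basicOpen hGn).mp (cone_mono inf_le_right hc)).2
  have hGr : ∀ (a : GrP.Rep) (_ : GrP.pr a ∈ W'), eval (repCoord σ a) G ≠ 0 := fun a ha =>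
    hcone _ (repCoord_mem_cone ha (hW' ha))
  have hlr : ∀ (a : GrP.Rep) (_ : GrP.pr a ∈ W'), repCoord σ a (.inr l) ≠ 0 := fun a ha =>
    hl _ (hGr a ha)
  refine ⟨W', inf_le_left, ⟨hx, ?_⟩, ?_⟩
  · exact ⟨_, ha.1, pr_repOf_repCoord a (hW hx), hG⟩
  -- The quotients `y₀ / y_l` and `y₁ / y_l` generate the ideal of `Z`.
  let Q : Fin 4 → (J → ℂ) → ℂ := fun j c => c (.inr j) / c (.inr l)
  have hq0 : ∀ (j : Fin 4), ∀ c ∈ cone σ W', ∀ a : ℂ, a ≠ 0 → Q j (scale a c) = Q j c :=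
      fun j c _ a ha =>
    mul_div_mul_left _ _ ha
  have hqr : ∀ j : Fin 4, RegularOn W' fun a _ => Q j (repCoord σ a) :=
    fun j => by
      simpa [Q, div_eq_mul_inv] using (regularOn_repCoord hW' _).mul
        ((regularOn_repCoord hW' (.inr l)).inv hlr)
  let q : Fin 4 → GrP.O W' := fun j =>
    ⟨funOf σ W' (Q j), funOf_mem hW' (hq0 j) (hqr j)⟩
  have hqI : ∀ j : Fin 4, (∀ c : J → ℂ, c (.inr 0) = 0 → c (.inr 1) = 0 → c (.inr j) = 0) →
      q j ∈ idealZ W' := by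
    rintro j hj ⟨x, hx⟩ hxZ
    obtain ⟨a, rfl⟩ := GrP.pr_surjective x
    obtain ⟨h0, h1⟩ := repCoord_eq_zero_of_mem_Z (hW' hx) hxZ
    refine (funOf_pr hW' (hq0 j) a hx).trans ?_
    simp only [Q, hj _ h0 h1, zero_div]
  let D : ℕ → MvPolynomial J ℂ := fun i => yComp (e - k) (C i)
  have hD : ∀ i, IsYHom (D i) (e - k) := fun i => isYHom_yComp _ _
  let S : ℕ → (J → ℂ) → ℂ := fun i c => c (.inr l) ^ k * (eval c (D i) / eval c G)
  have hS : ∀ i, ∀ c ∈ cone σ W', ∀ a : ℂ, a ≠ 0 → S i (scale a c) = a ^ d * S i c := by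
    intro i c hc a ha
    have h1 : a ^ d = a ^ k * a ^ (e - k) / a ^ n := by
      rw [← pow_add, Nat.add_sub_cancel' hke, ← zpow_natCast, ← zpow_natCast, ← zpow_sub₀ ha, hne,
        add_sub_cancel_left]
    have h2 := pow_ne_zero n ha
    have h3 := hcone c hc
    have h4 : scale a c (.inr l) = a * c (.inr l) := rfl
    simp only [S, (hD i).eval_scale, hGn.eval_scale, h1, h4, mul_pow]
    field_simp
  have hSr : ∀ i, RegularOn W' fun a _ => S i (repCoord σ a) := fun i => by
    simpa [S, div_eq_mul_inv] using ((regularOn_repCoord hW' (.inr l)).pow k).mul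
      ((RegularOn.eval (regularOn_repCoord hW') (D i)).mul
        ((RegularOn.eval (regularOn_repCoord hW') G).inv hGr))
  have key : res (fiber := fun x => (twist d).fiber x) (inf_le_left : W' ≤ W) s =
      ∑ i ∈ Finset.range (k + 1), (q 0 ^ i * q 1 ^ (k - i)) •
        (show ∀ x : W', (twist d).fiber x.1 from ofHat hW' (S i) (hS i)) := by
    refine eq_of_hat_eq hW' fun c hc => ?_
    refine (hat_res inf_le_left s hc).trans ?_
    refine Eq.trans ?_ (hat_sum _ _ c).symm
    have hGc := hcone c hc
    have hlc := hl c hGc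
    have h1 : hat σ s c = eval c F / eval c G := by
      rw [eq_div_iff hGc, E c (cone_mono inf_le_left hc)]
    have h2 : F = ∑ i ∈ Finset.range (k + 1), D i * (X (.inr 0) ^ i * X (.inr 1) ^ (k - i)) := by
      have h3 : F = yComp e F := (IsWeightedHomogeneous.weightedHomogeneousComponent_same hFe).symm
      rw [h3, hC]
      refine (map_sum (weightedHomogeneousComponent (R := ℂ) yWeight e) _ _).trans ?_
      refine Finset.sum_congr rfl fun i hi => ?_
      have hi' := Finset.mem_range.mp hi
      have h4 : IsYHom (X (Sum.inr 0) ^ i * X (Sum.inr 1) ^ (k - i)) k := by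
        have := isYHom_mul (isYHom_pow (isYHom_X_inr 0) i) (isYHom_pow (isYHom_X_inr 1) (k - i))
        rwa [mul_one, mul_one, Nat.add_sub_cancel' (by omega)] at this
      exact yComp_mul_of_isYHom h4 (C i) hke
    rw [h1, h2, map_sum, Finset.sum_div]
    refine Finset.sum_congr rfl fun i hi => ?_
    refine Eq.trans ?_ (hat_smul _ _ hc).symm
    rw [hat_ofHat hW' _ (hS i) hc]
    have h5 : ∀ j, (q j).1 ⟨_, hc.2⟩ = c (.inr j) / c (.inr l) := fun j => by
      refine Eq.trans ?_ (pullO_funOf hW' (hq0 j) (hqr j) hc)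
      rw [pullO, pull_apply _ hc]
    have h6 : pullO σ (q 0 ^ i * q 1 ^ (k - i)) c =
        (c (.inr 0) / c (.inr l)) ^ i * (c (.inr 1) / c (.inr l)) ^ (k - i) := by
      rw [← h5 0, ← h5 1, pullO, pull_apply _ hc]
      rfl
    have hi' := Finset.mem_range.mp hi
    have h7 : c (.inr l) ^ k = c (.inr l) ^ i * c (.inr l) ^ (k - i) := by
      rw [← pow_add, Nat.add_sub_cancel' (by omega)]
    rw [h6]
    simp only [S, map_mul, map_pow, eval_X, div_pow, h7]
    field_simp
  have hmem : (∑ i ∈ Finset.range (k + 1), (q 0 ^ i * q 1 ^ (k - i)) •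
        (show ∀ x : W', (twist d).fiber x.1 from ofHat hW' (S i) (hS i))) ∈
      Submodule.span (GrP.O W') {u : ∀ x : W', (twist d).fiber x.1 |
        ∃ f ∈ idealZ W' ^ k, ∃ s ∈ (twist d).sec W', u = f • s} := by
    refine Submodule.sum_mem _ fun i hi => Submodule.subset_span ⟨_, ?_, _, ?_, rfl⟩
    · have hi' := Finset.mem_range.mp hi
      have := Ideal.mul_mem_mul (Ideal.pow_mem_pow (hqI 0 fun c h0 _ => h0) i)
        (Ideal.pow_mem_pow (hqI 1 fun c _ h1 => h1) (k - i))
      rwa [← pow_add, Nat.add_sub_cancel' (by omega)] at this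
    · exact hSr i
  rw [← key] at hmem
  exact hmem

/-- Over a chart, the sections of `I_Z^k(d)` are the functions homogeneous of degree `d` that are
locally quotients with numerator in `(y₀, y₁)^k`. -/
theorem mem_sec_iff (hW : W ≤ chartDomainX σ) (s : ∀ x : W, twistFiber d (GrP.point x.1)) :
    s ∈ (idealPow k d).sec W ↔ LocalQuot k (cone σ W) (hat σ s) :=
  ⟨LocalQuot.of_sec, sec_of_localQuot hW s⟩

end

end LineSing

namespace LineSing

open CoordSpace MvPolynomial ConePoly AbSheaf

section

variable {σ : Equiv.Perm (Fin 4)} {d : ℤ} {W : Opens GrP.Pt} {k : ℕ}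

/-- A section over a basic open set has a power of the equation as a common denominator: all
sufficiently large powers will do. -/
theorem exists_numerator {G : MvPolynomial J ℂ} {e : ℕ} (hG : IsYHom G e) (he : 1 ≤ e)
    {h : (J → ℂ) → ℂ} (H : LocalQuot k {c | eval c G ≠ 0} h)
    (hh : ∀ c, eval c G ≠ 0 → ∀ a : ℂ, a ≠ 0 → h (scale a c) = a ^ d * h c) :
    ∃ N₀ : ℕ, ∀ N ≥ N₀, ∃ n : ℕ, (n : ℤ) = d + N * e ∧
      ∃ F ∈ pairIdeal (Sum.inr 0 : J) (Sum.inr 1) k, IsYHom F n ∧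
        ∀ c, eval c G ≠ 0 → h c * eval c G ^ N = eval c F := by
  -- The ideal of denominators: the local denominators show that it has no zeros where `G ≠ 0`.
  let I : Ideal (MvPolynomial J ℂ) :=
    { carrier := {A | ∃ F ∈ pairIdeal (Sum.inr 0 : J) (Sum.inr 1) k,
        ∀ c, eval c G ≠ 0 → h c * eval c A = eval c F}
      zero_mem' := ⟨0, Ideal.zero_mem _, fun c _ => by simp⟩
      add_mem' := by
        rintro A B ⟨F, hF, hA⟩ ⟨F', hF', hB⟩
        exact ⟨F + F', Ideal.add_mem _ hF hF', fun c hc => by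
          rw [map_add, map_add, mul_add, hA c hc, hB c hc]⟩
      smul_mem' := by
        rintro A B ⟨F, hF, hB⟩
        exact ⟨A * F, Ideal.mul_mem_left _ _ hF, fun c hc => by
          rw [smul_eq_mul, map_mul, map_mul, mul_left_comm, hB c hc]⟩ }
  obtain ⟨N₁, F₁, hF₁, E⟩ := exists_pow_mem_of_eval I G fun c hc => by
    obtain ⟨F, hF, A, hA, E⟩ := H c hc
    exact ⟨A, ⟨F, hF, fun b hb => E b hb⟩, hA⟩
  refine ⟨N₁ + d.natAbs, fun N hN => ?_⟩
  obtain ⟨n, hn⟩ : ∃ n : ℕ, (n : ℤ) = d + N * e := by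
    refine ⟨(d + N * e).toNat, Int.toNat_of_nonneg ?_⟩
    have : N * 1 ≤ N * e := Nat.mul_le_mul_left _ he
    have h2 : ((N * e : ℕ) : ℤ) = N * e := by push_cast; rfl
    omega
  refine ⟨n, hn, yComp n (F₁ * G ^ (N - N₁)),
    yComp_mem_pairIdeal (by simp) (Ideal.mul_mem_right _ _ hF₁) _, isYHom_yComp _ _, fun c hc => ?_⟩
  -- The quotient is homogeneous, so the numerator may be replaced by a component of it.
  refine (eval_yComp_of_scale fun a ha => ?_).symm
  have h1 : eval (scale a c) G ≠ 0 := by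
    rw [hG.eval_scale]
    exact mul_ne_zero (pow_ne_zero _ ha) hc
  have h2 : a ^ n = a ^ d * (a ^ e) ^ N := by
    rw [← zpow_natCast, hn, zpow_add₀ ha, mul_comm (N : ℤ), zpow_mul]
    norm_cast
  rw [map_mul, ← E _ h1, map_pow, map_pow, hh c hc a ha, mul_assoc (a ^ d * h c), ← pow_add,
    Nat.add_sub_cancel' (by omega), hG.eval_scale, mul_pow, h2]
  ring

/-- Quotients of homogeneous polynomials of the right degrees are sections of `I_Z^k(d)`. -/
theorem exists_sec_of_quotient (hW : W ≤ chartDomainX σ) {F G : MvPolynomial J ℂ} {n m : ℕ}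
    (hF : IsYHom F n) (hG : IsYHom G m) (hnm : (n : ℤ) = d + m)
    (hne : ∀ c ∈ cone σ W, eval c G ≠ 0)
    (hk : ∀ c ∈ cone σ W, ∃ A : MvPolynomial J ℂ, eval c A ≠ 0 ∧
      A * F ∈ pairIdeal (Sum.inr 0 : J) (Sum.inr 1) k) :
    ∃ s : ∀ x : W, twistFiber d (GrP.point x.1), s ∈ (idealPow k d).sec W ∧
      ∀ c ∈ cone σ W, hat σ s c = eval c F / eval c G := by
  have hh : ∀ c ∈ cone σ W, ∀ a : ℂ, a ≠ 0 →
      eval (scale a c) F / eval (scale a c) G = a ^ d * (eval c F / eval c G) := by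
    intro c hc a ha
    have h1 : a ^ n = a ^ d * a ^ m := by
      rw [← zpow_natCast, hnm, zpow_add₀ ha, zpow_natCast]
    have h2 := pow_ne_zero m ha
    have h3 := hne c hc
    rw [hF.eval_scale, hG.eval_scale, h1]
    field_simp
  refine ⟨ofHat hW (fun c => eval c F / eval c G) hh, ?_, fun c hc => hat_ofHat hW _ hh hc⟩
  rw [mem_sec_iff hW]
  refine LocalQuot.congr (h := fun c => eval c F / eval c G) (fun c hc => ?_)
    fun c hc => hat_ofHat hW _ hh hc
  obtain ⟨A, hA, hAF⟩ := hk c hc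
  refine ⟨A * F, hAF, A * G, by rw [map_mul]; exact mul_ne_zero hA (hne c hc), fun b hb => ?_⟩
  have h3 := hne b hb
  simp only [map_mul]
  field_simp

/-! ### The basis of affine open sets over a chart -/

variable (σ) in
/-- The basic open sets given by homogeneous polynomials of positive degree. -/
def basics : Set (Opens GrP.Pt) := {W | ∃ G n, IsYHom G n ∧ 1 ≤ n ∧ W = basicOpen σ G}

theorem basicOpen_le_basicOpen {G G' : MvPolynomial J ℂ} {n n' : ℕ} (hG : IsYHom G n)
    (hG' : IsYHom G' n') (h : ∀ c, eval c G ≠ 0 → eval c G' ≠ 0) :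
    basicOpen σ G ≤ basicOpen σ G' :=
  le_of_cone_subset (basicOpen_le G) fun c hc => by
    rw [mem_cone_basicOpen hG] at hc
    rw [mem_cone_basicOpen hG']
    exact ⟨hc.1, h c hc.2⟩

theorem basicOpen_inf {G G' : MvPolynomial J ℂ} {n n' : ℕ} (hG : IsYHom G n) (hG' : IsYHom G' n') :
    basicOpen σ G ⊓ basicOpen σ G' = basicOpen σ (G * G') := by
  have hGG := isYHom_mul hG hG'
  refine le_antisymm (le_of_cone_subset (inf_le_left.trans (basicOpen_le G)) fun c hc => ?_)
    (le_inf (basicOpen_le_basicOpen hGG hG fun c hc => ?_)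
      (basicOpen_le_basicOpen hGG hG' fun c hc => ?_))
  · rw [cone_inf] at hc
    rw [mem_cone_basicOpen hGG, map_mul]
    exact ⟨hc.1.1, mul_ne_zero ((mem_cone_basicOpen hG).mp hc.1).2
      ((mem_cone_basicOpen hG').mp hc.2).2⟩
  · rw [map_mul] at hc
    exact left_ne_zero_of_mul hc
  · rw [map_mul] at hc
    exact right_ne_zero_of_mul hc

theorem basicOpen_zero : basicOpen σ 0 = ⊥ := by
  refine le_bot_iff.mp ?_
  rintro x ⟨c, -, -, h⟩
  exact h (map_zero _)

theorem yComp_mul_eq_zero_of_lt {H : MvPolynomial J ℂ} {e : ℕ} (hH : IsYHom H e)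
    (A : MvPolynomial J ℂ) {n : ℕ} (hn : n < e) : yComp n (A * H) = 0 := by
  refine MvPolynomial.funext fun c => ?_
  obtain ⟨p, hp, hpe⟩ := exists_eval_scale_eq A c
  obtain ⟨q, hq, hqe⟩ := exists_eval_scale_eq (A * H) c
  have : q = p * Polynomial.monomial e (eval c H) := by
    refine Polynomial.funext fun a => ?_
    rw [hqe, map_mul, Polynomial.eval_mul, hpe, Polynomial.eval_monomial, hH.eval_scale,
      mul_comm (a ^ e)]
  rw [← hq, this, ← Polynomial.C_mul_X_pow_eq_monomial, ← mul_assoc, Polynomial.coeff_mul_X_pow',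
    if_neg (by omega), map_zero]

/-- The basic open sets form a basis of the topology below a chart: a polynomial that does not
vanish at a point has a component that does not vanish there. -/
theorem exists_basics_le {U : Opens GrP.Pt} (hU : U ≤ chartDomainX σ) {x : GrP.Pt} (hx : x ∈ U) :
    ∃ W ∈ basics σ, x ∈ W ∧ W ≤ U := by
  obtain ⟨a, rfl⟩ := GrP.pr_surjective x
  have hc := repCoord_mem_cone hx (hU hx)
  obtain ⟨g, hg, hgU⟩ := exists_polynomial_of_mem_cone hc
  obtain ⟨n, hn⟩ := exists_yComp_ne_zero hg
  obtain ⟨l, hl⟩ := hc.1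
  have hG : IsYHom (yComp n g * X (.inr l)) (n + 1) :=
    isYHom_mul (isYHom_yComp n g) (isYHom_X_inr l)
  refine ⟨_, ⟨_, n + 1, hG, Nat.le_add_left _ _, rfl⟩,
    ⟨_, hc.1, pr_repOf_repCoord a (hU hx), ?_⟩, ?_⟩
  · rw [map_mul, eval_X]
    exact mul_ne_zero hn hl
  · refine le_of_cone_subset (basicOpen_le _) fun c hc => ?_
    rw [mem_cone_basicOpen hG, map_mul] at hc
    obtain ⟨r, hr, h⟩ := exists_eval_scale_ne_zero (left_ne_zero_of_mul hc.2)
    have h1 := scale_mem_cone (hgU _ h) (inv_ne_zero hr)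
    have h2 : scale r⁻¹ (scale r c) = c := by
      funext j
      rcases j with p | j
      · rfl
      · exact inv_mul_cancel_left₀ hr _
    rwa [h2] at h1

/-- Where `K + K'` does not vanish, one of `K`, `K'` does not vanish. -/
theorem sup_eq_of_add {G K K' : MvPolynomial J ℂ} {e m : ℕ} (hG : IsYHom G e) (hK : IsYHom K m)
    (hK' : IsYHom K' m) : basicOpen σ (G * (K * (K + K'))) ⊔ basicOpen σ (G * (K' * (K + K'))) =
      basicOpen σ (G * (K + K')) := by
  have hs : IsYHom (K + K') m := IsWeightedHomogeneous.add hK hK'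
  refine le_antisymm (sup_le ?_ ?_) ?_
  · refine basicOpen_le_basicOpen (isYHom_mul hG (isYHom_mul hK hs)) (isYHom_mul hG hs)
      fun c hc => ?_
    rw [map_mul, map_mul] at hc
    rw [map_mul]
    exact mul_ne_zero (left_ne_zero_of_mul hc) (right_ne_zero_of_mul (right_ne_zero_of_mul hc))
  · refine basicOpen_le_basicOpen (isYHom_mul hG (isYHom_mul hK' hs)) (isYHom_mul hG hs)
      fun c hc => ?_
    rw [map_mul, map_mul] at hc
    rw [map_mul]
    exact mul_ne_zero (left_ne_zero_of_mul hc) (right_ne_zero_of_mul (right_ne_zero_of_mul hc))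
  · rintro x ⟨c, hc, hx, h⟩
    rw [map_mul] at h
    have h1 := left_ne_zero_of_mul h
    have h2 := right_ne_zero_of_mul h
    by_cases h3 : eval c K = 0
    · refine Or.inr ⟨c, hc, hx, ?_⟩
      rw [map_mul, map_mul]
      refine mul_ne_zero h1 (mul_ne_zero (fun h4 => h2 ?_) h2)
      rw [map_add, h3, h4, add_zero]
    · refine Or.inl ⟨c, hc, hx, ?_⟩
      rw [map_mul, map_mul]
      exact mul_ne_zero h1 (mul_ne_zero h3 h2)

/-- The basic open sets of positive degree behave like the principal open sets of an affine variety.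
The `H` for which `T` holds where `G * H ≠ 0` generate an ideal all of whose homogeneous elements
have this property; by the Nullstellensatz it contains a power of `G`. -/
theorem isAffineBasis_basics : IsAffineBasis (X := GrP.top) (basics σ) where
  exists_le := by
    rintro _ ⟨G, n, hG, hn, rfl⟩ U hU x hx
    exact exists_basics_le (hU.trans (basicOpen_le G)) hx
  induct := by
    rintro _ ⟨G, e, hG, he, rfl⟩ T hbot hmono hglue hloc
    have hB : ∀ {K m}, IsYHom K m → basicOpen σ (G * K) ∈ basics σ := fun {K m} hK =>
      ⟨_, e + m, isYHom_mul hG hK, by omega, rfl⟩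
    have hle : ∀ {K m}, IsYHom K m → basicOpen σ (G * K) ≤ basicOpen σ G := fun {K m} hK =>
      basicOpen_le_basicOpen (isYHom_mul hG hK) hG fun c hc => by
        rw [map_mul] at hc
        exact left_ne_zero_of_mul hc
    have hmul : ∀ {K m K' m'}, IsYHom K m → IsYHom K' m' → T (basicOpen σ (G * K)) →
        T (basicOpen σ (G * (K * K'))) := fun {K m K' m'} hK hK' hT =>
      hmono _ (hB hK) _ (hB (isYHom_mul hK hK'))
        (basicOpen_le_basicOpen (isYHom_mul hG (isYHom_mul hK hK')) (isYHom_mul hG hK)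
          fun c hc => by
            rw [map_mul, map_mul, ← mul_assoc] at hc
            rw [map_mul]
            exact left_ne_zero_of_mul hc) (hle hK) hT
    have hadd : ∀ {K K' m}, IsYHom K m → IsYHom K' m → T (basicOpen σ (G * K)) →
        T (basicOpen σ (G * K')) → T (basicOpen σ (G * (K + K'))) := by
      intro K K' m hK hK' hT hT'
      have hs : IsYHom (K + K') m := IsWeightedHomogeneous.add hK hK'
      rw [← sup_eq_of_add hG hK hK']
      refine hglue _ (hB (isYHom_mul hK hs)) _ (hB (isYHom_mul hK' hs)) ?_ ?_ (hmul hK hs hT)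
        (hmul hK' hs hT')
      · rw [sup_eq_of_add hG hK hK']
        exact hB hs
      · rw [basicOpen_inf (isYHom_mul hG (isYHom_mul hK hs)) (isYHom_mul hG (isYHom_mul hK' hs)),
          mul_assoc]
        exact hB (isYHom_mul (isYHom_mul hK hs) (isYHom_mul hG (isYHom_mul hK' hs)))
    let I : Ideal (MvPolynomial J ℂ) :=
      Ideal.span {H | ∃ m, IsYHom H m ∧ T (basicOpen σ (G * H))}
    have hI : ∀ F ∈ I, ∀ n, T (basicOpen σ (G * yComp n F)) := by
      intro F hF
      induction hF using Submodule.closure_induction with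
      | zero =>
        intro n
        rw [show yComp n (0 : MvPolynomial J ℂ) = 0 from map_zero _, mul_zero, basicOpen_zero]
        exact hbot
      | add F F' _ _ h h' =>
        intro n
        rw [show yComp n (F + F') = yComp n F + yComp n F' from map_add _ _ _]
        exact hadd (isYHom_yComp _ _) (isYHom_yComp _ _) (h n) (h' n)
      | smul_mem A H hH =>
        intro n
        obtain ⟨m, hHm, hT⟩ := hH
        rw [smul_eq_mul]
        rcases le_or_gt m n with h | h
        · rw [yComp_mul_of_isYHom hHm A h, mul_comm (yComp (n - m) A)]
          exact hmul hHm (isYHom_yComp _ _) hT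
        · rw [yComp_mul_eq_zero_of_lt hHm A h, mul_zero, basicOpen_zero]
          exact hbot
    obtain ⟨N, hN⟩ := exists_pow_mem_of_eval I G fun c hc => by
      have hcone := (mem_cone_basicOpen_of_pos (σ := σ) hG he).mpr hc
      obtain ⟨_, ⟨H, m, hH, hm, rfl⟩, hx, hle', hT⟩ := hloc _ hcone.2
      refine ⟨H, Ideal.subset_span ⟨m, hH, ?_⟩,
        (mem_cone_basicOpen_of_pos (σ := σ) hH hm).mp ⟨hcone.1, hx⟩⟩
      rw [← basicOpen_inf hG hH, inf_eq_right.mpr hle']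
      exact hT
    have h1 := hI _ hN (N * e)
    rw [show yComp (N * e) (G ^ N) = G ^ N from
      IsWeightedHomogeneous.weightedHomogeneousComponent_same (isYHom_pow hG N)] at h1
    refine (?_ : basicOpen σ (G * G ^ N) = basicOpen σ G) ▸ h1
    refine le_antisymm (hle (isYHom_pow hG N))
      (basicOpen_le_basicOpen hG (isYHom_mul hG (isYHom_pow hG N)) fun c hc => ?_)
    rw [map_mul, map_pow]
    exact mul_ne_zero hc (pow_ne_zero _ hc)

end

end LineSing

namespace LineSing

open CoordSpace MvPolynomial ConePoly AbSheaf

section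

variable {σ : Equiv.Perm (Fin 4)} {d : ℤ} {W : Opens GrP.Pt} {k : ℕ}

/-! ### Vanishing of Čech cohomology -/

/-- A section of the sheaf `I_Z^k(d)`, as a family of vectors. -/
abbrev fam {k : ℕ} {d : ℤ} {W : Opens GrP.Pt} (s : (idealPow k d).toSheaf.obj.obj (op W)) :
    ∀ x : W, twistFiber d (GrP.point x.1) := (show (idealPow k d).sec W from s).1

theorem localQuot_fam (s : (idealPow k d).toSheaf.obj.obj (op W)) :
    LocalQuot k (cone σ W) (hat σ (fam s)) :=
  LocalQuot.of_sec (show (idealPow k d).sec W from s).2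

theorem hat_rs {W' : Opens GrP.Pt} (i : W' ≤ W) (s : (idealPow k d).toSheaf.obj.obj (op W))
    {c : J → ℂ} (hc : c ∈ cone σ W') :
    hat σ (fam (rs (X := GrP.top) (idealPow k d).toSheaf i s)) c = hat σ (fam s) c :=
  hat_res i (fam s) hc

theorem sheaf_ext (hW : W ≤ chartDomainX σ) {s t : (idealPow k d).toSheaf.obj.obj (op W)}
    (h : ∀ c ∈ cone σ W, hat σ (fam s) c = hat σ (fam t) c) : s = t :=
  Subtype.ext (eq_of_hat_eq hW h)

variable (σ) in
/-- The value of sections at a point of the cone, as an additive map. -/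
def hatHom (k : ℕ) (d : ℤ) (W : Opens GrP.Pt) (c : J → ℂ) :
    (idealPow k d).toSheaf.obj.obj (op W) →+ ℂ :=
  AddMonoidHom.mk' (fun s => hat σ (fam s) c) fun s t => hat_add (fam s) (fam t) c

theorem exists_numerator_basicOpen {G : MvPolynomial J ℂ} {e : ℕ} (hG : IsYHom G e) (he : 1 ≤ e)
    (hW : W = basicOpen σ G) (s : (idealPow k d).toSheaf.obj.obj (op W)) :
    ∃ N₀ : ℕ, ∀ N ≥ N₀, ∃ n : ℕ, (n : ℤ) = d + N * e ∧
      ∃ F ∈ pairIdeal (Sum.inr 0 : J) (Sum.inr 1) k, IsYHom F n ∧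
        ∀ c, eval c G ≠ 0 → hat σ (fam s) c * eval c G ^ N = eval c F := by
  have hcone : {c | eval c G ≠ 0} = cone σ W := by
    ext c
    rw [hW, mem_cone_basicOpen_of_pos hG he]
    rfl
  refine exists_numerator hG he (hcone ▸ localQuot_fam s) fun c hc a ha => hat_scale (fam s) ?_ ha
  rw [← hcone]
  exact hc

/-- The sheaf `I_Z^k(d)` has no first Čech cohomology for covers of a basic open set by two basic
open sets: a partition of unity `A * G₁ ^ N + B * G₂ ^ N = G ^ M` splits the section
`F / (G₁ * G₂) ^ N` as `F * B / (G₁ ^ N * G ^ M) + F * A / (G₂ ^ N * G ^ M)`. -/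
theorem affineAcyclic_basics :
    AffineAcyclic (X := GrP.top) (basics σ)
      (0 : (idealPow k d).toSheaf ⟶ (idealPow k d).toSheaf) := by
  rintro W₁ ⟨G₁, e₁, hG₁, he₁, hW₁⟩ W₂ ⟨G₂, e₂, hG₂, he₂, hW₂⟩ ⟨G, e, hG, he, hW⟩ - s -
  have hc₁ : ∀ c, c ∈ cone σ W₁ ↔ eval c G₁ ≠ 0 := fun c => by
    rw [hW₁, mem_cone_basicOpen_of_pos hG₁ he₁]
  have hc₂ : ∀ c, c ∈ cone σ W₂ ↔ eval c G₂ ≠ 0 := fun c => by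
    rw [hW₂, mem_cone_basicOpen_of_pos hG₂ he₂]
  have hc : ∀ c, c ∈ cone σ (W₁ ⊔ W₂) ↔ eval c G ≠ 0 := fun c => by
    rw [← mem_cone_basicOpen_of_pos (σ := σ) hG he, ← hW]
  have hu₁ : W₁ ≤ chartDomainX σ := by rw [hW₁]; exact basicOpen_le _
  have hu₂ : W₂ ≤ chartDomainX σ := by rw [hW₂]; exact basicOpen_le _
  have hW₁₂ : W₁ ⊓ W₂ = basicOpen σ (G₁ * G₂) := by rw [hW₁, hW₂, basicOpen_inf hG₁ hG₂]
  obtain ⟨N, hN⟩ := exists_numerator_basicOpen (isYHom_mul hG₁ hG₂) (by omega) hW₁₂ s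
  obtain ⟨n, hn, F, hF, hFn, hs⟩ := hN N le_rfl
  -- A power of `G` lies in the ideal generated by `G₁ ^ N` and `G₂ ^ N`.
  obtain ⟨M₀, hM₀⟩ := exists_pow_mem_of_eval (Ideal.span {G₁ ^ N, G₂ ^ N}) G fun c h => by
    have h1 := (hc c).mpr h
    rcases h1.2 with h2 | h2
    · exact ⟨G₁ ^ N, Ideal.subset_span (by simp), by
        rw [map_pow]; exact pow_ne_zero _ ((hc₁ c).mp ⟨h1.1, h2⟩)⟩
    · exact ⟨G₂ ^ N, Ideal.subset_span (by simp), by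
        rw [map_pow]; exact pow_ne_zero _ ((hc₂ c).mp ⟨h1.1, h2⟩)⟩
  obtain ⟨M, hM, hM₁, hM₂⟩ : ∃ M, M₀ ≤ M ∧ N * e₁ ≤ M * e ∧ N * e₂ ≤ M * e := by
    refine ⟨M₀ + N * e₁ + N * e₂, by omega, ?_, ?_⟩ <;>
    exact le_trans (by omega) (Nat.le_mul_of_pos_right _ he)
  obtain ⟨A', B', hAB'⟩ := Ideal.mem_span_pair.mp
    ((Ideal.span {G₁ ^ N, G₂ ^ N}).pow_mem_of_pow_mem hM₀ hM)
  obtain ⟨A, hA, B, hB, hAB⟩ : ∃ A, IsYHom A (M * e - N * e₁) ∧ ∃ B, IsYHom B (M * e - N * e₂) ∧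
      A * G₁ ^ N + B * G₂ ^ N = G ^ M := by
    refine ⟨yComp _ A', isYHom_yComp _ _, yComp _ B', isYHom_yComp _ _, ?_⟩
    rw [← yComp_mul_of_isYHom (isYHom_pow hG₁ N) A' hM₁,
      ← yComp_mul_of_isYHom (isYHom_pow hG₂ N) B' hM₂]
    refine (map_add (weightedHomogeneousComponent (R := ℂ) yWeight (M * e)) _ _).symm.trans ?_
    rw [hAB']
    exact IsWeightedHomogeneous.weightedHomogeneousComponent_same (isYHom_pow hG M)
  have hM₁' : ((M * e - N * e₁ : ℕ) : ℤ) = M * e - N * e₁ := by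
    rw [Nat.cast_sub hM₁]; push_cast; rfl
  have hM₂' : ((M * e - N * e₂ : ℕ) : ℤ) = M * e - N * e₂ := by
    rw [Nat.cast_sub hM₂]; push_cast; rfl
  have hle₁ : ∀ c ∈ cone σ W₁, eval c G ≠ 0 := fun c h => (hc c).mp (cone_mono le_sup_left h)
  have hle₂ : ∀ c ∈ cone σ W₂, eval c G ≠ 0 := fun c h => (hc c).mp (cone_mono le_sup_right h)
  obtain ⟨s₁, hs₁, E₁⟩ := exists_sec_of_quotient (k := k) (d := d) hu₁ (isYHom_mul hFn hB)
    (isYHom_mul (isYHom_pow hG₁ N) (isYHom_pow hG M))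
    (by push_cast [hn, hM₂']; ring)
    (fun c h => by
      rw [map_mul, map_pow, map_pow]
      exact mul_ne_zero (pow_ne_zero _ ((hc₁ c).mp h)) (pow_ne_zero _ (hle₁ c h)))
    (fun c h => ⟨1, by simp, by rw [one_mul]; exact Ideal.mul_mem_right _ _ hF⟩)
  obtain ⟨s₂, hs₂, E₂⟩ := exists_sec_of_quotient (k := k) (d := d) hu₂ (isYHom_mul hFn hA)
    (isYHom_mul (isYHom_pow hG₂ N) (isYHom_pow hG M))
    (by push_cast [hn, hM₁']; ring)
    (fun c h => by
      rw [map_mul, map_pow, map_pow]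
      exact mul_ne_zero (pow_ne_zero _ ((hc₂ c).mp h)) (pow_ne_zero _ (hle₂ c h)))
    (fun c h => ⟨1, by simp, by rw [one_mul]; exact Ideal.mul_mem_right _ _ hF⟩)
  refine ⟨(⟨s₁, hs₁⟩ : (idealPow k d).sec W₁), -(⟨s₂, hs₂⟩ : (idealPow k d).sec W₂), ?_, ?_, ?_⟩
  · exact ap_zero _
  · exact ap_zero _
  refine sheaf_ext (σ := σ) (inf_le_left.trans hu₁) fun c h => ?_
  have h1 := cone_mono inf_le_left h
  have h2 := cone_mono inf_le_right h
  refine Eq.trans ?_ (map_sub (hatHom σ k d (W₁ ⊓ W₂) c) _ _).symm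
  refine Eq.trans ?_ (congrArg₂ (· - ·)
    ((hat_rs (W' := W₁ ⊓ W₂) inf_le_left (⟨s₁, hs₁⟩ : (idealPow k d).sec W₁) h).trans (E₁ c h1))
    ((hat_rs (W' := W₁ ⊓ W₂) inf_le_right (-(⟨s₂, hs₂⟩ : (idealPow k d).sec W₂)) h).trans
      ((hat_neg s₂ c).trans (congrArg Neg.neg (E₂ c h2))))).symm
  have n1 := (hc₁ c).mp h1
  have n2 := (hc₂ c).mp h2
  have n3 := hle₁ c h1
  have h3 := hs c (by rw [map_mul]; exact mul_ne_zero n1 n2)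
  have h4 := congrArg (eval c) hAB
  simp only [map_add, map_mul, map_pow] at h3 h4 ⊢
  rw [← h3]
  field_simp
  rw [← h4]
  ring

end

end LineSing

namespace LineSing

open CoordSpace MvPolynomial ConePoly AbSheaf

section

variable {σ : Equiv.Perm (Fin 4)} {d : ℤ} {W : Opens GrP.Pt} {k : ℕ}

/-! ### The standard cover of the projective space over an affine open set -/

theorem pr_mem_basicOpen {G : MvPolynomial J ℂ} {n : ℕ} (hG : IsYHom G n) {a : GrP.Rep}
    (ha : GrP.pr a ∈ chartDomainX σ) :
    GrP.pr a ∈ basicOpen σ G ↔ eval (repCoord σ a) G ≠ 0 := by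
  constructor
  · intro h
    exact ((mem_cone_basicOpen hG).mp (repCoord_mem_cone h ha)).2
  · intro h
    exact ⟨_, exists_repCoord_ne_zero a, pr_repOf_repCoord a ha, h⟩

variable (σ) in
/-- The open sets `g y_i ≠ 0`, where `g` is a function on the chart of the Grassmannian. -/
def yCover (g : MvPolynomial (Fin 2 × Fin 2) ℂ) (i : Fin 4) : Opens GrP.Pt :=
  basicOpen σ (rename Sum.inl g * X (Sum.inr i))

/-- The equation `g ∏_{i ∈ I} y_i` of an intersection of sets of the standard cover. -/
def yEqn (g : MvPolynomial (Fin 2 × Fin 2) ℂ) (I : Finset (Fin 4)) : MvPolynomial J ℂ :=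
  rename Sum.inl g * ∏ i ∈ I, X (Sum.inr i)

variable {g : MvPolynomial (Fin 2 × Fin 2) ℂ}

theorem isYHom_prod_X (I : Finset (Fin 4)) :
    IsYHom (∏ i ∈ I, X (Sum.inr i)) I.card := by
  have := IsWeightedHomogeneous.prod (R := ℂ) (w := yWeight) I
    (fun i => (X (Sum.inr i) : MvPolynomial J ℂ)) (fun _ => 1) fun i _ => isYHom_X_inr i
  simpa using this

theorem isYHom_yEqn (I : Finset (Fin 4)) : IsYHom (yEqn g I) I.card := by
  have := isYHom_mul (isYHom_rename g) (isYHom_prod_X I)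
  rwa [zero_add] at this

theorem yEqn_ne_zero (hg : g ≠ 0) (I : Finset (Fin 4)) : yEqn g I ≠ 0 :=
  mul_ne_zero (fun h => hg (rename_injective _ Sum.inl_injective (h.trans (map_zero _).symm)))
    (Finset.prod_ne_zero_iff.mpr fun _ _ => X_ne_zero _)

theorem eval_yEqn_ne_zero {I : Finset (Fin 4)} {c : J → ℂ} : eval c (yEqn g I) ≠ 0 ↔
    eval c (rename Sum.inl g) ≠ 0 ∧ ∀ i ∈ I, c (.inr i) ≠ 0 := by
  rw [yEqn, map_mul, map_prod, mul_ne_zero_iff, Finset.prod_ne_zero_iff]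
  simp only [eval_X]

theorem eval_yEqn_univ (I : Finset (Fin 4)) (c : J → ℂ) :
    eval c (yEqn g Finset.univ) = eval c (yEqn g I) * ∏ i ∈ Iᶜ, c (.inr i) := by
  simp only [yEqn, map_mul, map_prod, eval_X, mul_assoc]
  rw [Finset.prod_mul_prod_compl]

/-- The set of indices of a tuple. -/
abbrev idx {n : ℕ} (i : Fin n → Fin 4) : Finset (Fin 4) := Finset.univ.image i

theorem one_le_card_idx {n : ℕ} (i : Fin (n + 1) → Fin 4) : 1 ≤ (idx i).card :=
  Finset.card_pos.mpr ⟨i 0, Finset.mem_image_of_mem _ (Finset.mem_univ _)⟩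

theorem inter_eq {n : ℕ} (i : Fin (n + 1) → Fin 4) :
    inter (X := GrP.top) (yCover σ g) i = basicOpen σ (yEqn g (idx i)) := by
  have h1 : ∀ j, IsYHom (rename Sum.inl g * X (Sum.inr j)) (0 + 1) := fun j =>
    isYHom_mul (isYHom_rename g) (isYHom_X_inr j)
  refine SetLike.ext fun x => ?_
  obtain ⟨a, rfl⟩ := GrP.pr_surjective x
  have key : GrP.pr a ∈ chartDomainX σ → (GrP.pr a ∈ inter (X := GrP.top) (yCover σ g) i ↔
      GrP.pr a ∈ basicOpen σ (yEqn g (idx i))) := by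
    intro ha
    rw [pr_mem_basicOpen (isYHom_yEqn _) ha, eval_yEqn_ne_zero]
    have h2 : ∀ j, GrP.pr a ∈ yCover σ g (i j) ↔
        eval (repCoord σ a) (rename Sum.inl g) ≠ 0 ∧ repCoord σ a (.inr (i j)) ≠ 0 := fun j => by
      rw [yCover, pr_mem_basicOpen (h1 _) ha, map_mul, eval_X, mul_ne_zero_iff]
    constructor
    · intro h
      refine ⟨((h2 0).mp (h 0)).1, fun j hj => ?_⟩
      obtain ⟨l, -, rfl⟩ := Finset.mem_image.mp hj
      exact ((h2 l).mp (h l)).2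
    · rintro ⟨h3, h4⟩ j
      exact (h2 j).mpr ⟨h3, h4 _ (Finset.mem_image_of_mem _ (Finset.mem_univ _))⟩
  constructor
  · intro h
    exact (key (basicOpen_le _ (h 0))).mp h
  · intro h
    exact (key (basicOpen_le _ h)).mpr h

theorem inter_mem_basics {n : ℕ} (i : Fin (n + 1) → Fin 4) :
    inter (X := GrP.top) (yCover σ g) i ∈ basics σ :=
  ⟨_, _, isYHom_yEqn _, one_le_card_idx i, inter_eq i⟩

theorem inter_le_chartDomainX {n : ℕ} (i : Fin (n + 1) → Fin 4) :
    inter (X := GrP.top) (yCover σ g) i ≤ chartDomainX σ := by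
  rw [inter_eq]
  exact basicOpen_le _

theorem mem_cone_inter {n : ℕ} (i : Fin (n + 1) → Fin 4) {c : J → ℂ} :
    c ∈ cone σ (inter (X := GrP.top) (yCover σ g) i) ↔ eval c (yEqn g (idx i)) ≠ 0 := by
  rw [inter_eq, mem_cone_basicOpen_of_pos (isYHom_yEqn _) (one_le_card_idx i)]

/-! ### Monomials of the numerators -/

/-- The exponents of the monomials `m` such that `m / (y₀ y₁ y₂ y₃)^N` is a section of `I_Z^k(d)`
where the `y_i` with `i ∈ I` do not vanish. -/
def Allowed (k N : ℕ) (I : Finset (Fin 4)) (m : J →₀ ℕ) : Prop :=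
  (∀ j ∉ I, N ≤ m (.inr j)) ∧ (0 ∉ I → 1 ∉ I → k + 2 * N ≤ m (.inr 0) + m (.inr 1))

/-- The pivot of the contraction of the Čech complex. This is where `d ≥ k - 2` enters: for a
smaller exponent `m₀ + m₁ < k + 2N`, one of `m₂`, `m₃` is at least `N`. -/
theorem exists_pivot (hd : (k : ℤ) - 2 ≤ d) {N : ℕ} {m : J →₀ ℕ}
    (hm : ((∑ j : Fin 4, m (Sum.inr j) : ℕ) : ℤ) = d + N * 4) :
    ∃ j, ∀ I, Allowed k N (insert j I) m → Allowed k N I m := by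
  rw [Fin.sum_univ_four] at hm
  have key : ∀ j, N ≤ m (.inr j) → (k + 2 * N ≤ m (.inr 0) + m (.inr 1) ∨ j ≠ 0 ∧ j ≠ 1) →
      ∀ I, Allowed k N (insert j I) m → Allowed k N I m := by
    rintro j hj hor I ⟨h1, h2⟩
    constructor
    · intro l hl
      by_cases hlj : l = j
      · rw [hlj]
        exact hj
      · exact h1 l (by simp [hl, hlj])
    · intro h0 h1
      rcases hor with h | ⟨hj0, hj1⟩
      · exact h
      · exact h2 (by simp [h0, hj0.symm]) (by simp [h1, hj1.symm])
  by_cases h01 : k + 2 * N ≤ m (.inr 0) + m (.inr 1)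
  · by_cases h0 : N ≤ m (.inr 0)
    · exact ⟨0, key 0 h0 (Or.inl h01)⟩
    · exact ⟨1, key 1 (by omega) (Or.inl h01)⟩
  · by_cases h2 : N ≤ m (.inr 2)
    · exact ⟨2, key 2 h2 (Or.inr (by decide))⟩
    · exact ⟨3, key 3 (by omega) (Or.inr (by decide))⟩

/-- The exponent of `∏_{j ∈ I} y_j ^ N`. -/
def yExp (N : ℕ) (I : Finset (Fin 4)) : J →₀ ℕ := ∑ j ∈ I, Finsupp.single (Sum.inr j) N

theorem yExp_inr (N : ℕ) (I : Finset (Fin 4)) (j : Fin 4) :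
    yExp N I (.inr j) = if j ∈ I then N else 0 := by
  simp [yExp, Finsupp.finsetSum_apply, Finsupp.single_apply]

theorem yExp_inl (N : ℕ) (I : Finset (Fin 4)) (p : Fin 2 × Fin 2) : yExp N I (.inl p) = 0 := by
  simp [yExp, Finsupp.finsetSum_apply]

theorem eval_monomial_yExp (N : ℕ) (I : Finset (Fin 4)) (c : J → ℂ) :
    eval c (monomial (yExp N I) 1) = (∏ j ∈ I, c (.inr j)) ^ N := by
  rw [yExp, ← Finset.prod_pow]
  induction I using Finset.induction_on with
  | empty => simp
  | insert a I ha ih => simp only [Finset.sum_insert ha, Finset.prod_insert ha, ← ih, eval_monomial,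
      one_mul, Finsupp.prod_add_index', pow_zero, pow_add, implies_true, Finsupp.prod_single_index]

theorem weight_yExp (N : ℕ) (I : Finset (Fin 4)) :
    Finsupp.weight yWeight (yExp N I) = I.card * N := by
  rw [weight_yWeight]
  simp [yExp_inr]

/-- Sections over the intersections of the standard cover have numerators over
`(g * y₀ * y₁ * y₂ * y₃) ^ N` with allowed exponents only. -/
theorem exists_numerator_inter {n : ℕ} (i : Fin (n + 1) → Fin 4)
    (s : (idealPow k d).toSheaf.obj.obj (op (inter (X := GrP.top) (yCover σ g) i))) :
    ∃ N₀ : ℕ, ∀ N ≥ N₀, ∀ D : ℕ, (D : ℤ) = d + N * 4 → ∃ F : MvPolynomial J ℂ, IsYHom F D ∧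
      (∀ m ∈ F.support, Allowed k N (idx i) m) ∧
        ∀ c, eval c (yEqn g (idx i)) ≠ 0 →
          hat σ (fam s) c * eval c (yEqn g Finset.univ) ^ N = eval c F := by
  obtain ⟨N₀, hN₀⟩ := exists_numerator_basicOpen (isYHom_yEqn _) (one_le_card_idx i) (inter_eq i) s
  refine ⟨N₀, fun N hN D hD => ?_⟩
  obtain ⟨n', hn', F, hF, hFn, hE⟩ := hN₀ N hN
  have hcard : (idx i).card + (idx i)ᶜ.card = 4 := by rw [Finset.card_add_card_compl]; rfl
  have hDn : D = n' + (idx i)ᶜ.card * N := by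
    zify
    rw [hD, hn', show ((idx i)ᶜ.card : ℤ) = 4 - (idx i).card by omega]
    ring
  refine ⟨F * monomial (yExp N (idx i)ᶜ) 1, ?_, fun m hm => ?_, fun c hc => ?_⟩
  · rw [hDn]
    exact isYHom_mul hFn (isWeightedHomogeneous_monomial _ _ _ (weight_yExp _ _))
  · rw [mem_support_iff, coeff_mul_monomial'] at hm
    have hle : yExp N (idx i)ᶜ ≤ m := by
      by_contra h
      exact hm (if_neg h)
    rw [if_pos hle, mul_one] at hm
    have h1 := (mem_pairIdeal_iff (by simp)).mp hF _ (mem_support_iff.mpr hm)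
    have h2 : ∀ j : Fin 4, j ∉ idx i → N ≤ m (.inr j) := fun j hj => by
      have := hle (.inr j)
      rwa [yExp_inr, if_pos (Finset.mem_compl.mpr hj)] at this
    refine ⟨h2, fun h0 h1' => ?_⟩
    have h3 := h2 0 h0
    have h4 := h2 1 h1'
    rw [Finsupp.coe_tsub, Pi.sub_apply, Pi.sub_apply, yExp_inr, yExp_inr,
      if_pos (Finset.mem_compl.mpr h0), if_pos (Finset.mem_compl.mpr h1')] at h1
    omega
  · rw [map_mul, ← hE c hc, eval_monomial_yExp, eval_yEqn_univ (idx i), mul_pow, mul_assoc]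

/-- A homogeneous polynomial with allowed exponents is the numerator, over
`(g * y₀ * y₁ * y₂ * y₃) ^ N`, of a section. -/
theorem exists_sec_inter {n : ℕ} (i : Fin (n + 1) → Fin 4) {N D : ℕ} (hD : (D : ℤ) = d + N * 4)
    {F : MvPolynomial J ℂ} (hF : IsYHom F D) (hm : ∀ m ∈ F.support, Allowed k N (idx i) m) :
    ∃ s : (idealPow k d).toSheaf.obj.obj (op (inter (X := GrP.top) (yCover σ g) i)),
      ∀ c, eval c (yEqn g (idx i)) ≠ 0 →
        hat σ (fam s) c * eval c (yEqn g Finset.univ) ^ N = eval c F := by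
  have hcard : (idx i).card + (idx i)ᶜ.card = 4 := by rw [Finset.card_add_card_compl]; rfl
  let u := yExp N (idx i)ᶜ
  have hle : ∀ m ∈ F.support, u ≤ m := by
    rintro m h (p | j)
    · rw [yExp_inl]; exact Nat.zero_le _
    · rw [yExp_inr]
      split_ifs with hj
      · exact (hm m h).1 j (Finset.mem_compl.mp hj)
      · exact Nat.zero_le _
  let F' : MvPolynomial J ℂ := ∑ m ∈ F.support, monomial (m - u) (coeff m F)
  have hF' : F = F' * monomial u 1 := by
    conv_lhs => rw [F.as_sum]
    rw [Finset.sum_mul]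
    refine Finset.sum_congr rfl fun m h => ?_
    rw [monomial_mul, mul_one, tsub_add_cancel_of_le (hle m h)]
  by_cases h0 : F = 0
  · refine ⟨0, fun c hc => ?_⟩
    rw [h0, map_zero]
    exact (congrArg (· * _) (hat_zero c)).trans (zero_mul _)
  obtain ⟨m₀, hm₀⟩ := Finset.nonempty_iff_ne_empty.mpr (support_eq_empty.not.mpr h0)
  have hwt : ∀ m ∈ F.support, Finsupp.weight yWeight (m - u) + (idx i)ᶜ.card * N = D := by
    intro m h
    have h1 := hF (mem_support_iff.mp h)
    rw [← tsub_add_cancel_of_le (hle m h), map_add, weight_yExp] at h1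
    exact h1
  obtain ⟨n', hn'⟩ : ∃ n', n' + (idx i)ᶜ.card * N = D := ⟨_, hwt m₀ hm₀⟩
  have hF'n : IsYHom F' n' := by
    refine IsWeightedHomogeneous.sum _ _ _ fun m h => isWeightedHomogeneous_monomial _ _ _ ?_
    have := hwt m h
    omega
  have hn'd : (n' : ℤ) = d + ((N * (idx i).card : ℕ) : ℤ) := by
    have h1 : ((n' + (idx i)ᶜ.card * N : ℕ) : ℤ) = d + N * 4 := by rw [hn', hD]
    push_cast at h1 ⊢
    rw [show ((idx i)ᶜ.card : ℤ) = 4 - (idx i).card by omega] at h1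
    linarith
  obtain ⟨s, hs, hsE⟩ := exists_sec_of_quotient (k := k) (inter_le_chartDomainX (σ := σ) (g := g) i)
    hF'n (isYHom_pow (isYHom_yEqn (g := g) (idx i)) N) hn'd
    (fun c hc => by
      rw [map_pow]
      exact pow_ne_zero _ ((mem_cone_inter i).mp hc))
    (fun c hc => by
      have hc' := (eval_yEqn_ne_zero.mp ((mem_cone_inter i).mp hc)).2
      have hX : ∀ j : Fin 4, j = 0 ∨ j = 1 → j ∈ idx i → ∃ A : MvPolynomial J ℂ, eval c A ≠ 0 ∧
          A * F' ∈ pairIdeal (Sum.inr 0 : J) (Sum.inr 1) k := fun j hj hji => by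
        refine ⟨X (.inr j) ^ k, ?_, Ideal.mul_mem_right _ _ (Ideal.pow_mem_pow
          (Ideal.subset_span ?_) k)⟩
        · rw [map_pow, eval_X]
          exact pow_ne_zero _ (hc' j hji)
        · rcases hj with rfl | rfl <;> simp
      by_cases h0 : 0 ∈ idx i
      · exact hX 0 (Or.inl rfl) h0
      by_cases h1 : 1 ∈ idx i
      · exact hX 1 (Or.inr rfl) h1
      refine ⟨1, by simp, ?_⟩
      rw [one_mul]
      refine Ideal.sum_mem _ fun m h => monomial_mem_pairIdeal (by simp) ?_ _
      have h2 := (hm m h).2 h0 h1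
      have h3 := (hm m h).1 0 h0
      have h4 := (hm m h).1 1 h1
      rw [Finsupp.coe_tsub, Pi.sub_apply, Pi.sub_apply, yExp_inr, yExp_inr,
        if_pos (Finset.mem_compl.mpr h0), if_pos (Finset.mem_compl.mpr h1)]
      omega)
  refine ⟨(⟨s, hs⟩ : (idealPow k d).sec _), fun c hc => ?_⟩
  refine (congrArg (· * _) (hsE c ((mem_cone_inter i).mpr hc))).trans ?_
  rw [hF', eval_yEqn_univ (idx i), mul_pow, map_mul, eval_monomial_yExp, map_pow, ← mul_assoc,
    div_mul_cancel₀ _ (pow_ne_zero _ hc)]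

end

end LineSing

namespace LineSing

open CoordSpace MvPolynomial ConePoly AbSheaf

section

variable {σ : Equiv.Perm (Fin 4)} {d : ℤ} {W : Opens GrP.Pt} {k : ℕ}
  {g : MvPolynomial (Fin 2 × Fin 2) ℂ}

/-- Sections over an intersection of sets of the standard cover agree if they agree where a nonzero
polynomial does not vanish. -/
theorem inter_ext {n : ℕ} (hg : g ≠ 0) (i : Fin (n + 1) → Fin 4) {K : MvPolynomial J ℂ} (hK : K ≠ 0)
    (s : (idealPow k d).toSheaf.obj.obj (op (inter (X := GrP.top) (yCover σ g) i)))
    (h : ∀ c, eval c (yEqn g (idx i)) ≠ 0 → hat σ (fam s) c * eval c K = 0) : s = 0 := by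
  obtain ⟨N, hN⟩ := exists_numerator_basicOpen (isYHom_yEqn _) (one_le_card_idx i) (inter_eq i) s
  obtain ⟨-, -, F, -, -, hE⟩ := hN N le_rfl
  have hF : F = 0 := by
    have h1 : F * (K * yEqn g (idx i)) = 0 := by
      refine MvPolynomial.funext fun c => ?_
      rw [map_mul, map_mul, map_zero]
      by_cases hc : eval c (yEqn g (idx i)) = 0
      · rw [hc, mul_zero, mul_zero]
      · rw [← hE c hc, ← mul_assoc, mul_right_comm _ _ (eval c K), h c hc, zero_mul, zero_mul]
    exact (mul_eq_zero.mp h1).resolve_right (mul_ne_zero hK (yEqn_ne_zero hg _))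
  refine sheaf_ext (inter_le_chartDomainX (σ := σ) i) fun c hc => ?_
  have hc' := (mem_cone_inter i).mp hc
  have h2 := hE c hc'
  rw [hF, map_zero] at h2
  exact ((mul_eq_zero.mp h2).resolve_right (pow_ne_zero _ hc')).trans (hat_zero c).symm

theorem idx_comp_subset {n m : ℕ} (i : Fin n → Fin 4) (f : Fin m → Fin n) :
    idx (i ∘ f) ⊆ idx i := by
  intro j hj
  obtain ⟨l, -, rfl⟩ := Finset.mem_image.mp hj
  exact Finset.mem_image_of_mem _ (Finset.mem_univ _)

theorem eval_yEqn_ne_zero_of_subset {I I' : Finset (Fin 4)} (h : I ⊆ I') {c : J → ℂ}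
    (hc : eval c (yEqn g I') ≠ 0) : eval c (yEqn g I) ≠ 0 :=
  eval_yEqn_ne_zero.mpr ⟨(eval_yEqn_ne_zero.mp hc).1,
    fun j hj => (eval_yEqn_ne_zero.mp hc).2 j (h hj)⟩

theorem hat_cechD {n : ℕ} (c : Cochain (X := GrP.top) (idealPow k d).toSheaf (yCover σ g) (n + 1))
    (i : Fin (n + 2) → Fin 4) {x : J → ℂ} (hx : eval x (yEqn g (idx i)) ≠ 0) :
    hat σ (fam (cechD (X := GrP.top) c i)) x =
      ∑ j : Fin (n + 2), (-1 : ℂ) ^ (j : ℕ) * hat σ (fam (c (i ∘ j.succAbove))) x := by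
  refine (map_sum (hatHom σ k d (inter (X := GrP.top) (yCover σ g) i) x) _ _).trans ?_
  refine Finset.sum_congr rfl fun j _ => ?_
  refine (map_zsmul (hatHom σ k d (inter (X := GrP.top) (yCover σ g) i) x) _ _).trans ?_
  rw [zsmul_eq_mul, Int.cast_pow, Int.cast_neg, Int.cast_one]
  exact congrArg _ (hat_rs (inter_le_comp i j.succAbove) _ ((mem_cone_inter i).mpr hx))

/-- A polynomial is obtained by choosing, for each monomial, the polynomial whose coefficient is
taken. -/
theorem exists_coeff_eq (F : Fin 4 → MvPolynomial J ℂ) (p : (J →₀ ℕ) → Fin 4) :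
    ∃ B : MvPolynomial J ℂ, ∀ m, coeff m B = coeff m (F (p m)) := by
  classical
  refine ⟨∑ l, ∑ m ∈ (F l).support with p m = l, monomial m (coeff m (F l)), fun m => ?_⟩
  simp only [coeff_sum, coeff_monomial, Finset.sum_ite_eq', Finset.mem_filter, mem_support_iff]
  rw [Finset.sum_eq_single (p m) (fun l _ hl => if_neg fun h => hl h.2.symm) (by simp)]
  split_ifs with h
  · rfl
  · by_contra h'
    exact h ⟨fun h0 => h' h0.symm, rfl⟩

/-- The Čech complex of `I_Z^k(d)` for the standard cover is exact in positive degrees if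
`d ≥ k - 2`. With a common denominator it decomposes into complexes indexed by monomials `m`, and
the complex of `m` is contracted by inserting the pivot of `m` into the tuples of indices. -/
theorem cechAcyclic_yCover (hd : (k : ℤ) - 2 ≤ d) (hg : g ≠ 0) :
    CechAcyclic (X := GrP.top) (yCover σ g)
      (0 : (idealPow k d).toSheaf ⟶ (idealPow k d).toSheaf) := by
  intro n c _ hc
  -- a common denominator for the components of `c`
  choose N₀ hN₀ using fun i => exists_numerator_inter i (c i)
  obtain ⟨N, hN, D, hD⟩ : ∃ N, (∀ i, N₀ i ≤ N) ∧ ∃ D : ℕ, (D : ℤ) = d + N * 4 := by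
    refine ⟨Finset.univ.sup N₀ + d.natAbs, fun i =>
      (Finset.le_sup (Finset.mem_univ i)).trans (Nat.le_add_right _ _), _,
      Int.toNat_of_nonneg ?_⟩
    rw [Nat.cast_add]
    omega
  choose F hF hFm hFE using fun i => hN₀ i N (hN i) D hD
  let Y : MvPolynomial J ℂ := yEqn g Finset.univ ^ N
  have hY : Y ≠ 0 := pow_ne_zero _ (yEqn_ne_zero hg _)
  have hYe : ∀ x, eval x Y = eval x (yEqn g Finset.univ) ^ N := fun x => map_pow _ _ _
  have hFc : ∀ i : Fin (n + 3) → Fin 4,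
      ∑ j : Fin (n + 3), (-1 : ℂ) ^ (j : ℕ) • F (i ∘ j.succAbove) = 0 := by
    intro i
    refine (mul_eq_zero.mp (?_ : _ * yEqn g (idx i) = 0)).resolve_right (yEqn_ne_zero hg _)
    refine MvPolynomial.funext fun x => ?_
    rw [map_mul, map_zero]
    by_cases hx : eval x (yEqn g (idx i)) = 0
    · rw [hx, mul_zero]
    · have h1 := hat_cechD c i hx
      rw [hc] at h1
      have h2 : hat σ (fam ((0 : Cochain (X := GrP.top) (idealPow k d).toSheaf (yCover σ g) (n + 3))
        i)) x = 0 := hat_zero x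
      rw [h2] at h1
      have h3 : eval x (∑ j : Fin (n + 3), (-1 : ℂ) ^ (j : ℕ) • F (i ∘ j.succAbove)) =
          (∑ j : Fin (n + 3), (-1 : ℂ) ^ (j : ℕ) * hat σ (fam (c (i ∘ j.succAbove))) x) *
            eval x Y := by
        rw [map_sum, Finset.sum_mul]
        refine Finset.sum_congr rfl fun j _ => ?_
        rw [smul_eval, ← hFE (i ∘ j.succAbove) x
          (eval_yEqn_ne_zero_of_subset (idx_comp_subset i _) hx), hYe, mul_assoc]
      rw [h3, ← h1, zero_mul, zero_mul]
  -- the contracting homotopy, which acts on each monomial through its pivot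
  have hp : ∀ m : J →₀ ℕ, ∃ j, ((∑ j : Fin 4, m (Sum.inr j) : ℕ) : ℤ) = d + N * 4 →
      ∀ I, Allowed k N (insert j I) m → Allowed k N I m := by
    intro m
    by_cases h : ((∑ j : Fin 4, m (Sum.inr j) : ℕ) : ℤ) = d + N * 4
    · obtain ⟨j, hj⟩ := exists_pivot hd h
      exact ⟨j, fun _ => hj⟩
    · exact ⟨0, fun h' => absurd h' h⟩
  choose p hp using hp
  choose B hB using fun i : Fin (n + 1) → Fin 4 => exists_coeff_eq (fun l => F (Fin.cons l i)) p
  have hBF : ∀ i, IsYHom (B i) D := by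
    intro i m hm
    rw [hB] at hm
    exact hF _ hm
  have hBm : ∀ i, ∀ m ∈ (B i).support, Allowed k N (idx i) m := by
    intro i m hm
    rw [mem_support_iff, hB] at hm
    have h1 := hF _ hm
    rw [weight_yWeight] at h1
    refine hp m (by rw [h1, hD]) _ ?_
    have h2 := hFm _ m (mem_support_iff.mpr hm)
    have h3 : idx (Fin.cons (p m) i : Fin (n + 2) → Fin 4) = insert (p m) (idx i) := by
      ext l
      simp [Fin.exists_fin_succ, eq_comm]
    rwa [h3] at h2
  have hBd : ∀ i : Fin (n + 2) → Fin 4,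
      ∑ j : Fin (n + 2), (-1 : ℂ) ^ (j : ℕ) • B (i ∘ j.succAbove) = F i := by
    intro i
    ext m
    have h1 := congrArg (coeff m) (hFc (Fin.cons (p m) i))
    rw [Fin.sum_univ_succ] at h1
    simp only [coeff_add, coeff_sum, coeff_neg, coeff_smul, cons_comp_succ_succAbove, coeff_zero,
      Fin.val_succ, Fin.val_zero, pow_zero, one_smul, pow_succ, mul_neg_one, neg_smul,
      Finset.sum_neg_distrib] at h1
    simp only [coeff_sum, coeff_smul, hB]
    have h2 : (Fin.cons (p m) i : Fin (n + 3) → Fin 4) ∘ (0 : Fin (n + 3)).succAbove = i := by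
      funext l
      simp
    rw [h2] at h1
    exact (add_neg_eq_zero.mp h1).symm
  choose b hb using fun i => exists_sec_inter (σ := σ) (g := g) i hD (hBF i) (hBm i)
  refine ⟨b, fun i => ap_zero _, ?_⟩
  funext i
  refine sub_eq_zero.mp (inter_ext hg i hY _ fun x hx => ?_)
  have h1 : hat σ (fam (cechD b i - c i)) x = hat σ (fam (cechD b i)) x - hat σ (fam (c i)) x :=
    map_sub (hatHom σ k d (inter (X := GrP.top) (yCover σ g) i) x) _ _
  rw [h1, sub_mul, hYe, hFE i x hx, ← hBd i, hat_cechD b i hx, Finset.sum_mul, map_sum, sub_eq_zero]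
  refine Finset.sum_congr rfl fun j _ => ?_
  rw [smul_eval, ← hb _ x (eval_yEqn_ne_zero_of_subset (idx_comp_subset i _) hx), mul_assoc]

/-! ### Vanishing of the higher direct images -/

/-- The coordinates in a chart of the Grassmannian are regular functions. -/
theorem regularOn_chartCoord {U : Opens Gr.Pt} (hU : U ≤ chartDomain σ) (p : Fin 2 × Fin 2) :
    RegularOn U (fun a _ => chartCoord σ (Gr.pr a) p) := fun a ha => by
  refine ⟨numer σ (fun q => (X q : MvPolynomial (Fin 2 × Fin 4) ℂ)) p,
    minor σ (fun q => (X q : MvPolynomial (Fin 2 × Fin 4) ℂ)), fun h => ?_, fun b hb _ => ?_⟩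
  · obtain ⟨t, ht⟩ := hU ha
    exact minor_ne_zero (hA := a.2) ht ((eval_minor_X σ id a.1).symm.trans h)
  · refine Eq.trans ?_ (congrArg₂ (· / ·) (eval_numer_X σ id b.1 p) (eval_minor_X σ id b.1)).symm
    exact numer_div_minor (hA := b.2) (chartLine_chartCoord (hU hb)).symm p

variable (σ) in
/-- The principal open subset `g ≠ 0` of a chart of the Grassmannian. -/
def principalOpen (g : MvPolynomial (Fin 2 × Fin 2) ℂ) : Opens Gr.Pt where
  carrier := {ℓ | ℓ ∈ chartDomain σ ∧ eval (chartCoord σ ℓ) g ≠ 0}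
  is_open' := RegularOn.isOpen_ne_zero
    (RegularOn.eval (fun p => regularOn_chartCoord (σ := σ) le_rfl p) g)
    fun _ => ⟨fun h => ⟨h.1, h.2⟩, fun ⟨h, h'⟩ => ⟨h, h'⟩⟩

/-- The principal open sets of the charts form a basis of the topology of the Grassmannian. -/
theorem exists_principalOpen_le {U : Opens Gr.Pt} {t : Fin 2 × Fin 2 → ℂ}
    (h : (chartLine σ t : Line) ∈ U) :
    ∃ g : MvPolynomial (Fin 2 × Fin 2) ℂ, g ≠ 0 ∧ (chartLine σ t : Line) ∈ principalOpen σ g ∧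
      principalOpen σ g ≤ U := by
  obtain ⟨G, hG, hGU⟩ := U.isOpen ⟨normalForm σ t, linearIndependent_normalForm σ t⟩ h
  let g : MvPolynomial (Fin 2 × Fin 2) ℂ :=
    aeval (normalForm σ fun q => (X q : MvPolynomial (Fin 2 × Fin 2) ℂ))
      (show MvPolynomial (Fin 2 × Fin 4) ℂ from G)
  have hg : ∀ t, eval t g = eval (normalForm σ t) (show MvPolynomial (Fin 2 × Fin 4) ℂ from G) := by
    intro t
    refine (eval_aeval t _ _).trans (congrArg (fun f => eval f _) (funext fun q => ?_))
    refine (eval_normalForm σ (fun p => (X p : MvPolynomial (Fin 2 × Fin 2) ℂ)) t q).trans ?_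
    exact congrArg (fun t => normalForm σ t q) (funext fun p => eval_X _)
  have hgt : eval t g ≠ 0 := fun h0 => hG ((hg t).symm.trans h0)
  refine ⟨g, fun h0 => hgt (by rw [h0, map_zero]), ⟨chartLine_mem σ t, ?_⟩, ?_⟩
  · rwa [chartCoord_chartLine]
  · rintro _ ⟨⟨t', rfl⟩, ht'⟩
    rw [chartCoord_chartLine, hg] at ht'
    exact hGU ⟨normalForm σ t', linearIndependent_normalForm σ t'⟩ ht'

/-- The standard cover: one of the homogeneous coordinates of a point does not vanish. -/
theorem map_proj_principalOpen :
    (Opens.map proj).obj (principalOpen σ g) = iSup (yCover σ g) := by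
  refine SetLike.ext fun x => ?_
  obtain ⟨a, rfl⟩ := GrP.pr_surjective x
  have h1 : ∀ j, IsYHom (rename Sum.inl g * X (Sum.inr j)) (0 + 1) := fun j =>
    isYHom_mul (isYHom_rename g) (isYHom_X_inr j)
  have h2 : eval (repCoord σ a) (rename Sum.inl g) = eval (chartCoord σ (lineOf (GrP.pr a))) g :=
    eval_rename _ _ _
  refine Iff.trans ?_ Opens.mem_iSup.symm
  constructor
  · rintro ⟨ha, hg⟩
    obtain ⟨j, hj⟩ := exists_repCoord_ne_zero (σ := σ) a
    refine ⟨j, (pr_mem_basicOpen (h1 j) ha).mpr ?_⟩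
    rw [map_mul, eval_X, h2]
    exact mul_ne_zero hg hj
  · rintro ⟨j, hj⟩
    have ha := basicOpen_le _ hj
    have h3 := (pr_mem_basicOpen (h1 j) ha).mp hj
    rw [map_mul, h2] at h3
    exact ⟨ha, left_ne_zero_of_mul h3⟩

theorem isZero_higherDirectImage_idealPow (hd : (k : ℤ) - 2 ≤ d) (i : ℕ) (hi : 1 ≤ i) :
    Limits.IsZero ((higherDirectImage proj i).obj (idealPow k d).toSheaf) := by
  refine isZero_rightDerived_pushforward (κ := Fin 4) proj (fun ℓ U hU => ?_) i hi
  obtain ⟨σ, t, rfl⟩ := exists_chartLine ℓ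
  obtain ⟨g, hg, hmem, hle⟩ := exists_principalOpen_le hU
  exact ⟨principalOpen σ g, hle, hmem, basics σ, yCover σ g, isAffineBasis_basics,
    map_proj_principalOpen, fun n i => inter_mem_basics i, affineAcyclic_basics,
    cechAcyclic_yCover hd hg⟩

end

end LineSing

namespace LineSing

open CoordSpace

/-! ### Regular maps to vector spaces -/

namespace FamSheaf

section

variable {X : CoordSpace} {U W : Opens X.Pt}
  {M : Type} [AddCommGroup M] [Module ℂ M] {M' : Type} [AddCommGroup M'] [Module ℂ M']
  {N : Type} [AddCommGroup N] [Module ℂ N]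

/-- A map to a vector space is regular if its coordinates are regular functions. -/
def IsReg (s : W → M) : Prop := ∀ φ : M →ₗ[ℂ] ℂ, (fun x => φ (s x)) ∈ X.O W

theorem IsReg.const (m : M) : IsReg (fun _ : W => m) := fun φ =>
  (X.O W).algebraMap_mem (φ m)

theorem IsReg.add {s t : W → M} (hs : IsReg s) (ht : IsReg t) : IsReg (fun x => s x + t x) :=
  fun φ => by simpa [Pi.add_def] using add_mem (hs φ) (ht φ)

theorem IsReg.smul {f : W → ℂ} (hf : f ∈ X.O W) {s : W → M} (hs : IsReg s) :
    IsReg (fun x => f x • s x) :=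
  fun φ => by simpa [Pi.mul_def] using mul_mem hf (hs φ)

theorem IsReg.sum {ι : Type} (t : Finset ι) {s : ι → W → M} (hs : ∀ i, IsReg (s i)) :
    IsReg (fun x => ∑ i ∈ t, s i x) := by
  classical
  induction t using Finset.induction_on with
  | empty => simpa using IsReg.const (W := W) (0 : M)
  | insert a t ha ih => simpa [Finset.sum_insert ha] using (hs a).add ih

theorem IsReg.comp (L : M →ₗ[ℂ] M') {s : W → M} (hs : IsReg s) : IsReg (fun x => L (s x)) :=
  fun φ => hs (φ.comp L)

theorem IsReg.res (i : W ≤ U) {s : U → M} (hs : IsReg s) :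
    IsReg (fun x : W => s ⟨x.1, i x.2⟩) := fun φ => O.res_mem i (hs φ)

theorem IsReg.glue {s : U → M} (H : ∀ x ∈ U, ∃ (W : Opens X.Pt) (i : W ≤ U), x ∈ W ∧
    IsReg (fun x : W => s ⟨x.1, i x.2⟩)) : IsReg s := fun φ => O.glue fun x hx => by
  obtain ⟨W, i, h, hs⟩ := H x hx
  exact ⟨W, i, h, hs φ⟩

/-- The application of a regular family of linear maps to a regular family of vectors. -/
theorem IsReg.apply [Module.Finite ℂ M] {L : W → M →ₗ[ℂ] N} (hL : ∀ m, IsReg (fun x => L x m))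
    {s : W → M} (hs : IsReg s) : IsReg (fun x => L x (s x)) := by
  let b := Module.finBasis ℂ M
  have : (fun x => L x (s x)) = fun x => ∑ i, b.coord i (s x) • L x (b i) := by
    funext x
    conv_lhs => rw [← b.sum_repr (s x), map_sum]
    exact Finset.sum_congr rfl fun i _ => map_smul _ _ _
  rw [this]
  exact IsReg.sum _ fun i => IsReg.smul (hs _) (hL _)

theorem IsReg.apply₂ [Module.Finite ℂ M] [Module.Finite ℂ M'] (B : M →ₗ[ℂ] M' →ₗ[ℂ] N)
    {s : W → M} {t : W → M'} (hs : IsReg s) (ht : IsReg t) : IsReg (fun x => B (s x) (t x)) :=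
  IsReg.apply (L := fun x => B (s x)) (fun m => IsReg.comp (B.flip m) hs) ht

/-- Regularity may be checked in an ambient vector space. -/
theorem isReg_subtype_iff {E : Submodule ℂ M} {s : W → E} :
    IsReg s ↔ IsReg (fun x => (s x : M)) := by
  refine ⟨fun h => h.comp E.subtype, fun h φ => ?_⟩
  obtain ⟨ψ, hψ⟩ := LinearMap.exists_extend φ
  have := h ψ
  rw [← hψ]
  exact this

/-! ### Trivializations -/

/-- A trivialization over `U`: an identification of the fibres over `U` with a fixed vector space,
under which the sections correspond to the regular maps. -/
structure Triv (E : FamSheaf X) (U : Opens X.Pt) (M : Type) [AddCommGroup M] [Module ℂ M] where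
  /-- The identification of the fibres with the fixed vector space. -/
  e : ∀ y : U, E.fiber y.1 ≃ₗ[ℂ] M
  mem_iff : ∀ (W : Opens X.Pt) (i : W ≤ U) (s : ∀ y : W, E.fiber y.1),
    s ∈ E.sec W ↔ IsReg (fun y : W => e ⟨y.1, i y.2⟩ (s y))

variable {E F G : FamSheaf X}

theorem Triv.exists_frame [Module.Finite ℂ M] (T : Triv E U M) :
    ∃ (n : ℕ) (e : ∀ y : U, Module.Basis (Fin n) ℂ (E.fiber y.1)),
    ∀ (W : Opens X.Pt) (i : W ≤ U) (s : ∀ y : W, E.fiber y.1),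
      s ∈ E.sec W ↔ ∀ j, (fun y : W => (e ⟨y.1, i y.2⟩).repr (s y) j) ∈ X.O W := by
  let b := Module.finBasis ℂ M
  refine ⟨_, fun y => b.map (T.e y).symm, fun W i s => ?_⟩
  rw [T.mem_iff W i s]
  constructor
  · intro h j
    exact h (b.coord j)
  · intro h φ
    have : (fun y : W => φ (T.e ⟨y.1, i y.2⟩ (s y))) =
        ∑ j, φ (b j) • fun y : W => (b.map (T.e ⟨y.1, i y.2⟩).symm).repr (s y) j := by
      funext y
      conv_lhs => rw [← b.sum_repr (T.e ⟨y.1, i y.2⟩ (s y)), map_sum]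
      simp [mul_comm]
    rw [this]
    exact Subalgebra.sum_mem _ fun j _ => Subalgebra.smul_mem _ (h j) _

theorem isVectorBundle_of_triv
    (H : ∀ x : X.Pt, ∃ U : Opens X.Pt, x ∈ U ∧ ∃ (M : Type) (_ : AddCommGroup M) (_ : Module ℂ M)
      (_ : Module.Finite ℂ M), Nonempty (Triv E U M)) : E.IsVectorBundle := by
  intro x
  obtain ⟨U, hx, M, _, _, _, ⟨T⟩⟩ := H x
  exact ⟨U, hx, T.exists_frame⟩

/-- Change of the model space of a trivialization. -/
def Triv.congr (T : Triv E U M) (L : M ≃ₗ[ℂ] M') : Triv E U M' where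
  e y := (T.e y).trans L
  mem_iff W i s := by
    rw [T.mem_iff W i s]
    refine ⟨fun h => h.comp L.toLinearMap, fun h => ?_⟩
    simpa using h.comp L.symm.toLinearMap

/-- A trivialization of a locally generated sheaf of families: it suffices that the generators are
regular and that the generators include a spanning set of constant families. -/
def trivOfLocallySpanned [Module.Finite ℂ M] {fiber : X.Pt → Type} [∀ x, AddCommGroup (fiber x)]
    [∀ x, Module ℂ (fiber x)] {gen : ∀ U : Opens X.Pt, Set (∀ x : U, fiber x.1)}
    (gen_res : ∀ {U W : Opens X.Pt} (i : W ≤ U) (s : ∀ x : U, fiber x.1),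
      s ∈ gen U → res i s ∈ gen W) (e : ∀ y : U, fiber y.1 ≃ₗ[ℂ] M)
    (h₁ : ∀ (W : Opens X.Pt) (i : W ≤ U), ∀ u ∈ gen W, IsReg (fun y : W => e ⟨y.1, i y.2⟩ (u y)))
    (S : Set M) (hS : Submodule.span ℂ S = ⊤)
    (h₂ : ∀ (W : Opens X.Pt) (i : W ≤ U), ∀ m ∈ S, (fun y : W => (e ⟨y.1, i y.2⟩).symm m) ∈ gen W) :
    Triv (locallySpanned fiber gen gen_res) U M where
  e := e
  mem_iff W i s := by
    constructor
    · intro hs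
      refine IsReg.glue fun x hx => ?_
      obtain ⟨W', i', hx', hspan⟩ := hs x hx
      refine ⟨W', i', hx', ?_⟩
      have key : ∀ u ∈ Submodule.span (X.O W') (gen W'),
          IsReg (fun y : W' => e ⟨y.1, i (i' y.2)⟩ (u y)) := by
        intro u hu
        induction hu using Submodule.span_induction with
        | mem u hu => exact h₁ W' (i'.trans i) u hu
        | zero => simpa using IsReg.const (W := W') (0 : M)
        | add u v _ _ hu hv => simpa using hu.add hv
        | smul f u _ hu =>
          have : (fun y : W' => e ⟨y.1, i (i' y.2)⟩ ((f • u) y)) =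
              fun y : W' => f.1 y • e ⟨y.1, i (i' y.2)⟩ (u y) := by
            funext y
            exact map_smul (e ⟨y.1, i (i' y.2)⟩) (f.1 y) (u y)
          rw [this]
          exact hu.smul f.2
      exact key _ hspan
    · intro hs
      have hconst : ∀ m : M, (fun y : W => (e ⟨y.1, i y.2⟩).symm m) ∈
          Submodule.span (X.O W) (gen W) := by
        intro m
        have hm : m ∈ Submodule.span ℂ S := by rw [hS]; trivial
        induction hm using Submodule.span_induction with
        | mem m hm => exact Submodule.subset_span (h₂ W i m hm)
        | zero =>
          have : (fun y : W => (e ⟨y.1, i y.2⟩).symm (0 : M)) = 0 := by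
            funext y
            exact map_zero _
          rw [this]
          exact Submodule.zero_mem _
        | add m m' _ _ hm hm' =>
          have : (fun y : W => (e ⟨y.1, i y.2⟩).symm (m + m')) =
              (fun y : W => (e ⟨y.1, i y.2⟩).symm m) + fun y : W => (e ⟨y.1, i y.2⟩).symm m' := by
            funext y
            exact map_add _ _ _
          rw [this]
          exact Submodule.add_mem _ hm hm'
        | smul c m _ hm =>
          have : (fun y : W => (e ⟨y.1, i y.2⟩).symm (c • m)) =
              (algebraMap ℂ (X.O W) c) • fun y : W => (e ⟨y.1, i y.2⟩).symm m := by
            funext y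
            exact map_smul _ _ _
          rw [this]
          exact Submodule.smul_mem _ _ hm
      let b := Module.finBasis ℂ M
      have hsum : s = ∑ j, (⟨_, hs (b.coord j)⟩ : X.O W) •
          fun y : W => (e ⟨y.1, i y.2⟩).symm (b j) := by
        funext y
        have h1 : s y = (e ⟨y.1, i y.2⟩).symm
            (∑ j, b.coord j (e ⟨y.1, i y.2⟩ (s y)) • b j) := by
          refine (LinearEquiv.symm_apply_eq _).mpr ?_ |>.symm
          exact b.sum_repr _
        rw [Finset.sum_apply]
        refine h1.trans ((map_sum _ _ _).trans (Finset.sum_congr rfl fun j _ => ?_))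
        exact map_smul _ _ _
      have hmem : s ∈ Submodule.span (X.O W) (gen W) := by
        rw [hsum]
        exact Submodule.sum_mem _ fun j _ => Submodule.smul_mem _ _ (hconst _)
      exact fun x hx => ⟨W, le_rfl, hx, hmem⟩

/-- A trivialization of a subbundle of a trivial bundle, given by a regular family of linear maps
and a regular family of inverses. -/
def trivSub {E : X.Pt → Submodule ℂ N} (N₀ : Submodule ℂ N) [Module.Finite ℂ N₀]
    (M₀ : Submodule ℂ M) [Module.Finite ℂ M₀] (L : U → N →ₗ[ℂ] M) (R : U → M →ₗ[ℂ] N)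
    (hE : ∀ y : U, E y.1 ≤ N₀) (hL : ∀ (y : U), ∀ n ∈ E y.1, L y n ∈ M₀)
    (hR : ∀ (y : U), ∀ m ∈ M₀, R y m ∈ E y.1) (hRL : ∀ (y : U), ∀ n ∈ E y.1, R y (L y n) = n)
    (hLR : ∀ (y : U), ∀ m ∈ M₀, L y (R y m) = m) (hLr : ∀ n ∈ N₀, IsReg (fun y => L y n))
    (hRr : ∀ m ∈ M₀, IsReg (fun y => R y m)) : Triv (sub N E) U M₀ where
  e y := LinearEquiv.ofLinearMap ((L y).restrict (hL y)) ((R y).restrict (hR y))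
    (LinearMap.ext fun m => Subtype.ext (hLR y m.1 m.2))
    (LinearMap.ext fun n => Subtype.ext (hRL y n.1 n.2))
  mem_iff W i s := by
    have h0 : s ∈ (sub N E).sec W ↔ IsReg (fun y : W => (show E y.1 from s y).1) := Iff.rfl
    rw [h0, isReg_subtype_iff]
    constructor
    · intro h
      have h1 : IsReg (fun y : W =>
        (⟨(show E y.1 from s y).1, hE ⟨y.1, i y.2⟩ (show E y.1 from s y).2⟩ : N₀)) :=
        isReg_subtype_iff.mpr h
      exact IsReg.apply (L := fun y : W => (L ⟨y.1, i y.2⟩).comp N₀.subtype)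
        (fun n => (hLr n.1 n.2).res i) h1
    · intro h
      have h1 := IsReg.apply (L := fun y : W => (R ⟨y.1, i y.2⟩).comp M₀.subtype)
        (fun m => (hRr m.1 m.2).res i) (isReg_subtype_iff.mpr h)
      refine (congrArg (fun s : W → N => IsReg s) (funext fun y => ?_)).mp h1
      exact hRL ⟨y.1, i y.2⟩ _ (show E y.1 from s y).2

/-! ### Short exact sequences in compatible trivializations -/

/-- A sequence of families of linear maps is a short exact sequence of vector bundles if it is, in
suitable local trivializations, a constant short exact sequence of vector spaces. -/
theorem isShortExact_of_triv (α : ∀ x, E.fiber x →ₗ[ℂ] F.fiber x)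
    (β : ∀ x, F.fiber x →ₗ[ℂ] G.fiber x)
    (H : ∀ x : X.Pt, ∃ U : Opens X.Pt, x ∈ U ∧
      ∃ (M₁ : Type) (_ : AddCommGroup M₁) (_ : Module ℂ M₁) (_ : Module.Finite ℂ M₁)
        (M₂ : Type) (_ : AddCommGroup M₂) (_ : Module ℂ M₂) (_ : Module.Finite ℂ M₂)
        (M₃ : Type) (_ : AddCommGroup M₃) (_ : Module ℂ M₃) (_ : Module.Finite ℂ M₃)
        (T₁ : Triv E U M₁) (T₂ : Triv F U M₂) (T₃ : Triv G U M₃)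
        (α₀ : M₁ →ₗ[ℂ] M₂) (β₀ : M₂ →ₗ[ℂ] M₃),
        (∀ (y : U) v, T₂.e y (α y.1 v) = α₀ (T₁.e y v)) ∧
        (∀ (y : U) v, T₃.e y (β y.1 v) = β₀ (T₂.e y v)) ∧
        Function.Injective α₀ ∧ Function.Exact α₀ β₀ ∧ Function.Surjective β₀) :
    IsShortExact α β := by
  have hinj : ∀ x, Function.Injective (α x) := fun x => by
    obtain ⟨U, hx, M₁, _, _, _, M₂, _, _, _, M₃, _, _, _, T₁, T₂, T₃, α₀, β₀, hα, hβ, h1, h2, h3⟩ :=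
      H x
    intro v w hvw
    refine (T₁.e ⟨x, hx⟩).injective (h1 ?_)
    rw [← hα, ← hα, hvw]
  have hex : ∀ x, Function.Exact (α x) (β x) := fun x => by
    obtain ⟨U, hx, M₁, _, _, _, M₂, _, _, _, M₃, _, _, _, T₁, T₂, T₃, α₀, β₀, hα, hβ, h1, h2, h3⟩ :=
      H x
    intro v
    have e1 : β x v = 0 ↔ β₀ (T₂.e ⟨x, hx⟩ v) = 0 := by
      rw [← hβ ⟨x, hx⟩ v]
      exact (LinearEquiv.map_eq_zero_iff _).symm
    rw [e1, h2]
    constructor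
    · rintro ⟨w, hw⟩
      refine ⟨(T₁.e ⟨x, hx⟩).symm w, (T₂.e ⟨x, hx⟩).injective ?_⟩
      rw [hα ⟨x, hx⟩, LinearEquiv.apply_symm_apply, hw]
    · rintro ⟨w, rfl⟩
      exact ⟨_, (hα ⟨x, hx⟩ w).symm⟩
  have hsurj : ∀ x, Function.Surjective (β x) := fun x => by
    obtain ⟨U, hx, M₁, _, _, _, M₂, _, _, _, M₃, _, _, _, T₁, T₂, T₃, α₀, β₀, hα, hβ, h1, h2, h3⟩ :=
      H x
    intro v
    obtain ⟨w, hw⟩ := h3 (T₃.e ⟨x, hx⟩ v)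
    refine ⟨(T₂.e ⟨x, hx⟩).symm w, (T₃.e ⟨x, hx⟩).injective ?_⟩
    rw [hβ ⟨x, hx⟩, LinearEquiv.apply_symm_apply, hw]
  refine ⟨isVectorBundle_of_triv fun x => ?_, isVectorBundle_of_triv fun x => ?_,
    isVectorBundle_of_triv fun x => ?_, fun W s hs => ?_, fun W s hs => ?_, hinj, hex, hsurj,
    fun W s _ h0 => ?_, fun W t ht h0 => ?_, fun W u hu x hx => ?_⟩
  · obtain ⟨U, hx, M₁, i1, i2, i3, M₂, _, _, _, M₃, _, _, _, T₁, -⟩ := H x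
    exact ⟨U, hx, M₁, i1, i2, i3, ⟨T₁⟩⟩
  · obtain ⟨U, hx, M₁, _, _, _, M₂, i1, i2, i3, M₃, _, _, _, -, T₂, -⟩ := H x
    exact ⟨U, hx, M₂, i1, i2, i3, ⟨T₂⟩⟩
  · obtain ⟨U, hx, M₁, _, _, _, M₂, _, _, _, M₃, i1, i2, i3, -, -, T₃, -⟩ := H x
    exact ⟨U, hx, M₃, i1, i2, i3, ⟨T₃⟩⟩
  · refine F.glue _ fun x hx => ?_
    obtain ⟨U, hxU, M₁, _, _, _, M₂, _, _, _, M₃, _, _, _, T₁, T₂, T₃, α₀, β₀, hα, -⟩ := H x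
    refine ⟨W ⊓ U, inf_le_left, ⟨hx, hxU⟩, (T₂.mem_iff _ inf_le_right _).mpr ?_⟩
    have h1 := ((T₁.mem_iff (W ⊓ U) inf_le_right _).mp (E.res_mem inf_le_left s hs)).comp α₀
    refine (congrArg (fun s : (W ⊓ U : Opens X.Pt) → M₂ => IsReg s) (funext fun y => ?_)).mp h1
    exact (hα ⟨y.1, y.2.2⟩ _).symm
  · refine G.glue _ fun x hx => ?_
    obtain ⟨U, hxU, M₁, _, _, _, M₂, _, _, _, M₃, _, _, _, T₁, T₂, T₃, α₀, β₀, -, hβ, -⟩ := H x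
    refine ⟨W ⊓ U, inf_le_left, ⟨hx, hxU⟩, (T₃.mem_iff _ inf_le_right _).mpr ?_⟩
    have h1 := ((T₂.mem_iff (W ⊓ U) inf_le_right _).mp (F.res_mem inf_le_left s hs)).comp β₀
    refine (congrArg (fun s : (W ⊓ U : Opens X.Pt) → M₃ => IsReg s) (funext fun y => ?_)).mp h1
    exact (hβ ⟨y.1, y.2.2⟩ _).symm
  · funext x
    exact hinj _ ((h0 x).trans (map_zero _).symm)
  · choose s hs using fun x : W => (hex x.1 (t x)).mp (h0 x)
    refine ⟨s, E.glue s fun x hx => ?_, hs⟩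
    obtain ⟨U, hxU, M₁, _, _, _, M₂, _, _, _, M₃, _, _, _, T₁, T₂, T₃, α₀, β₀, hα, -, h1, -⟩ := H x
    obtain ⟨r, hr⟩ := LinearMap.exists_leftInverse_of_injective α₀ (LinearMap.ker_eq_bot.mpr h1)
    refine ⟨W ⊓ U, inf_le_left, ⟨hx, hxU⟩, (T₁.mem_iff _ inf_le_right _).mpr ?_⟩
    have h1 := ((T₂.mem_iff (W ⊓ U) inf_le_right _).mp (F.res_mem inf_le_left t ht)).comp r
    refine (congrArg (fun s : (W ⊓ U : Opens X.Pt) → M₁ => IsReg s) (funext fun y => ?_)).mp h1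
    refine (congrArg (fun v => r (T₂.e ⟨y.1, y.2.2⟩ v)) (hs ⟨y.1, y.2.1⟩)).symm.trans ?_
    refine (congrArg r (hα ⟨y.1, y.2.2⟩ _)).trans ?_
    exact LinearMap.congr_fun hr _
  · obtain ⟨U, hxU, M₁, _, _, _, M₂, _, _, _, M₃, _, _, _, T₁, T₂, T₃, α₀, β₀, -, hβ, -, -, h3⟩ :=
      H x
    obtain ⟨r, hr⟩ := LinearMap.exists_rightInverse_of_surjective β₀ (LinearMap.range_eq_top.mpr h3)
    have h1 := ((T₃.mem_iff (W ⊓ U) inf_le_right _).mp (G.res_mem inf_le_left u hu)).comp r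
    refine ⟨W ⊓ U, inf_le_left, ⟨hx, hxU⟩, fun y => (T₂.e ⟨y.1, y.2.2⟩).symm
      (r (T₃.e ⟨y.1, y.2.2⟩ (u ⟨y.1, y.2.1⟩))), (T₂.mem_iff _ inf_le_right _).mpr ?_, fun y => ?_⟩
    · refine (congrArg (fun s : (W ⊓ U : Opens X.Pt) → M₂ => IsReg s) (funext fun y => ?_)).mp h1
      exact (LinearEquiv.apply_symm_apply _ _).symm
    · refine (T₃.e ⟨y.1, y.2.2⟩).injective ((hβ ⟨y.1, y.2.2⟩ _).trans ?_)
      rw [LinearEquiv.apply_symm_apply]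
      exact LinearMap.congr_fun hr _

end

end FamSheaf

end LineSing

namespace LineSing

open CoordSpace

namespace FamSheaf

section

variable {M : Type} [AddCommGroup M] [Module ℂ M] {M' : Type} [AddCommGroup M'] [Module ℂ M']
  {M'' : Type} [AddCommGroup M''] [Module ℂ M'']

/-! ### Functoriality of symmetric powers -/

/-- The homomorphism of symmetric algebras induced by a linear map. -/
abbrev symAlgMap (f : M →ₗ[ℂ] M') : SymmetricAlgebra ℂ M →ₐ[ℂ] SymmetricAlgebra ℂ M' :=
  SymmetricAlgebra.lift ((SymmetricAlgebra.ι ℂ M').comp f)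

theorem symAlgMap_mem {n : ℕ} (f : M →ₗ[ℂ] M') {x : SymmetricAlgebra ℂ M} (hx : x ∈ SymPow n M) :
    symAlgMap f x ∈ SymPow n M' := by
  have h : Submodule.map (symAlgMap f).toLinearMap (SymPow n M) ≤ SymPow n M' := by
    rw [Submodule.map_pow]
    refine pow_le_pow_left' ?_ n
    rintro _ ⟨_, ⟨m, rfl⟩, rfl⟩
    exact ⟨f m, (SymmetricAlgebra.lift_ι_apply ((SymmetricAlgebra.ι ℂ M').comp f) m).symm⟩
  exact h (Submodule.mem_map_of_mem hx)

/-- The map of symmetric powers induced by a linear map. -/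
def symMap (n : ℕ) (f : M →ₗ[ℂ] M') : SymPow n M →ₗ[ℂ] SymPow n M' :=
  (symAlgMap f).toLinearMap.restrict fun _ hx => symAlgMap_mem f hx

theorem symMap_coe (n : ℕ) (f : M →ₗ[ℂ] M') (x : SymPow n M) :
    (symMap n f x : SymmetricAlgebra ℂ M') = symAlgMap f x.1 := rfl

theorem lift_symAlgMap {A : Type} [CommRing A] [Algebra ℂ A] (f : M →ₗ[ℂ] M') (g : M' →ₗ[ℂ] A)
    (x : SymmetricAlgebra ℂ M) :
    SymmetricAlgebra.lift g (symAlgMap f x) = SymmetricAlgebra.lift (g.comp f) x := by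
  have h : (SymmetricAlgebra.lift g).comp (symAlgMap f) = SymmetricAlgebra.lift (g.comp f) :=
    SymmetricAlgebra.algHom_ext (LinearMap.ext fun m => by
      simp [SymmetricAlgebra.lift_ι_apply])
  exact DFunLike.congr_fun h x

theorem symMap_symMap (n : ℕ) (f : M →ₗ[ℂ] M') (g : M' →ₗ[ℂ] M'') (x : SymPow n M) :
    symMap n g (symMap n f x) = symMap n (g.comp f) x :=
  Subtype.ext (lift_symAlgMap f _ x.1)

theorem symMap_id (n : ℕ) (x : SymPow n M) : symMap n LinearMap.id x = x :=
  Subtype.ext (DFunLike.congr_fun SymmetricAlgebra.lift_ι x.1)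

/-- The isomorphism of symmetric powers induced by a linear isomorphism. -/
def symEquiv (n : ℕ) (f : M ≃ₗ[ℂ] M') : SymPow n M ≃ₗ[ℂ] SymPow n M' :=
  LinearEquiv.ofLinearMap (symMap n f.toLinearMap) (symMap n f.symm.toLinearMap)
    (LinearMap.ext fun x => by simp [symMap_symMap, symMap_id])
    (LinearMap.ext fun x => by simp [symMap_symMap, symMap_id])

theorem prod_ι_mem {n : ℕ} (m : Fin n → M) :
    ∏ j, SymmetricAlgebra.ι ℂ M (m j) ∈ SymPow n M := by
  induction n with
  | zero => exact Submodule.one_le.mp (by rw [SymPow, pow_zero])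
  | succ n ih =>
    rw [Fin.prod_univ_succ, SymPow, pow_succ']
    exact Submodule.mul_mem_mul ⟨_, rfl⟩ (ih _)

/-- A product of `n` vectors, as an element of the symmetric power. -/
def symProd {n : ℕ} (m : Fin n → M) : SymPow n M := ⟨_, prod_ι_mem m⟩

theorem span_symProd (n : ℕ) :
    Submodule.span ℂ (Set.range (symProd : (Fin n → M) → SymPow n M)) = ⊤ := by
  refine Submodule.map_injective_of_injective (SymPow n M).injective_subtype ?_
  rw [Submodule.map_span, Submodule.map_top, Submodule.range_subtype]
  refine le_antisymm (Submodule.span_le.mpr ?_) ?_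
  · rintro _ ⟨x, -, rfl⟩
    exact x.2
  · refine (Submodule.pow_eq_span_pow_set (LinearMap.range (SymmetricAlgebra.ι ℂ M)) n).trans_le ?_
    refine Submodule.span_mono fun x hx => ?_
    obtain ⟨f, rfl⟩ := Set.mem_pow.mp hx
    choose m hm using fun i => (f i).2
    refine ⟨symProd m, ⟨m, rfl⟩, ?_⟩
    rw [List.prod_ofFn]
    change ∏ i, SymmetricAlgebra.ι ℂ M (m i) = _
    exact Finset.prod_congr rfl fun i _ => hm i

theorem symMap_symProd {n : ℕ} (f : M →ₗ[ℂ] M') (m : Fin n → M) :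
    symMap n f (symProd m) = symProd fun j => f (m j) := by
  refine Subtype.ext ?_
  rw [symMap_coe]
  simp [symProd, SymmetricAlgebra.lift_ι_apply]

instance finite_symPow (n : ℕ) [Module.Finite ℂ M] : Module.Finite ℂ (SymPow n M) := by
  rw [Module.Finite.iff_fg, SymPow, LinearMap.range_eq_map]
  exact Submodule.FG.pow (Submodule.FG.map _ Module.Finite.fg_top) n

/-- The product of symmetric powers of vectors depends multilinearly on the vectors. -/
def symProdMultilinear (n : ℕ) (M : Type) [AddCommGroup M] [Module ℂ M] :
    MultilinearMap ℂ (fun _ : Fin n => M) (SymPow n M) :=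
  MultilinearMap.codRestrict
    ((MultilinearMap.mkPiAlgebra ℂ (Fin n) (SymmetricAlgebra ℂ M)).compLinearMap
      fun _ => SymmetricAlgebra.ι ℂ M) (SymPow n M) fun m => prod_ι_mem m

/-! ### Functoriality of trivializations -/

variable {X : CoordSpace} {U W : Opens X.Pt} {E F : FamSheaf X}

theorem IsReg.multilinear [Module.Finite ℂ M] {n : ℕ}
    (B : MultilinearMap ℂ (fun _ : Fin n => M) M') {s : Fin n → W → M} (hs : ∀ j, IsReg (s j)) :
    IsReg (fun x => B fun j => s j x) := by
  induction n with
  | zero =>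
    have : (fun x : W => B fun j => s j x) = fun _ => B 0 := by
      funext x
      exact congrArg B (Subsingleton.elim _ _)
    rw [this]
    exact IsReg.const _
  | succ n ih =>
    let L : W → M →ₗ[ℂ] M' := fun x =>
      { toFun := fun m => B.curryLeft m fun j => s j.succ x
        map_add' := fun m m' => by rw [map_add]; rfl
        map_smul' := fun c m => by rw [map_smul]; rfl }
    have h := IsReg.apply (L := L) (fun m => ih (B.curryLeft m) fun j => hs j.succ) (hs 0)
    refine (congrArg (fun s : W → M' => IsReg s) (funext fun x => ?_)).mp h
    exact congrArg B (Fin.cons_self_tail fun j => s j x)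

/-- The trivialization of a tensor product. -/
def Triv.tensor [Module.Finite ℂ M] [Module.Finite ℂ M'] (T : Triv E U M) (T' : Triv F U M') :
    Triv (E.tensor F) U (M ⊗[ℂ] M') :=
  trivOfLocallySpanned
    (by
      rintro U W i _ ⟨s, hs, t, ht, rfl⟩
      exact ⟨_, E.res_mem i s hs, _, F.res_mem i t ht, rfl⟩)
    (fun y => TensorProduct.congr (T.e y) (T'.e y))
    (by
      rintro W i _ ⟨s, hs, t, ht, rfl⟩
      exact IsReg.apply₂ (TensorProduct.mk ℂ M M') ((T.mem_iff W i s).mp hs)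
        ((T'.mem_iff W i t).mp ht))
    {u | ∃ m n, m ⊗ₜ[ℂ] n = u} (TensorProduct.span_tmul_eq_top ℂ M M')
    (by
      rintro W i _ ⟨m, n, rfl⟩
      refine ⟨fun y => (T.e ⟨y.1, i y.2⟩).symm m, (T.mem_iff W i _).mpr ?_,
        fun y => (T'.e ⟨y.1, i y.2⟩).symm n, (T'.mem_iff W i _).mpr ?_, rfl⟩
      · simpa using IsReg.const m
      · simpa using IsReg.const n)

/-- The isomorphism of exterior squares induced by a linear isomorphism. -/
def wedgeEquiv (f : M ≃ₗ[ℂ] M') : ⋀[ℂ]^2 M ≃ₗ[ℂ] ⋀[ℂ]^2 M' :=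
  LinearEquiv.ofLinearMap (exteriorPower.map 2 f.toLinearMap)
      (exteriorPower.map 2 f.symm.toLinearMap)
    (by rw [← exteriorPower.map_comp]; simp)
    (by rw [← exteriorPower.map_comp]; simp)

theorem wedgeEquiv_ιMulti (f : M ≃ₗ[ℂ] M') (m : Fin 2 → M) :
    wedgeEquiv f (exteriorPower.ιMulti ℂ 2 m) = exteriorPower.ιMulti ℂ 2 fun j => f (m j) :=
  exteriorPower.map_apply_ιMulti _ _

/-- The trivialization of an exterior square. -/
def Triv.wedge2 [Module.Finite ℂ M] (T : Triv E U M) : Triv E.wedge2 U (⋀[ℂ]^2 M) :=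
  trivOfLocallySpanned
    (by
      rintro U W i _ ⟨s, hs, t, ht, rfl⟩
      exact ⟨_, E.res_mem i s hs, _, E.res_mem i t ht, rfl⟩)
    (fun y => wedgeEquiv (T.e y))
    (by
      rintro W i _ ⟨s, hs, t, ht, rfl⟩
      have h := IsReg.multilinear (exteriorPower.ιMulti ℂ 2 (M := M)).toMultilinearMap
        (s := ![fun y => T.e ⟨y.1, i y.2⟩ (s y), fun y => T.e ⟨y.1, i y.2⟩ (t y)])
        (Fin.forall_fin_two.mpr ⟨(T.mem_iff W i s).mp hs, (T.mem_iff W i t).mp ht⟩)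
      refine (congrArg (fun s : W → ⋀[ℂ]^2 M => IsReg s) (funext fun y => ?_)).mp h
      rw [wedgeEquiv_ιMulti]
      refine congrArg (exteriorPower.ιMulti ℂ 2) (funext (Fin.forall_fin_two.mpr ⟨rfl, rfl⟩)))
    (Set.range (exteriorPower.ιMulti ℂ 2)) (exteriorPower.ιMulti_span ℂ 2 M)
    (by
      rintro W i _ ⟨m, rfl⟩
      refine ⟨fun y => (T.e ⟨y.1, i y.2⟩).symm (m 0), (T.mem_iff W i _).mpr ?_,
        fun y => (T.e ⟨y.1, i y.2⟩).symm (m 1), (T.mem_iff W i _).mpr ?_, funext fun y => ?_⟩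
      · simpa using IsReg.const (m 0)
      · simpa using IsReg.const (m 1)
      · refine (LinearEquiv.symm_apply_eq _).mpr ?_
        rw [wedgeEquiv_ιMulti]
        refine congrArg (exteriorPower.ιMulti ℂ 2) (funext (Fin.forall_fin_two.mpr ⟨?_, ?_⟩)) <;>
        simp)

/-- The trivialization of a symmetric power. -/
def Triv.sym [Module.Finite ℂ M] (n : ℕ) (T : Triv E U M) : Triv (E.sym n) U (SymPow n M) :=
  trivOfLocallySpanned
    (by
      rintro U W i u ⟨s, hs, hu⟩
      exact ⟨fun j => res i (s j), fun j => E.res_mem i _ (hs j), fun x => hu ⟨x.1, i x.2⟩⟩)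
    (fun y => symEquiv n (T.e y))
    (by
      rintro W i u ⟨s, hs, hu⟩
      have h := IsReg.multilinear (symProdMultilinear n M)
        (s := fun j y => T.e ⟨y.1, i y.2⟩ (s j y)) (fun j => (T.mem_iff W i _).mp (hs j))
      refine (congrArg (fun s : W → SymPow n M => IsReg s) (funext fun y => ?_)).mp h
      have h1 : u y = symProd fun j => s j y := Subtype.ext (hu y)
      rw [h1]
      exact (symMap_symProd (T.e ⟨y.1, i y.2⟩).toLinearMap fun j => s j y).symm)
    (Set.range symProd) (span_symProd n)
    (by
      rintro W i _ ⟨m, rfl⟩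
      refine ⟨fun j y => (T.e ⟨y.1, i y.2⟩).symm (m j), fun j => (T.mem_iff W i _).mpr ?_,
        fun y => ?_⟩
      · simpa using IsReg.const (m j)
      · exact congrArg Subtype.val (symMap_symProd (T.e ⟨y.1, i y.2⟩).symm.toLinearMap m))

end

end FamSheaf

end LineSing

namespace LineSing

open CoordSpace FamSheaf MvPolynomial ConePoly

/-! ### Homogeneous polynomials -/

theorem mem_P_natCast {n : ℕ} {F : MvPolynomial (Fin 4) ℂ} : F ∈ P n ↔ F.IsHomogeneous n := by
  rw [P, if_pos (Int.natCast_nonneg n), mem_homogeneousSubmodule, Int.toNat_natCast]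

theorem mem_P_iff {m : ℤ} {F : MvPolynomial (Fin 4) ℂ} :
    F ∈ P m ↔ F = 0 ∨ ∃ n : ℕ, m = n ∧ F.IsHomogeneous n := by
  constructor
  · intro h
    rcases lt_or_ge m 0 with hm | hm
    · rw [P, if_neg (not_le.mpr hm)] at h
      exact Or.inl h
    · obtain ⟨n, rfl⟩ := Int.eq_ofNat_of_zero_le hm
      exact Or.inr ⟨n, rfl, mem_P_natCast.mp h⟩
  · rintro (rfl | ⟨n, rfl, h⟩)
    · exact Submodule.zero_mem _
    · exact mem_P_natCast.mpr h

theorem mul_mem_P {a b c : ℤ} (h : a + b = c) {F G : MvPolynomial (Fin 4) ℂ} (hF : F ∈ P a)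
    (hG : G ∈ P b) : F * G ∈ P c := by
  rcases mem_P_iff.mp hF with rfl | ⟨n, rfl, hF⟩
  · rw [zero_mul]; exact Submodule.zero_mem _
  rcases mem_P_iff.mp hG with rfl | ⟨n', rfl, hG⟩
  · rw [mul_zero]; exact Submodule.zero_mem _
  rw [← h]
  exact mem_P_iff.mpr (Or.inr ⟨n + n', by push_cast; rfl, hF.mul hG⟩)

theorem X_mem_P (j : Fin 4) : X j ∈ P 1 := mem_P_natCast.mpr (isHomogeneous_X ℂ j)

theorem aeval_mem_P {f : Fin 4 → MvPolynomial (Fin 4) ℂ} (hf : ∀ j, f j ∈ P 1) {m : ℤ}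
    {F : MvPolynomial (Fin 4) ℂ} (hF : F ∈ P m) : aeval f F ∈ P m := by
  rcases mem_P_iff.mp hF with rfl | ⟨n, rfl, hn⟩
  · rw [map_zero]; exact Submodule.zero_mem _
  · refine mem_P_natCast.mpr ?_
    have := hn.aeval f fun j => mem_P_natCast.mp (hf j)
    simpa using this

instance finite_P (m : ℤ) : Module.Finite ℂ (P m) := by
  rw [Module.Finite.iff_fg, P]
  split_ifs
  · exact homogeneousSubmodule_fg _ _ _
  · exact Submodule.fg_bot

instance finite_P_inf (m : ℤ) (S : Submodule ℂ (MvPolynomial (Fin 4) ℂ)) :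
    Module.Finite ℂ (P m ⊓ S : Submodule ℂ (MvPolynomial (Fin 4) ℂ)) :=
  Module.Finite.of_injective (Submodule.inclusion inf_le_left) (Submodule.inclusion_injective _)

/-! ### Moving a line to the standard line -/

/-- The substitution that evaluates the variables `t`. -/
def evalT (t : Fin 2 × Fin 2 → ℂ) : MvPolynomial J ℂ →ₐ[ℂ] MvPolynomial (Fin 4) ℂ :=
  aeval (Sum.elim (fun p => C (t p)) X)

theorem isReg_evalT {Y : CoordSpace} {W : Opens Y.Pt} {r : W → Fin 2 × Fin 2 → ℂ}
    (hr : ∀ p, (fun y => r y p) ∈ Y.O W) (Q : MvPolynomial J ℂ) :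
    IsReg (fun y => evalT (r y) Q) := by
  rw [Q.as_sum]
  simp only [map_sum]
  refine IsReg.sum _ fun m => ?_
  have : (fun y => evalT (r y) (monomial m (coeff m Q))) = fun y =>
      (∏ p, r y p ^ m (.inl p)) • (C (coeff m Q) * ∏ j, X j ^ m (.inr j)) := by
    funext y
    rw [evalT, aeval_monomial, Finsupp.prod_fintype _ _ fun _ => pow_zero _, Fintype.prod_sum_type,
      smul_eq_C_mul, map_prod, algebraMap_eq]
    simp only [Sum.elim_inl, Sum.elim_inr, map_pow]
    ring
  rw [this]
  refine IsReg.smul ?_ (IsReg.const _)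
  have h : (fun y => ∏ p, r y p ^ m (Sum.inl p)) = ∏ p, (fun y => r y p) ^ m (Sum.inl p) := by
    funext y
    simp
  rw [h]
  exact Subalgebra.prod_mem _ fun p _ => Subalgebra.pow_mem _ (hr p) _

section

variable (σ : Equiv.Perm (Fin 4)) (t : Fin 2 × Fin 2 → ℂ)

/-- The linear change of variables that moves the line with coordinates `t` to the line
`X₀ = X₁ = 0`. -/
def down : MvPolynomial (Fin 4) ℂ →ₐ[ℂ] MvPolynomial (Fin 4) ℂ :=
  (evalT t).comp (aeval (toVec σ fun i => (X i : MvPolynomial J ℂ)))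

/-- The linear forms, over the ring of functions on the chart, that define the line, completed to
a system of coordinates. -/
def upVec : Fin 4 → MvPolynomial J ℂ :=
  ![X (.inr (σ 0)) - (X (.inl (0, 0)) * X (.inr (σ 2)) + X (.inl (0, 1)) * X (.inr (σ 3))),
    X (.inr (σ 1)) - (X (.inl (1, 0)) * X (.inr (σ 2)) + X (.inl (1, 1)) * X (.inr (σ 3))),
    X (.inr (σ 2)), X (.inr (σ 3))]

/-- The linear change of variables inverse to `down`. -/
def up : MvPolynomial (Fin 4) ℂ →ₐ[ℂ] MvPolynomial (Fin 4) ℂ := (evalT t).comp (aeval (upVec σ))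

theorem down_X (j : Fin 4) : down σ t (X j) =
    toVec σ (Sum.elim (fun p => (C (t p) : MvPolynomial (Fin 4) ℂ)) X) j := by
  obtain ⟨j, rfl⟩ := σ.surjective j
  rw [down, AlgHom.comp_apply, aeval_X]
  fin_cases j <;> simp [toVec, evalT]

theorem up_X (j : Fin 4) : up σ t (X j) =
    ![X (σ 0) - (C (t (0, 0)) * X (σ 2) + C (t (0, 1)) * X (σ 3)),
      X (σ 1) - (C (t (1, 0)) * X (σ 2) + C (t (1, 1)) * X (σ 3)), X (σ 2), X (σ 3)] j := by
  rw [up, AlgHom.comp_apply, aeval_X]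
  fin_cases j <;> simp [upVec, evalT]

theorem up_down (F : MvPolynomial (Fin 4) ℂ) : up σ t (down σ t F) = F := by
  have h : (up σ t).comp (down σ t) = AlgHom.id ℂ _ := by
    refine algHom_ext fun j => ?_
    obtain ⟨j, rfl⟩ := σ.surjective j
    rw [AlgHom.comp_apply, down_X]
    fin_cases j <;> simp [toVec, up_X, algHom_C]
  exact DFunLike.congr_fun h F

theorem down_up (F : MvPolynomial (Fin 4) ℂ) : down σ t (up σ t F) = F := by
  have h : (down σ t).comp (up σ t) = AlgHom.id ℂ _ := by
    refine algHom_ext fun j => ?_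
    rw [AlgHom.comp_apply, up_X]
    fin_cases j <;> simp [toVec, down_X, algHom_C]
  exact DFunLike.congr_fun h F

theorem down_mem_P {m : ℤ} {F : MvPolynomial (Fin 4) ℂ} (hF : F ∈ P m) : down σ t F ∈ P m := by
  have h : down σ t = aeval fun j => down σ t (X j) := by
    refine algHom_ext fun j => ?_
    rw [aeval_X]
  rw [h]
  refine aeval_mem_P (fun j => ?_) hF
  have hC : ∀ (c : ℂ) (j : Fin 4), C c * X j ∈ P 1 := fun c j => by
    rw [← smul_eq_C_mul]
    exact Submodule.smul_mem _ _ (X_mem_P j)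
  obtain ⟨j, rfl⟩ := σ.surjective j
  rw [down_X]
  fin_cases j <;> simp only [toVec, Equiv.symm_apply_apply, Sum.elim_inl, Sum.elim_inr]
  · exact Submodule.add_mem _ (X_mem_P _) (Submodule.add_mem _ (hC _ _) (hC _ _))
  · exact Submodule.add_mem _ (X_mem_P _) (Submodule.add_mem _ (hC _ _) (hC _ _))
  · exact X_mem_P _
  · exact X_mem_P _

theorem up_mem_P {m : ℤ} {F : MvPolynomial (Fin 4) ℂ} (hF : F ∈ P m) : up σ t F ∈ P m := by
  have h : up σ t = aeval fun j => up σ t (X j) := by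
    refine algHom_ext fun j => ?_
    rw [aeval_X]
  rw [h]
  refine aeval_mem_P (fun j => ?_) hF
  have hC : ∀ (c : ℂ) (j : Fin 4), C c * X j ∈ P 1 := fun c j => by
    rw [← smul_eq_C_mul]
    exact Submodule.smul_mem _ _ (X_mem_P j)
  rw [up_X]
  fin_cases j
  · exact Submodule.sub_mem _ (X_mem_P _) (Submodule.add_mem _ (hC _ _) (hC _ _))
  · exact Submodule.sub_mem _ (X_mem_P _) (Submodule.add_mem _ (hC _ _) (hC _ _))
  · exact X_mem_P _
  · exact X_mem_P _

theorem mem_lineIdeal {F : MvPolynomial (Fin 4) ℂ} :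
    F ∈ lineIdeal (chartLine σ t) ↔ ∀ v ∈ (chartLine σ t).1, eval v F = 0 := Iff.rfl

theorem map_down_lineIdeal : Ideal.map (down σ t) (lineIdeal (chartLine σ t)) ≤
    Ideal.span {X 0, X 1} := by
  refine Ideal.map_le_iff_le_comap.mpr fun F hF => ?_
  refine mem_span_pair_of_eval_eq_zero fun c h0 h1 => ?_
  have h2 : eval c (down σ t F) = eval (toVec σ (Sum.elim t c)) F := by
    have h : down σ t = aeval fun j => down σ t (X j) := by
      refine algHom_ext fun j => ?_
      rw [aeval_X]
    rw [h]
    refine (eval_aeval c _ F).trans (congrArg (fun f => eval f F) (funext fun j => ?_))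
    rw [down_X, eval_toVec]
    refine congrArg (fun f => toVec σ f j) (funext fun i => ?_)
    rcases i with p | i
    · exact eval_C _
    · exact eval_X _
  rw [h2]
  exact (mem_lineIdeal σ t).mp hF _ (toVec_mem (c := Sum.elim t c) h0 h1)

theorem map_up_span : Ideal.map (up σ t) (Ideal.span {X 0, X 1}) ≤ lineIdeal (chartLine σ t) := by
  rw [Ideal.map_span, Ideal.span_le]
  rintro _ ⟨_, rfl | rfl, rfl⟩
  · refine (mem_lineIdeal σ t).mpr fun v hv => ?_
    rw [mem_chartLine] at hv
    simp [up_X, hv.1]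
  · refine (mem_lineIdeal σ t).mpr fun v hv => ?_
    rw [mem_chartLine] at hv
    simp [up_X, hv.2]

theorem down_mem_pairIdeal {k : ℕ} {F : MvPolynomial (Fin 4) ℂ}
    (hF : F ∈ lineIdeal (chartLine σ t) ^ k) : down σ t F ∈ pairIdeal 0 1 k := by
  have h := Ideal.mem_map_of_mem (down σ t) hF
  rw [Ideal.map_pow] at h
  exact Ideal.pow_right_mono (map_down_lineIdeal σ t) k h

theorem up_mem_lineIdeal_pow {k : ℕ} {F : MvPolynomial (Fin 4) ℂ} (hF : F ∈ pairIdeal 0 1 k) :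
    up σ t F ∈ lineIdeal (chartLine σ t) ^ k := by
  have h := Ideal.mem_map_of_mem (up σ t) hF
  rw [Ideal.map_pow] at h
  exact Ideal.pow_right_mono (map_up_span σ t) k h

/-! ### Trivializations over a chart -/

theorem chartCoord_mem_O {W : Opens Gr.Pt} (hW : W ≤ chartDomain σ) (p : Fin 2 × Fin 2) :
    (fun y : W => chartCoord σ y.1 p) ∈ Gr.O W := regularOn_chartCoord hW p

/-- The trivialization of `𝒪 ⊗ P(m)` by the change of variables `down`. -/
def trivTrivP (m : ℤ) : Triv (trivP m) (chartDomain σ) (P m) :=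
  trivSub (P m) (P m) (fun y => (down σ (chartCoord σ y.1)).toLinearMap)
    (fun y => (up σ (chartCoord σ y.1)).toLinearMap) (fun _ => le_rfl)
    (fun _ _ => down_mem_P σ _) (fun _ _ => up_mem_P σ _) (fun _ _ _ => up_down σ _ _)
    (fun _ _ _ => down_up σ _ _) (fun _ _ => isReg_evalT (chartCoord_mem_O σ le_rfl) _)
    (fun _ _ => isReg_evalT (chartCoord_mem_O σ le_rfl) _)

/-- The trivialization of `V_{k,d}` by the change of variables `down`. -/
def trivV (k : ℕ) (d : ℤ) : Triv (V k d) (chartDomain σ)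
    (P d ⊓ (pairIdeal 0 1 k).restrictScalars ℂ : Submodule ℂ (MvPolynomial (Fin 4) ℂ)) :=
  trivSub (P d) _ (fun y => (down σ (chartCoord σ y.1)).toLinearMap)
    (fun y => (up σ (chartCoord σ y.1)).toLinearMap) (fun _ => inf_le_left)
    (fun y n hn => ⟨down_mem_P σ _ hn.1, down_mem_pairIdeal σ _
      (by rw [chartLine_chartCoord y.2]; exact hn.2)⟩)
    (fun y n hn => ⟨up_mem_P σ _ hn.1, by
      have h := up_mem_lineIdeal_pow σ (chartCoord σ y.1) hn.2
      rw [chartLine_chartCoord y.2] at h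
      exact h⟩)
    (fun _ _ _ => up_down σ _ _)
    (fun _ _ _ => down_up σ _ _) (fun _ _ => isReg_evalT (chartCoord_mem_O σ le_rfl) _)
    (fun _ _ => isReg_evalT (chartCoord_mem_O σ le_rfl) _)

/-- The linear functionals that define the line with coordinates `t`. -/
def lineForm (i : Fin 2) : Module.Dual ℂ (Fin 4 → ℂ) :=
  LinearMap.proj (σ (i.castLE (by omega))) - (t (i, 0) • LinearMap.proj (σ 2) +
    t (i, 1) • LinearMap.proj (σ 3))

/-- The values of a functional on two of the basis vectors. -/
def nuL : Module.Dual ℂ (Fin 4 → ℂ) →ₗ[ℂ] (Fin 2 → ℂ) :=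
  LinearMap.pi fun i => LinearMap.applyₗ (Pi.single (σ (i.castLE (by omega))) 1 : Fin 4 → ℂ)

/-- The functional vanishing on the line with coordinates `t` and with prescribed values on two of
the basis vectors. -/
def nuR : (Fin 2 → ℂ) →ₗ[ℂ] Module.Dual ℂ (Fin 4 → ℂ) :=
  Fintype.linearCombination ℂ (lineForm σ t)

theorem nuR_apply (u : Fin 2 → ℂ) : nuR σ t u = u 0 • lineForm σ t 0 + u 1 • lineForm σ t 1 := by
  rw [nuR, Fintype.linearCombination_apply, Fin.sum_univ_two]

theorem nuL_nuR (u : Fin 2 → ℂ) : nuL σ (nuR σ t u) = u := by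
  rw [nuR_apply]
  funext i
  fin_cases i <;> simp [nuL, lineForm]

theorem nuR_mem (u : Fin 2 → ℂ) : nuR σ t u ∈ (chartLine σ t).1.dualAnnihilator := by
  rw [Submodule.mem_dualAnnihilator]
  intro v hv
  rw [mem_chartLine] at hv
  simp [nuR_apply, lineForm, hv.1, hv.2]

/-- A functional vanishing on the line is determined by its values on two of the basis vectors. -/
theorem nuR_nuL {a : Module.Dual ℂ (Fin 4 → ℂ)} (ha : a ∈ (chartLine σ t).1.dualAnnihilator) :
    nuR σ t (nuL σ a) = a := by
  refine sub_eq_zero.mp ?_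
  obtain ⟨D, hD⟩ : ∃ D, D = nuR σ t (nuL σ a) - a := ⟨_, rfl⟩
  rw [← hD]
  have hline : ∀ v ∈ (chartLine σ t).1, D v = 0 := fun v hv => by
    rw [hD, LinearMap.sub_apply, (Submodule.mem_dualAnnihilator _).mp (nuR_mem σ t _) v hv,
      (Submodule.mem_dualAnnihilator _).mp ha v hv, sub_zero]
  have hL : nuL σ D = 0 := by rw [hD, map_sub, nuL_nuR, sub_self]
  have h0 : D (Pi.single (σ 0) 1) = 0 := congrFun hL 0
  have h1 : D (Pi.single (σ 1) 1) = 0 := congrFun hL 1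
  have hsum : ∀ v, D v = v (σ 2) * D (Pi.single (σ 2) 1) + v (σ 3) * D (Pi.single (σ 3) 1) := by
    intro v
    rw [LinearMap.pi_apply_eq_sum_univ D v, ← Equiv.sum_comp σ, Fin.sum_univ_four]
    have hs : ∀ j : Fin 4, (fun i => if j = i then (1 : ℂ) else 0) = Pi.single j 1 := fun j => by
      funext i
      simp [Pi.single_apply, eq_comm]
    simp only [hs, h0, h1, smul_eq_mul, mul_zero, zero_add]
  have h2 := hsum (rows (normalForm σ t) 0)
  have h3 := hsum (rows (normalForm σ t) 1)
  rw [hline _ (normalForm_mem_chartLine σ t _)] at h2 h3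
  simp [normalForm] at h2 h3
  refine LinearMap.ext fun v => ?_
  rw [hsum, ← h2, ← h3, mul_zero, mul_zero, add_zero, LinearMap.zero_apply]

/-- The linear form of an element of the model fibre of `ν`. -/
def stdForm : (Fin 2 → ℂ) →ₗ[ℂ] MvPolynomial (Fin 4) ℂ :=
  Fintype.linearCombination ℂ ![X 0, X 1]

theorem stdForm_apply (u : Fin 2 → ℂ) : stdForm u = u 0 • X 0 + u 1 • X 1 := by
  rw [stdForm, Fintype.linearCombination_apply, Fin.sum_univ_two]
  rfl

/-- The change of variables `down` takes the linear forms vanishing on the line to the combinations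
of `X 0` and `X 1`. -/
theorem down_linForm_nuR (u : Fin 2 → ℂ) : down σ t (linForm (nuR σ t u)) = stdForm u := by
  have hproj : ∀ j, linForm (LinearMap.proj j) = X j := fun j => by
    simp [linForm, Pi.single_apply]
  have hup : ∀ i : Fin 2, linForm (lineForm σ t i) = up σ t (X (i.castLE (by omega))) := fun i => by
    rw [up_X, lineForm, map_sub, map_add, map_smul, map_smul, hproj, hproj, hproj, smul_eq_C_mul,
      smul_eq_C_mul]
    fin_cases i <;> rfl
  rw [nuR_apply, map_add, map_smul, map_smul, hup, hup, map_add, map_smul, map_smul, down_up,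
    down_up, stdForm_apply]
  rfl

theorem isReg_lineForm (i : Fin 2) :
    IsReg (fun y : chartDomain σ => lineForm σ (chartCoord σ y.1) i) := by
  have h : (fun y : chartDomain σ => lineForm σ (chartCoord σ y.1) i) = fun y =>
      LinearMap.proj (σ (i.castLE (by omega))) +
        (chartCoord σ y.1 (i, 0) • (-LinearMap.proj (σ 2)) +
          chartCoord σ y.1 (i, 1) • (-LinearMap.proj (σ 3))) := by
    funext y
    rw [lineForm, smul_neg, smul_neg, ← neg_add, sub_eq_add_neg]
  rw [h]
  exact IsReg.add (IsReg.const _) (IsReg.add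
    (IsReg.smul (chartCoord_mem_O σ le_rfl (i, 0)) (IsReg.const _))
    (IsReg.smul (chartCoord_mem_O σ le_rfl (i, 1)) (IsReg.const _)))

/-- The trivialization of `ν`. -/
def trivNu : Triv nu (chartDomain σ) (Fin 2 → ℂ) :=
  (trivSub (M₀ := (⊤ : Submodule ℂ (Fin 2 → ℂ))) ⊤ (fun _ => nuL σ)
    (fun y => nuR σ (chartCoord σ y.1)) (fun _ => le_top) (fun _ _ _ => trivial)
    (fun y u _ => by
      have h := nuR_mem σ (chartCoord σ y.1) u
      rw [chartLine_chartCoord y.2] at h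
      exact h)
    (fun y a ha => nuR_nuL σ _ (by rw [chartLine_chartCoord y.2]; exact ha))
    (fun _ u _ => nuL_nuR σ _ u) (fun _ _ => IsReg.const _)
    (fun u _ => by
      simp only [nuR_apply]
      exact IsReg.add (IsReg.smul ((Gr.O _).algebraMap_mem (u 0)) (isReg_lineForm σ 0))
        (IsReg.smul ((Gr.O _).algebraMap_mem (u 1)) (isReg_lineForm σ 1)))).congr Submodule.topEquiv

end

end LineSing

namespace LineSing

open CoordSpace FamSheaf MvPolynomial ConePoly

/-! ### The maps `α` and `β` of a vector space of linear forms -/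

/-- The alternating map `(a, b) ↦ (s ⊗ q ↦ as ⊗ bq - bs ⊗ aq)` for two bilinear actions. -/
def altPair {N S S' Q Q' : Type} [AddCommGroup N] [Module ℂ N] [AddCommGroup S] [Module ℂ S]
    [AddCommGroup S'] [Module ℂ S'] [AddCommGroup Q] [Module ℂ Q] [AddCommGroup Q'] [Module ℂ Q']
    (μ : N →ₗ[ℂ] S →ₗ[ℂ] S') (φ : N →ₗ[ℂ] Q →ₗ[ℂ] Q') :
    N [⋀^Fin 2]→ₗ[ℂ] (S ⊗[ℂ] Q →ₗ[ℂ] S' ⊗[ℂ] Q') where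
  toFun v := TensorProduct.map (μ (v 0)) (φ (v 1)) - TensorProduct.map (μ (v 1)) (φ (v 0))
  map_update_add' v i x y := by
    obtain rfl : ‹DecidableEq (Fin 2)› = instDecidableEqFin 2 := Subsingleton.elim _ _
    fin_cases i <;> simp [TensorProduct.map_add_left, TensorProduct.map_add_right] <;> abel
  map_update_smul' v i c x := by
    obtain rfl : ‹DecidableEq (Fin 2)› = instDecidableEqFin 2 := Subsingleton.elim _ _
    fin_cases i <;> simp [TensorProduct.map_smul_left, TensorProduct.map_smul_right, smul_sub]
  map_eq_zero_of_eq' v i i' h hne := by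
    have h01 : v 0 = v 1 := by
      fin_cases i <;> fin_cases i' <;> simp_all
    rw [h01, sub_self]

/-- The map `(a ∧ b) ⊗ s ⊗ q ↦ as ⊗ bq - bs ⊗ aq` for two bilinear actions. -/
def wedgePair {N S S' Q Q' : Type} [AddCommGroup N] [Module ℂ N] [AddCommGroup S] [Module ℂ S]
    [AddCommGroup S'] [Module ℂ S'] [AddCommGroup Q] [Module ℂ Q] [AddCommGroup Q'] [Module ℂ Q']
    (μ : N →ₗ[ℂ] S →ₗ[ℂ] S') (φ : N →ₗ[ℂ] Q →ₗ[ℂ] Q') :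
    (⋀[ℂ]^2 N ⊗[ℂ] S) ⊗[ℂ] Q →ₗ[ℂ] S' ⊗[ℂ] Q' :=
  (TensorProduct.lift (exteriorPower.alternatingMapLinearEquiv (altPair μ φ))).comp
    (TensorProduct.assoc ℂ (⋀[ℂ]^2 N) S Q).toLinearMap

theorem wedgePair_tmul {N S S' Q Q' : Type} [AddCommGroup N] [Module ℂ N] [AddCommGroup S]
    [Module ℂ S] [AddCommGroup S'] [Module ℂ S'] [AddCommGroup Q] [Module ℂ Q] [AddCommGroup Q']
    [Module ℂ Q'] (μ : N →ₗ[ℂ] S →ₗ[ℂ] S') (φ : N →ₗ[ℂ] Q →ₗ[ℂ] Q') (v : Fin 2 → N) (s : S)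
    (q : Q) :
    wedgePair μ φ ((exteriorPower.ιMulti ℂ 2 v ⊗ₜ[ℂ] s) ⊗ₜ[ℂ] q) =
      μ (v 0) s ⊗ₜ[ℂ] φ (v 1) q - μ (v 1) s ⊗ₜ[ℂ] φ (v 0) q := by
  simp [wedgePair, altPair]

theorem wedgePair_natural {N S S' Q Q' M T T' R R' : Type} [AddCommGroup N] [Module ℂ N]
    [AddCommGroup S] [Module ℂ S] [AddCommGroup S'] [Module ℂ S'] [AddCommGroup Q] [Module ℂ Q]
    [AddCommGroup Q'] [Module ℂ Q'] [AddCommGroup M] [Module ℂ M] [AddCommGroup T] [Module ℂ T]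
    [AddCommGroup T'] [Module ℂ T'] [AddCommGroup R] [Module ℂ R] [AddCommGroup R'] [Module ℂ R']
    (μ : N →ₗ[ℂ] S →ₗ[ℂ] S') (φ : N →ₗ[ℂ] Q →ₗ[ℂ] Q') (μ' : M →ₗ[ℂ] T →ₗ[ℂ] T')
    (φ' : M →ₗ[ℂ] R →ₗ[ℂ] R') (f : N ≃ₗ[ℂ] M) (e : S ≃ₗ[ℂ] T) (e' : S' ≃ₗ[ℂ] T') (g : Q ≃ₗ[ℂ] R)
    (g' : Q' ≃ₗ[ℂ] R') (hs : ∀ n s, e' (μ n s) = μ' (f n) (e s))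
    (hp : ∀ n q, g' (φ n q) = φ' (f n) (g q)) (x : (⋀[ℂ]^2 N ⊗[ℂ] S) ⊗[ℂ] Q) :
    TensorProduct.congr e' g' (wedgePair μ φ x) =
      wedgePair μ' φ' (TensorProduct.congr (TensorProduct.congr (wedgeEquiv f) e) g x) := by
  induction x using TensorProduct.induction_on with
  | zero => simp only [map_zero]
  | add x y hx hy => simp only [map_add, hx, hy]
  | tmul x p =>
    induction x using TensorProduct.induction_on with
    | zero => simp only [TensorProduct.zero_tmul, map_zero]
    | add x y hx hy => simp only [TensorProduct.add_tmul, map_add, hx, hy]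
    | tmul w s =>
      have hw : w ∈ Submodule.span ℂ (Set.range (exteriorPower.ιMulti ℂ 2 (M := N))) := by
        rw [exteriorPower.ιMulti_span]
        trivial
      induction hw using Submodule.span_induction with
      | zero => simp only [TensorProduct.zero_tmul, map_zero]
      | add x y _ _ hx hy => simp only [TensorProduct.add_tmul, map_add, hx, hy]
      | smul c x _ hx => simp only [← TensorProduct.smul_tmul', map_smul, hx]
      | mem x hx =>
        obtain ⟨v, rfl⟩ := hx
        rw [wedgePair_tmul, map_sub, TensorProduct.congr_tmul, TensorProduct.congr_tmul,
          TensorProduct.congr_tmul, TensorProduct.congr_tmul, wedgeEquiv_ιMulti, wedgePair_tmul,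
          hs, hs, hp, hp]

section

variable {N : Type} [AddCommGroup N] [Module ℂ N] (lam : N →ₗ[ℂ] MvPolynomial (Fin 4) ℂ)
  (hlam : ∀ n, lam n ∈ P 1)

/-- Multiplication of polynomials by linear forms. -/
def formMul (m : ℤ) : N →ₗ[ℂ] P (m - 1) →ₗ[ℂ] P m :=
  LinearMap.mk₂ ℂ (fun n p => ⟨lam n * p.1, mul_mem_P (by ring) (hlam n) p.2⟩)
    (fun n n' p => Subtype.ext (by simp [add_mul]))
    (fun c n p => Subtype.ext (by simp))
    (fun n p p' => Subtype.ext (by simp [mul_add]))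
    (fun c n p => Subtype.ext (by simp))

theorem formMul_coe (m : ℤ) (n : N) (p : P (m - 1)) :
    (formMul lam hlam m n p : MvPolynomial (Fin 4) ℂ) = lam n * p.1 := rfl

variable (N) in
/-- Multiplication in the symmetric algebra by vectors. -/
def symMul (j : ℕ) : N →ₗ[ℂ] SymPow j N →ₗ[ℂ] SymPow (j + 1) N :=
  LinearMap.mk₂ ℂ (fun n s => ⟨SymmetricAlgebra.ι ℂ N n * s.1, by
      rw [SymPow, pow_succ']
      exact Submodule.mul_mem_mul ⟨n, rfl⟩ s.2⟩)
    (fun n n' p => Subtype.ext (by simp [add_mul]))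
    (fun c n p => Subtype.ext (by simp))
    (fun n p p' => Subtype.ext (by simp [mul_add]))
    (fun c n p => Subtype.ext (by simp))

theorem symMul_coe (j : ℕ) (n : N) (s : SymPow j N) :
    (symMul N j n s : SymmetricAlgebra ℂ N) = SymmetricAlgebra.ι ℂ N n * s.1 := rfl

/-- The map `α`. -/
def alpha (j : ℕ) (m : ℤ) :
    (⋀[ℂ]^2 N ⊗[ℂ] SymPow j N) ⊗[ℂ] P (m - 1) →ₗ[ℂ] SymPow (j + 1) N ⊗[ℂ] P m :=
  wedgePair (symMul N j) (formMul lam hlam m)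

theorem alpha_tmul (j : ℕ) (m : ℤ) (v : Fin 2 → N) (s : SymPow j N) (p : P (m - 1)) :
    alpha lam hlam j m ((exteriorPower.ιMulti ℂ 2 v ⊗ₜ[ℂ] s) ⊗ₜ[ℂ] p) =
      symMul N j (v 0) s ⊗ₜ[ℂ] formMul lam hlam m (v 1) p -
        symMul N j (v 1) s ⊗ₜ[ℂ] formMul lam hlam m (v 0) p :=
  wedgePair_tmul _ _ v s p

theorem lift_mem_of_mem_symPow (hlam : ∀ n, lam n ∈ P 1)
    {I : Ideal (MvPolynomial (Fin 4) ℂ)} (hI : ∀ n, lam n ∈ I) (k : ℕ)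
    {s : SymmetricAlgebra ℂ N} (hs : s ∈ SymPow k N) :
    SymmetricAlgebra.lift lam s ∈ P k ∧ SymmetricAlgebra.lift lam s ∈ I ^ k := by
  induction k generalizing s with
  | zero =>
    obtain ⟨c, rfl⟩ := Submodule.mem_one.mp hs
    rw [AlgHom.commutes, pow_zero, Ideal.one_eq_top]
    exact ⟨mem_P_natCast.mpr (isHomogeneous_C _ c), trivial⟩
  | succ k ih =>
    have hs' : s ∈ SymPow k N * LinearMap.range (SymmetricAlgebra.ι ℂ N) := by
      rwa [SymPow, ← pow_succ]
    refine Submodule.mul_induction_on (C := fun s => SymmetricAlgebra.lift lam s ∈ P (k + 1 : ℕ) ∧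
      SymmetricAlgebra.lift lam s ∈ I ^ (k + 1)) hs' ?_ ?_
    · rintro s hs _ ⟨n, rfl⟩
      rw [map_mul, SymmetricAlgebra.lift_ι_apply, pow_succ]
      exact ⟨mul_mem_P (by push_cast; rfl) (ih hs).1 (hlam n), Ideal.mul_mem_mul (ih hs).2 (hI n)⟩
    · intro s s' hs hs'
      rw [map_add]
      exact ⟨Submodule.add_mem _ hs.1 hs'.1, Ideal.add_mem _ hs.2 hs'.2⟩

/-- The multiplication of polynomials, without constraints on the target. -/
def betaAux (k : ℕ) (m : ℤ) : SymPow k N ⊗[ℂ] P m →ₗ[ℂ] MvPolynomial (Fin 4) ℂ :=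
  TensorProduct.lift ((LinearMap.mul ℂ (MvPolynomial (Fin 4) ℂ)).compl₁₂
    ((SymmetricAlgebra.lift lam).toLinearMap.comp (SymPow k N).subtype) (P m).subtype)

theorem betaAux_tmul (k : ℕ) (m : ℤ) (s : SymPow k N) (p : P m) :
    betaAux lam k m (s ⊗ₜ[ℂ] p) = SymmetricAlgebra.lift lam s.1 * p.1 := rfl

variable {lam}

theorem betaAux_mem (hlam : ∀ n, lam n ∈ P 1)
    {I : Ideal (MvPolynomial (Fin 4) ℂ)} (hI : ∀ n, lam n ∈ I) {k : ℕ} {m d : ℤ}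
    (hd : d = m + k) (x : SymPow k N ⊗[ℂ] P m) :
    betaAux lam k m x ∈ P d ⊓ (I ^ k).restrictScalars ℂ := by
  induction x using TensorProduct.induction_on with
  | zero => rw [map_zero]; exact Submodule.zero_mem _
  | tmul s p =>
    obtain ⟨h1, h2⟩ := lift_mem_of_mem_symPow lam hlam hI k s.2
    rw [betaAux_tmul]
    exact ⟨mul_mem_P (by rw [hd, add_comm]) h1 p.2, Ideal.mul_mem_right _ _ h2⟩
  | add x y hx hy => rw [map_add]; exact Submodule.add_mem _ hx hy

/-- The map `β`, with values in the polynomials of degree `d` in the `k`-th power of an ideal that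
contains the linear forms. -/
def beta (hlam : ∀ n, lam n ∈ P 1)
    {I : Ideal (MvPolynomial (Fin 4) ℂ)} (hI : ∀ n, lam n ∈ I) {k : ℕ} {m d : ℤ}
    (hd : d = m + k) :
    SymPow k N ⊗[ℂ] P m →ₗ[ℂ]
      (P d ⊓ (I ^ k).restrictScalars ℂ : Submodule ℂ (MvPolynomial (Fin 4) ℂ)) :=
  (betaAux lam k m).codRestrict _ (betaAux_mem hlam hI hd)

/-! ### Naturality -/

variable {N' : Type} [AddCommGroup N'] [Module ℂ N'] {lam' : N' →ₗ[ℂ] MvPolynomial (Fin 4) ℂ}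

theorem alpha_natural (hlam : ∀ n, lam n ∈ P 1) (hlam' : ∀ n, lam' n ∈ P 1) (f : N ≃ₗ[ℂ] N')
    (T : MvPolynomial (Fin 4) ℂ →ₐ[ℂ] MvPolynomial (Fin 4) ℂ)
    (hT : ∀ n, T (lam n) = lam' (f n)) {j : ℕ} {m : ℤ} (g : P (m - 1) ≃ₗ[ℂ] P (m - 1))
    (hg : ∀ p, (g p).1 = T p.1) (g' : P m ≃ₗ[ℂ] P m) (hg' : ∀ p, (g' p).1 = T p.1)
    (x : (⋀[ℂ]^2 N ⊗[ℂ] SymPow j N) ⊗[ℂ] P (m - 1)) :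
    TensorProduct.congr (symEquiv (j + 1) f) g' (alpha lam hlam j m x) =
      alpha lam' hlam' j m
        (TensorProduct.congr (TensorProduct.congr (wedgeEquiv f) (symEquiv j f)) g x) := by
  have hs : ∀ n s, symEquiv (j + 1) f (symMul N j n s) = symMul N' j (f n) (symEquiv j f s) := by
    intro n s
    refine Subtype.ext ?_
    refine (map_mul (symAlgMap f.toLinearMap) _ _).trans ?_
    rw [SymmetricAlgebra.lift_ι_apply]
    rfl
  have hp : ∀ n p, g' (formMul lam hlam m n p) = formMul lam' hlam' m (f n) (g p) := by
    intro n p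
    refine Subtype.ext ?_
    rw [hg', formMul_coe, formMul_coe, map_mul, hT, hg]
  exact wedgePair_natural _ _ _ _ f (symEquiv j f) (symEquiv (j + 1) f) g g' hs hp x

theorem betaAux_natural (f : N ≃ₗ[ℂ] N')
    (T : MvPolynomial (Fin 4) ℂ →ₐ[ℂ] MvPolynomial (Fin 4) ℂ)
    (hT : ∀ n, T (lam n) = lam' (f n)) {k : ℕ} {m : ℤ} (g' : P m ≃ₗ[ℂ] P m)
    (hg' : ∀ p, (g' p).1 = T p.1) (x : SymPow k N ⊗[ℂ] P m) :
    T (betaAux lam k m x) = betaAux lam' k m (TensorProduct.congr (symEquiv k f) g' x) := by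
  induction x using TensorProduct.induction_on with
  | zero => simp only [map_zero]
  | add x y hx hy => simp only [map_add, hx, hy]
  | tmul s p =>
    rw [TensorProduct.congr_tmul, betaAux_tmul, betaAux_tmul, map_mul, hg']
    refine congrArg (· * T p.1) ?_
    have h1 : T.comp (SymmetricAlgebra.lift lam) =
        (SymmetricAlgebra.lift lam').comp (symAlgMap f.toLinearMap) :=
      SymmetricAlgebra.algHom_ext (LinearMap.ext fun n => by
        simp [SymmetricAlgebra.lift_ι_apply, hT])
    exact DFunLike.congr_fun h1 s.1

end

end LineSing

namespace LineSing

open CoordSpace FamSheaf MvPolynomial ConePoly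

/-! ### Syzygies of the monomials of degree `k` in two variables -/

theorem degree_eq_of_coeff_ne_zero {F : MvPolynomial (Fin 4) ℂ} {n : ℕ} (hF : F.IsHomogeneous n)
    {e : Fin 4 →₀ ℕ} (he : coeff e F ≠ 0) : e.degree = n :=
  (DFunLike.congr_fun Finsupp.degree_eq_weight_one e).trans (hF he)

theorem mem_P_of_X_mul_mem {m : ℤ} {j : Fin 4} {q : MvPolynomial (Fin 4) ℂ} (h : X j * q ∈ P m) :
    q ∈ P (m - 1) := by
  rw [mem_P_iff] at h
  by_cases hq : q = 0
  · rw [hq]; exact Submodule.zero_mem _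
  obtain h | ⟨n, rfl, h⟩ := h
  · exact absurd h (mul_ne_zero (X_ne_zero j) hq)
  have hdeg : ∀ e, coeff e q ≠ 0 → e.degree + 1 = n := fun e he => by
    have h1 := degree_eq_of_coeff_ne_zero h (e := Finsupp.single j 1 + e) (by rwa [coeff_X_mul])
    rw [map_add, Finsupp.degree_single] at h1
    omega
  obtain ⟨e, he⟩ := ne_zero_iff.mp hq
  refine mem_P_iff.mpr (Or.inr ⟨e.degree, by have := hdeg e he; omega, fun {e'} he' => ?_⟩)
  refine (DFunLike.congr_fun Finsupp.degree_eq_weight_one e').symm.trans ?_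
  have h1 := hdeg e he
  have h2 := hdeg e' he'
  omega

/-- The syzygies of the monomials `X₀ⁱ X₁ᵏ⁻ⁱ` are generated by those between neighbours. -/
theorem exists_syzygy {m : ℤ} (k : ℕ) (c : ℕ → MvPolynomial (Fin 4) ℂ) (hc : ∀ i, c i ∈ P m)
    (h : ∑ i ∈ Finset.range (k + 1), c i * (X 0 ^ i * X 1 ^ (k - i)) = 0) :
    ∃ q : ℕ → MvPolynomial (Fin 4) ℂ, (∀ i, q i ∈ P (m - 1)) ∧ c 0 = -(X 0 * q 0) ∧
      (∀ i < k, c (i + 1) = X 1 * q i - X 0 * q (i + 1)) ∧ q k = 0 := by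
  induction k generalizing c with
  | zero =>
    refine ⟨fun _ => 0, fun _ => Submodule.zero_mem _, ?_, fun i hi => absurd hi (by omega), rfl⟩
    simpa using h
  | succ k ih =>
    rw [Finset.sum_range_succ'] at h
    have hS : ∑ i ∈ Finset.range (k + 1), c (i + 1) * (X 0 ^ (i + 1) * X 1 ^ (k + 1 - (i + 1))) =
        X 0 * ∑ i ∈ Finset.range (k + 1), c (i + 1) * (X 0 ^ i * X 1 ^ (k - i)) := by
      rw [Finset.mul_sum]
      refine Finset.sum_congr rfl fun i _ => ?_
      rw [Nat.add_sub_add_right]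
      ring
    rw [hS, pow_zero, one_mul, Nat.sub_zero] at h
    -- `X₀` divides `c₀ X₁ᵏ⁺¹`, hence `c₀`.
    obtain ⟨q₀, hq₀⟩ : X 0 ∣ c 0 := by
      have h1 : X 0 ∣ c 0 * X 1 ^ (k + 1) := by
        rw [eq_neg_of_add_eq_zero_right h]
        exact (Dvd.intro _ rfl).neg_right
      refine ((X_prime (i := 0)).dvd_or_dvd h1).resolve_right fun h2 => ?_
      have h3 := (X_prime (i := (0 : Fin 4))).dvd_of_dvd_pow h2
      rw [X_dvd_X] at h3
      simp at h3
    have hq₀P : q₀ ∈ P (m - 1) := mem_P_of_X_mul_mem (hq₀ ▸ hc 0)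
    have h' : ∑ i ∈ Finset.range (k + 1), (fun i => c (i + 1) + if i = 0 then X 1 * q₀ else 0) i *
        (X 0 ^ i * X 1 ^ (k - i)) = 0 := by
      have h1 : ∑ i ∈ Finset.range (k + 1), (if i = 0 then X 1 * q₀ else 0) *
          (X 0 ^ i * X 1 ^ (k - i)) = (X 1 * q₀ * X 1 ^ k : MvPolynomial (Fin 4) ℂ) := by
        rw [Finset.sum_eq_single 0]
        · simp
        · intro i _ hi
          rw [if_neg hi, zero_mul]
        · simp
      simp only [add_mul, Finset.sum_add_distrib]
      rw [h1]
      refine (mul_right_injective₀ (X_ne_zero (0 : Fin 4))) ?_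
      change X 0 * _ = X 0 * 0
      rw [mul_zero, ← h, hq₀]
      ring
    obtain ⟨q, hqP, hq0, hqi, hqk⟩ := ih (fun i => c (i + 1) + if i = 0 then X 1 * q₀ else 0)
      (fun i => by
        refine Submodule.add_mem _ (hc _) ?_
        split_ifs
        · exact mul_mem_P (by ring) (X_mem_P 1) hq₀P
        · exact Submodule.zero_mem _) h'
    refine ⟨fun i => match i with | 0 => -q₀ | i + 1 => q i, ?_, ?_, ?_, hqk⟩
    · rintro (_ | i)
      · exact Submodule.neg_mem _ hq₀P
      · exact hqP i
    · rw [hq₀]; ring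
    · rintro (_ | i) hi
      · have := hq0
        simp only [if_true] at this
        linear_combination this
      · have := hqi i (by omega)
        simp only [Nat.succ_ne_zero, if_false, add_zero] at this
        exact this

theorem homogeneousComponent_add_mul {M : MvPolynomial (Fin 4) ℂ} {k : ℕ} (hM : M.IsHomogeneous k)
    (n : ℕ) (F : MvPolynomial (Fin 4) ℂ) :
    homogeneousComponent (n + k) (F * M) = homogeneousComponent n F * M := by
  have h1 : ∀ i, homogeneousComponent (n + k) (homogeneousComponent i F * M) =
      if n = i then homogeneousComponent i F * M else 0 := fun i => by
    rw [homogeneousComponent_of_mem ((homogeneousComponent_isHomogeneous i F).mul hM)]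
    simp
  conv_lhs => rw [← sum_homogeneousComponent F, Finset.sum_mul, map_sum]
  simp only [h1, Finset.sum_ite_eq]
  split_ifs with h
  · rfl
  · rw [homogeneousComponent_eq_zero _ _ (by simpa using h), zero_mul]

/-- The coefficients of the monomials `X₀ⁱ X₁ᵏ⁻ⁱ` may be taken homogeneous. For `d < k` all of them
are zero, because `(X₀, X₁) ^ k` has no elements of degree less than `k`. -/
theorem exists_eq_sum_homogeneous {k : ℕ} {m d : ℤ} (hd : d = m + k) {F : MvPolynomial (Fin 4) ℂ}
    (hF : F ∈ P d) (hFk : F ∈ pairIdeal 0 1 k) :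
    ∃ C : ℕ → P m, F = ∑ i ∈ Finset.range (k + 1), (C i).1 * (X 0 ^ i * X 1 ^ (k - i)) := by
  by_cases hm : 0 ≤ m
  · obtain ⟨n, rfl⟩ := Int.eq_ofNat_of_zero_le hm
    have hF' : F.IsHomogeneous (n + k) := mem_P_natCast.mp (by push_cast; exact hd ▸ hF)
    obtain ⟨C, hC⟩ := exists_eq_sum_of_mem_pairIdeal hFk
    refine ⟨fun i => ⟨homogeneousComponent n (C i),
      mem_P_natCast.mpr (homogeneousComponent_isHomogeneous _ _)⟩, ?_⟩
    rw [← homogeneousComponent_eq_self hF']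
    conv_lhs => rw [hC, map_sum]
    refine Finset.sum_congr rfl fun i hi => ?_
    have hi' : i ≤ k := Nat.lt_succ_iff.mp (Finset.mem_range.mp hi)
    have hM : (X 0 ^ i * X 1 ^ (k - i) : MvPolynomial (Fin 4) ℂ) ∈
        homogeneousSubmodule (Fin 4) ℂ k := by
      have := ((isHomogeneous_X ℂ (0 : Fin 4)).pow i).mul
        ((isHomogeneous_X ℂ (1 : Fin 4)).pow (k - i))
      rwa [show 1 * i + 1 * (k - i) = k by omega] at this
    exact homogeneousComponent_add_mul hM n (C i)
  · refine ⟨fun _ => 0, ?_⟩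
    obtain h | ⟨n, hn, h⟩ := mem_P_iff.mp hF
    · simp [h]
    have h0 : F = 0 := by
      by_contra hne
      obtain ⟨e, he⟩ := ne_zero_iff.mp hne
      have h1 := degree_eq_of_coeff_ne_zero h he
      have h2 := (mem_pairIdeal_iff (by decide)).mp hFk e (mem_support_iff.mpr he)
      have h3 : e 0 + e 1 ≤ Finsupp.degree e := by
        rw [Finsupp.degree_eq_sum, Fin.sum_univ_four]
        omega
      omega
    simp [h0]

end LineSing

namespace LineSing

open CoordSpace FamSheaf MvPolynomial ConePoly

/-! ### The exact sequence for the standard line -/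

theorem exists_eq_sum_tmul {S Q : Type} [AddCommMonoid S] [Module ℂ S] [AddCommMonoid Q]
    [Module ℂ Q]
    {e : ℕ → S} {n : ℕ} (he : ∀ s, ∃ t : ℕ → ℂ, s = ∑ i ∈ Finset.range n, t i • e i)
    (x : S ⊗[ℂ] Q) : ∃ c : ℕ → Q, x = ∑ i ∈ Finset.range n, e i ⊗ₜ[ℂ] c i := by
  induction x using TensorProduct.induction_on with
  | zero => exact ⟨0, by simp⟩
  | tmul s q =>
    obtain ⟨t, ht⟩ := he s
    refine ⟨fun i => t i • q, ?_⟩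
    conv_lhs => rw [ht, TensorProduct.sum_tmul]
    exact Finset.sum_congr rfl fun i _ => TensorProduct.smul_tmul _ _ _
  | add x y hx hy =>
    obtain ⟨c, rfl⟩ := hx
    obtain ⟨c', rfl⟩ := hy
    refine ⟨c + c', ?_⟩
    simp only [Pi.add_apply, TensorProduct.tmul_add, Finset.sum_add_distrib]

/-- The basis of the model fibre of `ν`. -/
abbrev stdVec (i : Fin 2) : Fin 2 → ℂ := Pi.single i 1

theorem stdForm_stdVec_zero : stdForm (stdVec 0) = X 0 := by simp [stdForm_apply]

theorem stdForm_stdVec_one : stdForm (stdVec 1) = X 1 := by simp [stdForm_apply]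

theorem stdForm_mem_P (u : Fin 2 → ℂ) : stdForm u ∈ P 1 := by
  rw [stdForm_apply]
  exact Submodule.add_mem _ (Submodule.smul_mem _ _ (X_mem_P 0))
    (Submodule.smul_mem _ _ (X_mem_P 1))

theorem stdForm_mem_span (u : Fin 2 → ℂ) :
    stdForm u ∈ Ideal.span {(X 0 : MvPolynomial (Fin 4) ℂ), X 1} := by
  rw [stdForm_apply, smul_eq_C_mul, smul_eq_C_mul]
  exact Ideal.add_mem _ (Ideal.mul_mem_left _ _ (Ideal.subset_span (by simp)))
    (Ideal.mul_mem_left _ _ (Ideal.subset_span (by simp)))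

/-- The exterior square of a plane is a line. -/
theorem exists_eq_smul_wedge (w : ⋀[ℂ]^2 (Fin 2 → ℂ)) :
    ∃ t : ℂ, w = t • exteriorPower.ιMulti ℂ 2 stdVec := by
  let S : Submodule ℂ (⋀[ℂ]^2 (Fin 2 → ℂ)) := ℂ ∙ exteriorPower.ιMulti ℂ 2 stdVec
  have hg : S.mkQ.compAlternatingMap (exteriorPower.ιMulti ℂ 2) = 0 := by
    refine Module.Basis.ext_alternating (Pi.basisFun ℂ (Fin 2)) fun v hv => ?_
    have h2 : (∀ i, v i = i) ∨ ∀ i, v i = Equiv.swap 0 1 i := by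
      revert v; decide
    refine (Submodule.Quotient.mk_eq_zero S).mpr ?_
    obtain h | h := h2
    · simp only [h, Pi.basisFun_apply]
      exact Submodule.mem_span_singleton_self _
    · simp only [h, Pi.basisFun_apply]
      have h3 := (exteriorPower.ιMulti ℂ 2 (M := Fin 2 → ℂ)).map_swap stdVec
        (show (0 : Fin 2) ≠ 1 by decide)
      refine (congrArg (· ∈ S) h3).mpr ?_
      exact S.neg_mem (Submodule.mem_span_singleton_self _)
  have hw : w ∈ Submodule.span ℂ (Set.range (exteriorPower.ιMulti ℂ 2 (M := Fin 2 → ℂ))) := by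
    rw [exteriorPower.ιMulti_span]
    trivial
  have hS : w ∈ S := by
    refine Submodule.span_le.mpr ?_ hw
    rintro _ ⟨v, rfl⟩
    exact (Submodule.Quotient.mk_eq_zero S).mp (DFunLike.congr_fun hg v)
  obtain ⟨t, ht⟩ := Submodule.mem_span_singleton.mp hS
  exact ⟨t, ht.symm⟩

theorem monomial_mem_symPow (i l : ℕ) :
    SymmetricAlgebra.ι ℂ (Fin 2 → ℂ) (stdVec 0) ^ i *
      SymmetricAlgebra.ι ℂ (Fin 2 → ℂ) (stdVec 1) ^ l ∈
      SymPow (i + l) (Fin 2 → ℂ) := by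
  rw [SymPow, pow_add]
  exact Submodule.mul_mem_mul (Submodule.pow_mem_pow _ (LinearMap.mem_range_self _ _) _)
    (Submodule.pow_mem_pow _ (LinearMap.mem_range_self _ _) _)

/-- The monomials of degree `k` in the symmetric algebra; zero if `i > k`. -/
def symMon (k i : ℕ) : SymPow k (Fin 2 → ℂ) :=
  if h : i ≤ k then ⟨_, by
    have := monomial_mem_symPow i (k - i)
    rwa [show i + (k - i) = k by omega] at this⟩
  else 0

theorem symMon_coe {k i : ℕ} (h : i ≤ k) : (symMon k i : SymmetricAlgebra ℂ (Fin 2 → ℂ)) =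
    SymmetricAlgebra.ι ℂ (Fin 2 → ℂ) (stdVec 0) ^ i *
      SymmetricAlgebra.ι ℂ (Fin 2 → ℂ) (stdVec 1) ^ (k - i) := by
  rw [symMon, dif_pos h]

theorem symMul_zero_symMon {j i : ℕ} (h : i ≤ j) :
    symMul (Fin 2 → ℂ) j (stdVec 0) (symMon j i) = symMon (j + 1) (i + 1) := by
  refine Subtype.ext ?_
  rw [symMul_coe, symMon_coe h, symMon_coe (by omega), Nat.add_sub_add_right]
  ring

theorem symMul_one_symMon {j i : ℕ} (h : i ≤ j) :
    symMul (Fin 2 → ℂ) j (stdVec 1) (symMon j i) = symMon (j + 1) i := by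
  refine Subtype.ext ?_
  rw [symMul_coe, symMon_coe h, symMon_coe (by omega), show j + 1 - i = j - i + 1 by omega]
  ring

theorem exists_eq_sum_symMon {k : ℕ} (s : SymPow k (Fin 2 → ℂ)) :
    ∃ t : ℕ → ℂ, s = ∑ i ∈ Finset.range (k + 1), t i • symMon k i := by
  have hspan : ∀ k (s : SymmetricAlgebra ℂ (Fin 2 → ℂ)) (_ : s ∈ SymPow k (Fin 2 → ℂ)),
      s ∈ Submodule.span ℂ (Set.range fun i : Fin (k + 1) =>
        (symMon k i : SymmetricAlgebra ℂ (Fin 2 → ℂ))) := by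
    intro k
    induction k with
    | zero =>
      intro s hs
      obtain ⟨c, rfl⟩ := Submodule.mem_one.mp hs
      rw [Algebra.algebraMap_eq_smul_one]
      refine Submodule.smul_mem _ _ (Submodule.subset_span ⟨0, ?_⟩)
      simp [symMon_coe]
    | succ k ih =>
      intro s hs
      rw [SymPow, pow_succ'] at hs
      refine Submodule.mul_induction_on hs ?_ fun _ _ => Submodule.add_mem _
      rintro _ ⟨u, rfl⟩ s hs
      have hu : u = u 0 • stdVec 0 + u 1 • stdVec 1 := by
        funext i
        fin_cases i <;> simp
      refine Submodule.span_induction (p := fun s _ => SymmetricAlgebra.ι ℂ (Fin 2 → ℂ) u * s ∈ _)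
        ?_ (by rw [mul_zero]; exact Submodule.zero_mem _)
        (fun x y _ _ hx hy => by rw [mul_add]; exact Submodule.add_mem _ hx hy)
        (fun c x _ hx => by rw [mul_smul_comm]; exact Submodule.smul_mem _ c hx) (ih s hs)
      rintro _ ⟨i, rfl⟩
      have hi : (i : ℕ) ≤ k := Nat.lt_succ_iff.mp i.2
      have h0 := congrArg Subtype.val (symMul_zero_symMon hi)
      have h1 := congrArg Subtype.val (symMul_one_symMon hi)
      rw [symMul_coe] at h0 h1
      rw [hu, map_add, map_smul, map_smul, add_mul, smul_mul_assoc, smul_mul_assoc, h0, h1]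
      exact Submodule.add_mem _
        (Submodule.smul_mem _ _ (Submodule.subset_span ⟨⟨i + 1, by omega⟩, rfl⟩))
        (Submodule.smul_mem _ _ (Submodule.subset_span ⟨⟨i, by omega⟩, rfl⟩))
  obtain ⟨t, ht⟩ := (Submodule.mem_span_range_iff_exists_fun ℂ).mp (hspan k s.1 s.2)
  refine ⟨fun i => if h : i < k + 1 then t ⟨i, h⟩ else 0, Subtype.ext ?_⟩
  rw [← ht, AddSubmonoidClass.coe_finsetSum, Finset.sum_range]
  refine Finset.sum_congr rfl fun i _ => ?_
  simp [Nat.lt_succ_iff.mp i.2]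

end LineSing

namespace LineSing

open CoordSpace FamSheaf MvPolynomial ConePoly

section

variable {j k : ℕ} {m d : ℤ}

/-- The generating function of the coefficients of an element of `Symᵏ ⊗ P(m)`: the monomial
`u₀ⁱ u₁ᵏ⁻ⁱ ⊗ c` is mapped to `c Tⁱ`. -/
def genFun (k : ℕ) (m : ℤ) :
    SymPow k (Fin 2 → ℂ) ⊗[ℂ] P m →ₗ[ℂ] Polynomial (MvPolynomial (Fin 4) ℂ) :=
  TensorProduct.lift ((LinearMap.mul ℂ (Polynomial (MvPolynomial (Fin 4) ℂ))).compl₁₂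
    ((SymmetricAlgebra.lift (Fintype.linearCombination ℂ ![Polynomial.X, 1])).toLinearMap.comp
      (SymPow k (Fin 2 → ℂ)).subtype)
    ((Polynomial.CAlgHom (R := ℂ) (A := MvPolynomial (Fin 4) ℂ)).toLinearMap.comp (P m).subtype))

theorem genFun_tmul {i : ℕ} (h : i ≤ k) (c : P m) :
    genFun k m (symMon k i ⊗ₜ[ℂ] c) = Polynomial.C c.1 * Polynomial.X ^ i := by
  have h0 : Fintype.linearCombination ℂ
      ![(Polynomial.X : Polynomial (MvPolynomial (Fin 4) ℂ)), 1] (stdVec 0) = Polynomial.X := by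
    simp [Fintype.linearCombination_apply]
  have h1 : Fintype.linearCombination ℂ
      ![(Polynomial.X : Polynomial (MvPolynomial (Fin 4) ℂ)), 1] (stdVec 1) = 1 := by
    simp [Fintype.linearCombination_apply]
  refine Eq.trans (b := SymmetricAlgebra.lift (Fintype.linearCombination ℂ ![Polynomial.X, 1])
    (symMon k i).1 * Polynomial.C c.1) rfl ?_
  rw [symMon_coe h, map_mul, map_pow, map_pow, SymmetricAlgebra.lift_ι_apply,
    SymmetricAlgebra.lift_ι_apply, h0, h1, one_pow, mul_one, mul_comm]

theorem eq_of_sum_C_mul_X_pow_eq {R : Type} [CommRing R] {n : ℕ} {c c' : ℕ → R}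
    (h : ∑ i ∈ Finset.range n, Polynomial.C (c i) * Polynomial.X ^ i =
      ∑ i ∈ Finset.range n, Polynomial.C (c' i) * Polynomial.X ^ i) {i : ℕ} (hi : i < n) :
    c i = c' i := by
  have h1 := congrArg (Polynomial.coeff · i) h
  simpa [Polynomial.finsetSum_coeff, Polynomial.coeff_C_mul_X_pow, hi] using h1

/-- The element of `∧² ⊗ Symʲ ⊗ P(m - 1)` with coefficients `q`. -/
def wedgeSum (j : ℕ) (q : ℕ → P (m - 1)) :
    (⋀[ℂ]^2 (Fin 2 → ℂ) ⊗[ℂ] SymPow j (Fin 2 → ℂ)) ⊗[ℂ] P (m - 1) :=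
  ∑ i ∈ Finset.range (j + 1), (exteriorPower.ιMulti ℂ 2 stdVec ⊗ₜ[ℂ] symMon j i) ⊗ₜ[ℂ] q i

theorem exists_eq_wedgeSum
    (x : (⋀[ℂ]^2 (Fin 2 → ℂ) ⊗[ℂ] SymPow j (Fin 2 → ℂ)) ⊗[ℂ] P (m - 1)) :
    ∃ q, x = wedgeSum j q := by
  refine exists_eq_sum_tmul (fun y => ?_) x
  induction y using TensorProduct.induction_on with
  | zero => exact ⟨0, by simp⟩
  | tmul w s =>
    obtain ⟨r, rfl⟩ := exists_eq_smul_wedge w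
    obtain ⟨t, rfl⟩ := exists_eq_sum_symMon s
    refine ⟨fun i => r * t i, ?_⟩
    rw [TensorProduct.tmul_sum]
    refine Finset.sum_congr rfl fun i _ => ?_
    rw [TensorProduct.tmul_smul, ← TensorProduct.smul_tmul', smul_smul, mul_comm]
  | add x y hx hy =>
    obtain ⟨t, rfl⟩ := hx
    obtain ⟨t', rfl⟩ := hy
    refine ⟨t + t', ?_⟩
    simp only [Pi.add_apply, add_smul, Finset.sum_add_distrib]

theorem alpha_wedgeSum (q : ℕ → P (m - 1)) :
    alpha stdForm stdForm_mem_P j m (wedgeSum j q) = ∑ i ∈ Finset.range (j + 1),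
      (symMon (j + 1) (i + 1) ⊗ₜ[ℂ] formMul stdForm stdForm_mem_P m (stdVec 1) (q i) -
        symMon (j + 1) i ⊗ₜ[ℂ] formMul stdForm stdForm_mem_P m (stdVec 0) (q i)) := by
  rw [wedgeSum, map_sum]
  refine Finset.sum_congr rfl fun i hi => ?_
  have hi' : i ≤ j := Nat.lt_succ_iff.mp (Finset.mem_range.mp hi)
  rw [alpha_tmul, symMul_zero_symMon hi', symMul_one_symMon hi']

/-- On generating functions, `α` is the multiplication by `X₁ T - X₀`. -/
theorem genFun_alpha_wedgeSum (q : ℕ → P (m - 1)) :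
    genFun (j + 1) m (alpha stdForm stdForm_mem_P j m (wedgeSum j q)) =
      (Polynomial.C (X 1) * Polynomial.X - Polynomial.C (X 0)) *
        ∑ i ∈ Finset.range (j + 1), Polynomial.C (q i).1 * Polynomial.X ^ i := by
  rw [alpha_wedgeSum, map_sum, Finset.mul_sum]
  refine Finset.sum_congr rfl fun i hi => ?_
  have hi' : i < j + 1 := Finset.mem_range.mp hi
  rw [map_sub, genFun_tmul (by omega), genFun_tmul (by omega), formMul_coe, formMul_coe,
    stdForm_stdVec_zero, stdForm_stdVec_one, Polynomial.C_mul, Polynomial.C_mul]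
  ring

/-- The map `α` of the standard line is injective, since `X₁ T - X₀` is not a zero divisor. -/
theorem alpha_std_injective : Function.Injective (alpha stdForm stdForm_mem_P j m) := by
  intro x x' hx
  obtain ⟨q, rfl⟩ := exists_eq_wedgeSum x
  obtain ⟨q', rfl⟩ := exists_eq_wedgeSum x'
  have h := congrArg (genFun (j + 1) m) hx
  rw [genFun_alpha_wedgeSum, genFun_alpha_wedgeSum] at h
  have hne : (Polynomial.C (X 1) * Polynomial.X - Polynomial.C (X 0) :
      Polynomial (MvPolynomial (Fin 4) ℂ)) ≠ 0 := fun h => X_ne_zero (R := ℂ) (1 : Fin 4) (by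
    have := congrArg (Polynomial.coeff · 1) h
    simp [Polynomial.coeff_C] at this)
  have h' := mul_left_cancel₀ hne h
  refine Finset.sum_congr rfl fun i hi => congrArg _ (Subtype.ext ?_)
  exact eq_of_sum_C_mul_X_pow_eq (c := fun i => (q i).1) (c' := fun i => (q' i).1) h'
    (Finset.mem_range.mp hi)

theorem betaAux_sum (c : ℕ → P m) :
    betaAux stdForm k m (∑ i ∈ Finset.range (k + 1), symMon k i ⊗ₜ[ℂ] c i) =
      ∑ i ∈ Finset.range (k + 1), (c i).1 * (X 0 ^ i * X 1 ^ (k - i)) := by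
  rw [map_sum]
  refine Finset.sum_congr rfl fun i hi => ?_
  rw [betaAux_tmul, symMon_coe (Nat.lt_succ_iff.mp (Finset.mem_range.mp hi)), map_mul, map_pow,
    map_pow, SymmetricAlgebra.lift_ι_apply, SymmetricAlgebra.lift_ι_apply, stdForm_stdVec_zero,
    stdForm_stdVec_one, mul_comm]

theorem betaAux_alpha {N : Type} [AddCommGroup N] [Module ℂ N]
    (lam : N →ₗ[ℂ] MvPolynomial (Fin 4) ℂ) (hlam : ∀ n, lam n ∈ P 1) (v : Fin 2 → N)
    (s : SymPow j N) (p : P (m - 1)) :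
    betaAux lam (j + 1) m (alpha lam hlam j m ((exteriorPower.ιMulti ℂ 2 v ⊗ₜ[ℂ] s) ⊗ₜ[ℂ] p)) =
      0 := by
  rw [alpha_tmul, map_sub, betaAux_tmul, betaAux_tmul, symMul_coe, symMul_coe, formMul_coe,
    formMul_coe, map_mul, map_mul, SymmetricAlgebra.lift_ι_apply, SymmetricAlgebra.lift_ι_apply]
  ring

theorem sum_telescope {T : Type} [AddCommGroup T] {k : ℕ} {y A B : ℕ → T} (h0 : y 0 = -A 0)
    (h : ∀ i < k, y (i + 1) = B i - A (i + 1)) (hk : A k = 0) :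
    ∑ i ∈ Finset.range k, (B i - A i) = ∑ i ∈ Finset.range (k + 1), y i := by
  have h1 : ∑ i ∈ Finset.range k, y (i + 1) = ∑ i ∈ Finset.range k, (B i - A (i + 1)) :=
    Finset.sum_congr rfl fun i hi => h i (Finset.mem_range.mp hi)
  have h2 := Finset.sum_range_succ A k
  rw [Finset.sum_range_succ', hk] at h2
  rw [Finset.sum_range_succ', h1, Finset.sum_sub_distrib, Finset.sum_sub_distrib, h0]
  have h3 := eq_sub_of_add_eq h2
  rw [h3]
  abel

theorem sum_tmul_telescope {S Q : Type} [AddCommGroup S] [Module ℂ S] [AddCommGroup Q] [Module ℂ Q]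
    {k : ℕ} (e : ℕ → S) {c a b : ℕ → Q} (h0 : c 0 = -a 0)
    (h : ∀ i < k, c (i + 1) = b i - a (i + 1)) (hk : a k = 0) :
    ∑ i ∈ Finset.range k, (e (i + 1) ⊗ₜ[ℂ] b i - e i ⊗ₜ[ℂ] a i) =
      ∑ i ∈ Finset.range (k + 1), e i ⊗ₜ[ℂ] c i :=
  sum_telescope (y := fun i => e i ⊗ₜ[ℂ] c i) (A := fun i => e i ⊗ₜ[ℂ] a i)
    (B := fun i => e (i + 1) ⊗ₜ[ℂ] b i) (by simp only [h0, TensorProduct.tmul_neg])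
    (fun i hi => by simp only [h i hi, TensorProduct.tmul_sub])
    (by simp only [hk, TensorProduct.tmul_zero])

/-- The coefficients `q i` provided by `exists_syzygy` are those of a preimage under `α`. -/
theorem exact_std (y : SymPow (j + 1) (Fin 2 → ℂ) ⊗[ℂ] P m) :
    betaAux stdForm (j + 1) m y = 0 ↔ y ∈ Set.range (alpha stdForm stdForm_mem_P j m) := by
  constructor
  · intro hy
    obtain ⟨c, rfl⟩ := exists_eq_sum_tmul (fun s => exists_eq_sum_symMon s) y
    rw [betaAux_sum] at hy
    obtain ⟨q, hq, h0, hi, hk⟩ := exists_syzygy (j + 1) (fun i => (c i).1) (fun i => (c i).2) hy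
    refine ⟨wedgeSum j fun i => ⟨q i, hq i⟩, ?_⟩
    rw [alpha_wedgeSum]
    refine sum_tmul_telescope (symMon (j + 1)) (Subtype.ext ?_) (fun i hij => Subtype.ext ?_)
      (Subtype.ext ?_)
    · change _ = -(formMul stdForm stdForm_mem_P m (stdVec 0) ⟨q 0, hq 0⟩).1
      rw [h0, formMul_coe, stdForm_stdVec_zero]
    · change _ = (formMul stdForm stdForm_mem_P m (stdVec 1) ⟨q i, hq i⟩).1 -
        (formMul stdForm stdForm_mem_P m (stdVec 0) ⟨q (i + 1), hq (i + 1)⟩).1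
      rw [hi i hij, formMul_coe, formMul_coe, stdForm_stdVec_zero, stdForm_stdVec_one]
    · exact (congrArg (stdForm (stdVec 0) * ·) hk).trans (mul_zero _)
  · rintro ⟨x, rfl⟩
    obtain ⟨q, rfl⟩ := exists_eq_wedgeSum x
    rw [wedgeSum, map_sum, map_sum]
    exact Finset.sum_eq_zero fun i _ => betaAux_alpha _ _ _ _ _

/-- Surjectivity of `β` for the standard line. -/
theorem exists_betaAux_eq (hd : d = m + k) {F : MvPolynomial (Fin 4) ℂ} (hF : F ∈ P d)
    (hFk : F ∈ pairIdeal 0 1 k) : ∃ y, betaAux stdForm k m y = F := by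
  obtain ⟨c, rfl⟩ := exists_eq_sum_homogeneous hd hF hFk
  exact ⟨_, betaAux_sum c⟩

end

end LineSing

namespace LineSing

open CoordSpace FamSheaf MvPolynomial ConePoly

/-! ### The exact sequence on the Grassmannian -/

theorem nuForm_mem_P (ℓ : Gr.Pt) (a : nu.fiber ℓ) : nuForm ℓ a ∈ P 1 := by
  have h : nuForm ℓ a = ∑ j : Fin 4, a.1 (Pi.single j 1) • X j := by
    change linForm a.1 = _
    simp [linForm]
  rw [h]
  exact Submodule.sum_mem _ fun j _ => Submodule.smul_mem _ _ (X_mem_P j)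

theorem nuForm_mem_lineIdeal (ℓ : Gr.Pt) (a : nu.fiber ℓ) : nuForm ℓ a ∈ lineIdeal ℓ := by
  refine MvPolynomial.mem_vanishingIdeal_iff.mpr fun v hv => ?_
  have h : aeval v (nuForm ℓ a) = a.1 v := by
    change aeval v (linForm a.1) = _
    have hs : ∀ j : Fin 4, (fun i => if j = i then (1 : ℂ) else 0) = Pi.single j 1 := fun j => by
      funext i
      simp [Pi.single_apply, eq_comm]
    rw [LinearMap.pi_apply_eq_sum_univ a.1 v]
    simp [linForm, hs, mul_comm]
  rw [h]
  exact (Submodule.mem_dualAnnihilator _).mp a.2 v hv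

/-- The map `α` of vector bundles, fibre by fibre. -/
def alphaNu (j : ℕ) (m : ℤ) (ℓ : Gr.Pt) :
    (((wedge2 nu).tensor (sym j nu)).tensor (trivP (m - 1))).fiber ℓ →ₗ[ℂ]
      ((sym (j + 1) nu).tensor (trivP m)).fiber ℓ :=
  alpha (nuForm ℓ) (nuForm_mem_P ℓ) j m

/-- The map `β` of vector bundles, fibre by fibre. -/
def betaNu {k : ℕ} {m d : ℤ} (hd : d = m + k) (ℓ : Gr.Pt) :
    ((sym k nu).tensor (trivP m)).fiber ℓ →ₗ[ℂ] (V k d).fiber ℓ :=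
  beta (nuForm_mem_P ℓ) (nuForm_mem_lineIdeal ℓ) hd

/-- The map `β` for the standard line. -/
def betaStd {k : ℕ} {m d : ℤ} (hd : d = m + k) : SymPow k (Fin 2 → ℂ) ⊗[ℂ] P m →ₗ[ℂ]
    (P d ⊓ (pairIdeal 0 1 k).restrictScalars ℂ : Submodule ℂ (MvPolynomial (Fin 4) ℂ)) :=
  beta stdForm_mem_P stdForm_mem_span hd

/-- The trivializations of `ν` and of the polynomials are compatible. -/
theorem down_nuForm (σ : Equiv.Perm (Fin 4)) (y : chartDomain σ) (a : nu.fiber y.1) :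
    down σ (chartCoord σ y.1) (nuForm y.1 a) = stdForm ((trivNu σ).e y a) := by
  refine Eq.trans ?_ (down_linForm_nuR σ (chartCoord σ y.1) _)
  refine congrArg (fun b => down σ (chartCoord σ y.1) (linForm b))
    (nuR_nuL σ (chartCoord σ y.1) ?_).symm
  rw [chartLine_chartCoord y.2]
  exact a.2

/-- In the trivializations over a chart, `α` and `β` become the constant maps of the standard line,
for which the sequence is exact. -/
theorem isShortExact_alphaNu_betaNu (j : ℕ) {m d : ℤ} (hd : d = m + (j + 1 : ℕ)) :
    IsShortExact (alphaNu j m) (betaNu hd) := by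
  refine isShortExact_of_triv _ _ fun ℓ => ?_
  obtain ⟨σ, hσ⟩ := exists_chartLine ℓ
  refine ⟨chartDomain σ, hσ,
    _, _, _, ?_, _, _, _, ?_, _, _, _, ?_,
    ((trivNu σ).wedge2.tensor ((trivNu σ).sym j)).tensor (trivTrivP σ (m - 1)),
    ((trivNu σ).sym (j + 1)).tensor (trivTrivP σ m), trivV σ (j + 1) d,
    alpha stdForm stdForm_mem_P j m, betaStd hd, ?_, ?_, ?_, ?_, ?_⟩
  · infer_instance
  · infer_instance
  · infer_instance
  · intro y v
    exact alpha_natural (nuForm_mem_P y.1) stdForm_mem_P ((trivNu σ).e y)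
      (down σ (chartCoord σ y.1)) (down_nuForm σ y) _ (fun _ => rfl) _ (fun _ => rfl) v
  · intro y v
    exact Subtype.ext (betaAux_natural ((trivNu σ).e y) (down σ (chartCoord σ y.1))
      (down_nuForm σ y) _ (fun _ => rfl) v)
  · exact alpha_std_injective
  · intro y
    rw [← exact_std]
    exact Subtype.ext_iff
  · intro F
    obtain ⟨y, hy⟩ := exists_betaAux_eq hd F.2.1 F.2.2
    exact ⟨y, Subtype.ext hy⟩

end LineSing
end

open LineSing FamSheaf in
theorem mainTheorem3 (k : ℕ) (hk : 1 ≤ k) (d : ℤ) :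
    ((k : ℤ) - 2 ≤ d → ∀ i : ℕ, 1 ≤ i →
      CategoryTheory.Limits.IsZero ((higherDirectImage proj i).obj (idealPow k d).toSheaf)) ∧
    ((k : ℤ) - 3 ≤ d →
      ∃ (α : ∀ ℓ : Gr.Pt,
            (((wedge2 nu).tensor (sym (k - 1) nu)).tensor (trivP (d - k - 1))).fiber ℓ →ₗ[ℂ]
              ((sym k nu).tensor (trivP (d - k))).fiber ℓ)
        (β : ∀ ℓ : Gr.Pt,
            ((sym k nu).tensor (trivP (d - k))).fiber ℓ →ₗ[ℂ] (V k d).fiber ℓ),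
        IsShortExact α β ∧
        (∀ (ℓ : Gr.Pt) (a b : nu.fiber ℓ) (s : SymPow (k - 1) (nu.fiber ℓ)) (p : P (d - k - 1))
            (as bs : SymPow k (nu.fiber ℓ)) (ap bp : P (d - k)),
          (as : SymmetricAlgebra ℂ (nu.fiber ℓ)) = SymmetricAlgebra.ι ℂ (nu.fiber ℓ) a * s →
          (bs : SymmetricAlgebra ℂ (nu.fiber ℓ)) = SymmetricAlgebra.ι ℂ (nu.fiber ℓ) b * s →
          (ap : MvPolynomial (Fin 4) ℂ) = nuForm ℓ a * p →
          (bp : MvPolynomial (Fin 4) ℂ) = nuForm ℓ b * p →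
          α ℓ ((exteriorPower.ιMulti ℂ 2 ![a, b] ⊗ₜ[ℂ] s) ⊗ₜ[ℂ] p) =
            as ⊗ₜ[ℂ] bp - bs ⊗ₜ[ℂ] ap) ∧
        (∀ (ℓ : Gr.Pt) (s : SymPow k (nu.fiber ℓ)) (p : P (d - k)),
          ((β ℓ (s ⊗ₜ[ℂ] p)).1 : MvPolynomial (Fin 4) ℂ) =
            SymmetricAlgebra.lift (nuForm ℓ) s.1 * p.1)) := by
  refine ⟨fun hd i hi => isZero_higherDirectImage_idealPow hd i hi, fun _ => ?_⟩
  obtain ⟨j, rfl⟩ : ∃ j, k = j + 1 := ⟨k - 1, by omega⟩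
  refine ⟨alphaNu j (d - (j + 1 : ℕ)), betaNu (by ring), isShortExact_alphaNu_betaNu j (by ring),
    fun ℓ a b s p as bs ap bp has hbs hap hbp => ?_, fun ℓ s p => rfl⟩
  obtain rfl : as = symMul (nu.fiber ℓ) j a s := Subtype.ext has
  obtain rfl : bs = symMul (nu.fiber ℓ) j b s := Subtype.ext hbs
  obtain rfl : ap = formMul (nuForm ℓ) (nuForm_mem_P ℓ) _ a p := Subtype.ext hap
  obtain rfl : bp = formMul (nuForm ℓ) (nuForm_mem_P ℓ) _ b p := Subtype.ext hbp
  exact alpha_tmul (nuForm ℓ) (nuForm_mem_P ℓ) j _ ![a, b] s p
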